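/- **Setting.** Let $\Sigma_E$ be a finite signature, and let $E$ be an equational theory over $\Sigma_E$ with at most one associative-commutative (AC) binary symbol $\oplus$, presented by a set $R_E$ of rewrite rules (over $\Sigma_E$ and variables) that is terminating and confluent modulo AC. Messages are the ground terms built from a countably infinite set of names, the constructors $\mathsf{pub}(M)$, $\mathsf{sign}(M,K)$, $\mathsf{blind}(M,K)$, $\langle M,N\rangle$, $\{M\}_K$ (none of them in $\Sigma_E$), and the symbols of $\Sigma_E$. Write $\equiv$ for equality modulo AC and $\approx_E$ for equality modulo $E$. Sequents $\Gamma\vdash M$ consist of a finite set $\Gamma$ of messages and a message $M$, and are assumed to be in $E$-normal form. A message is guarded if it is a name or is headed by a constructor. *Elementary deduction* $\Gamma\Vdash_E M$: there are a context $C[\ldots]$ over $\Sigma_E$ and $M_1,\dots,M_k\in\Gamma$ with $C[M_1,\dots,M_k]\approx_E M$. *System $\mathcal N$* (natural deduction, $\Gamma$ fixed): every $M\in\Gamma$ is derivable; from $M$ and $K$ derive $\{M\}_K$, $\langle M,K\rangle$, $\mathsf{sign}(M,K)$, $\mathsf{blind}(M,K)$; from $M_1,\dots,M_r$ derive $f(M_1,\dots,M_r)$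 for $f\in\Sigma_E$; from $\{M\}_K$ and $K$ derive $M$; from $\langle M,N\rangle$ derive $M$ and derive $N$; from $\mathsf{sign}(M,K)$ and $\mathsf{pub}(K)$ derive $M$; from $\mathsf{blind}(M,K)$ and $K$ derive $M$; from $\mathsf{sign}(\mathsf{blind}(M,R),K)$ and $R$ derive $\mathsf{sign}(M,K)$; from $N$ derive any $M\approx_E N$. *System $\mathcal S$* (sequents): *id*: $\Gamma\vdash M$ if $\Gamma\Vdash_E M$. *cut*: from $\Gamma\vdash M$ and $\Gamma,M\vdash T$ derive $\Gamma\vdash T$. *Right rules*: from $\Gamma\vdash M$ and $\Gamma\vdash K$ derive $\Gamma\vdash c(M,K)$ for each binary constructor $c$. *Left rules* deriving $\Gamma\vdash T$: from $\Gamma,M,N\vdash T$ if $\langle M,N\rangle\in\Gamma$; from $\Gamma\vdash K$ and $\Gamma,M,K\vdash T$ if $\{M\}_K\in\Gamma$, and likewise if $\mathsf{blind}(M,K)\in\Gamma$; from $\Gamma,M\vdash T$ if $\mathsf{sign}(M,K),\mathsf{pub}(L)\in\Gamma$ with $K\equiv L$; from $\Gamma\vdash R$ and $\Gamma,\mathsf{sign}(M,K),R\vdash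 T$ if $\mathsf{sign}(\mathsf{blind}(M,R),K)\in\Gamma$; from $\Gamma\vdash A$ and $\Gamma,A\vdash T$ if $A$ is a guarded subterm of a message in $\Gamma\cup\{T\}$. *System $\mathcal L$* (linear): let $\Gamma\Vdash_{\mathcal R}M$ mean that $\Gamma\vdash M$ is derivable with *id* and the right rules only. The rules of $\mathcal L$ are: $\Gamma\vdash M$ if $\Gamma\Vdash_{\mathcal R}M$; and all left rules of $\mathcal S$ in which the left premise $\Gamma\vdash X$ of each two-premise rule is replaced by the side condition $\Gamma\Vdash_{\mathcal R}X$. *Input and size.* For a set $\Delta$ of messages let $pst(\Delta)$ be the set of proper subterms of its elements and $St(\Delta)=\Delta\cup pst(\Delta)\cup\{\mathsf{sign}(M,N): M,N\in pst(\Delta)\}$. An instance $\Gamma\vdash M$ of a deduction problem is given as the maximally shared DAG of $St(\Gamma\cup\{M\})$ (one node for each element, in any order), each node carrying two tags that say whether its message is in $\Gamma$ and whether it is $M$; its size is $n=|St(\Gamma\cup\{M\})|$. Programs are while programs over binary trees, with unit cost for each elementary operation (forming a pair, head, tail, test for $\mathsf{nil}$). A problem has complexity $O(g(n))$ if some program decides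 every instance of size $n$ (in normal form) in at most $c\,g(n)$ steps, for a constant $c$. **Theorem.** For every such $E$: 1. Derivability in $\mathcal L$ is polynomially reducible to elementary deduction: there is a constant $k$ such that, for every nondecreasing $f:\mathbb N\to\mathbb N$, if $\Vdash_E$ has complexity $O(f(n))$, then $\Vdash_{\mathcal L}$ has complexity $O(n^k f(n))$. The same holds for $\Vdash_{\mathcal S}$ and for $\Vdash_{\mathcal N}$. 2. For every finite $\Gamma$ and every $M$ such that $\Gamma\vdash M$ is in normal form, $\Gamma\Vdash_{\mathcal L}M\iff\Gamma\Vdash_{\mathcal S}M\iff\Gamma\Vdash_{\mathcal N}M$. 3. If $E$ is empty (no rewrite rules and no AC symbol), then $\Vdash_{\mathcal L}$, $\Vdash_{\mathcal S}$ and $\Vdash_{\mathcal N}$ have complexity $O(n^k)$ for some constant $k$; that is, intruder deduction with blind signatures is in polynomial time. -/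

import Mathlib

/-!
Intruder deduction with blind signatures, modulo an AC-convergent equational theory.
-/

namespace Intruder

/-! ### Messages -/

/-- A finite signature of equational symbols: symbols are `0, …, size - 1`, with arities. -/
structure Sig where
  size : ℕ
  arity : Fin size → ℕ

/-- Terms built from the equational symbols only, over a set `X` of variables (or holes). -/
inductive Pat (S : Sig) (X : Type) : Type
  | var (x : X) : Pat S X
  | app (f : Fin S.size) (args : Fin (S.arity f) → Pat S X) : Pat S X

/-- The variables of a pure term. -/
def Pat.vars {S : Sig} {X : Type} : Pat S X → Set X
  | .var x => {x}
  | .app _ args => ⋃ i, (args i).vars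

/-- Ground messages.  The names are the natural numbers. The constructors `pub`, `sign`, `blind`,
`pair`, `enc` are disjoint from the equational symbols.
`sign M K`: `M` signed with `K`; `blind M K`: `M` blinded with `K`; `enc M K`: `M` encrypted
with `K`. -/
inductive Msg (S : Sig) : Type
  | name (a : ℕ) : Msg S
  | pub (M : Msg S) : Msg S
  | sign (M K : Msg S) : Msg S
  | blind (M K : Msg S) : Msg S
  | pair (M N : Msg S) : Msg S
  | enc (M K : Msg S) : Msg S
  | app (f : Fin S.size) (args : Fin (S.arity f) → Msg S) : Msg S

/-- Replace the variables (or fill the holes) of a pure term with messages. -/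
def Pat.inst {S : Sig} {X : Type} (σ : X → Msg S) : Pat S X → Msg S
  | .var x => σ x
  | .app f args => .app f (fun i => (args i).inst σ)

/-- `x ⊕ y`, for a binary symbol `⊕`. -/
def Msg.bin {S : Sig} (f : Fin S.size) (x y : Msg S) : Msg S :=
  .app f (fun i => if i.val = 0 then x else y)

/-- The immediate subterms of a message, from left to right. -/
def Msg.children {S : Sig} : Msg S → List (Msg S)
  | .name _ => []
  | .pub M => [M]
  | .sign M K => [M, K]
  | .blind M K => [M, K]
  | .pair M N => [M, N]
  | .enc M K => [M, K]
  | .app _ args => List.ofFn args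

/-- `M.IsSubterm N`: `M` is a subterm of `N`. -/
def Msg.IsSubterm {S : Sig} : Msg S → Msg S → Prop :=
  Relation.ReflTransGen (fun u v => u ∈ v.children)

/-- A message is guarded if it is a name or is headed by a constructor. -/
def Msg.IsGuarded {S : Sig} : Msg S → Prop
  | .app _ _ => False
  | _ => True

/-- The proper subterms of the messages in `Γ`. -/
def pst {S : Sig} (Γ : Set (Msg S)) : Set (Msg S) :=
  {M | ∃ N ∈ Γ, M.IsSubterm N ∧ M ≠ N}

/-- All `sign M N` where `M` and `N` are proper subterms of messages in `Γ`. -/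
def sst {S : Sig} (Γ : Set (Msg S)) : Set (Msg S) :=
  {U | ∃ M ∈ pst Γ, ∃ N ∈ pst Γ, U = .sign M N}

/-- The saturated set of `Γ`. -/
def St {S : Sig} (Γ : Set (Msg S)) : Set (Msg S) :=
  Γ ∪ pst Γ ∪ sst Γ

/-! ### Equational theories and rewriting modulo AC -/

/-- A rewrite rule over the equational symbols. -/
structure Rule (S : Sig) where
  lhs : Pat S ℕ
  rhs : Pat S ℕ
  lhs_not_var : ∀ x, lhs ≠ .var x
  vars_subset : rhs.vars ⊆ lhs.vars

/-- An equational theory over a finite signature, given by a set of rewrite rules and at most one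
associative-commutative binary symbol. -/
structure Theory where
  sig : Sig
  rules : Set (Rule sig)
  ac : Option (Fin sig.size)
  ac_binary : ∀ f ∈ ac, sig.arity f = 2

/-- Messages over the constructors and the signature of `T`. -/
abbrev Theory.Message (T : Theory) : Type := Msg T.sig

/-- Equality modulo associativity and commutativity (`≡`). -/
inductive ACEq (T : Theory) : T.Message → T.Message → Prop
  | comm {f} (hf : T.ac = some f) (x y : T.Message) : ACEq T (.bin f x y) (.bin f y x)
  | assoc {f} (hf : T.ac = some f) (x y z : T.Message) :
      ACEq T (.bin f (.bin f x y) z) (.bin f x (.bin f y z))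
  | refl (M) : ACEq T M M
  | symm {M N} : ACEq T M N → ACEq T N M
  | trans {M N P} : ACEq T M N → ACEq T N P → ACEq T M P
  | pub {M M'} : ACEq T M M' → ACEq T (.pub M) (.pub M')
  | sign {M M' K K'} : ACEq T M M' → ACEq T K K' → ACEq T (.sign M K) (.sign M' K')
  | blind {M M' K K'} : ACEq T M M' → ACEq T K K' → ACEq T (.blind M K) (.blind M' K')
  | pair {M M' K K'} : ACEq T M M' → ACEq T K K' → ACEq T (.pair M K) (.pair M' K')
  | enc {M M' K K'} : ACEq T M M' → ACEq T K K' → ACEq T (.enc M K) (.enc M' K')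
  | app {f} {a b : Fin (T.sig.arity f) → T.Message} :
      (∀ i, ACEq T (a i) (b i)) → ACEq T (.app f a) (.app f b)

/-- One syntactic application of a rewrite rule, at any position. -/
inductive Rew (T : Theory) : T.Message → T.Message → Prop
  | root {r : Rule T.sig} (hr : r ∈ T.rules) (σ : ℕ → T.Message) :
      Rew T (r.lhs.inst σ) (r.rhs.inst σ)
  | pub {M M'} : Rew T M M' → Rew T (.pub M) (.pub M')
  | sign_left {M M'} (K) : Rew T M M' → Rew T (.sign M K) (.sign M' K)
  | sign_right {K K'} (M) : Rew T K K' → Rew T (.sign M K) (.sign M K')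
  | blind_left {M M'} (K) : Rew T M M' → Rew T (.blind M K) (.blind M' K)
  | blind_right {K K'} (M) : Rew T K K' → Rew T (.blind M K) (.blind M K')
  | pair_left {M M'} (K) : Rew T M M' → Rew T (.pair M K) (.pair M' K)
  | pair_right {K K'} (M) : Rew T K K' → Rew T (.pair M K) (.pair M K')
  | enc_left {M M'} (K) : Rew T M M' → Rew T (.enc M K) (.enc M' K)
  | enc_right {K K'} (M) : Rew T K K' → Rew T (.enc M K) (.enc M K')
  | app {f} (a : Fin (T.sig.arity f) → T.Message) (i : Fin (T.sig.arity f)) {M'} :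
      Rew T (a i) M' → Rew T (.app f a) (.app f (Function.update a i M'))

/-- One rewrite step modulo AC. -/
def Step (T : Theory) (M N : T.Message) : Prop :=
  ∃ M' N', ACEq T M M' ∧ Rew T M' N' ∧ ACEq T N' N

/-- Equality modulo the theory (`≈`). -/
def EqE (T : Theory) : T.Message → T.Message → Prop :=
  Relation.EqvGen (fun M N => ACEq T M N ∨ Rew T M N)

/-- Normal forms for rewriting modulo AC. -/
def IsNormal (T : Theory) (M : T.Message) : Prop :=
  ∀ N, ¬ Step T M N

/-- Rewriting modulo AC is terminating and confluent modulo AC. (As there are infinitely many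
names, and no name occurs in a rule, it makes no difference that this speaks of ground terms.) -/
structure ACConvergent (T : Theory) : Prop where
  terminating : WellFounded (fun N M => Step T M N)
  confluent : ∀ M N₁ N₂, Relation.ReflTransGen (Step T) M N₁ →
    Relation.ReflTransGen (Step T) M N₂ →
    ∃ P₁ P₂, Relation.ReflTransGen (Step T) N₁ P₁ ∧ Relation.ReflTransGen (Step T) N₂ P₂ ∧
      ACEq T P₁ P₂

/-! ### Deduction systems

In the rules below, an instance `Γ, A ⊢ M` of the left-hand side notation is a sequent `Γ ⊢ M`
with `A ∈ Γ`, and `Γ, A ⊢ M` in a premise is `insert A Γ ⊢ M`. -/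

/-- Elementary deduction: `M ≈ C[M₁, …, Mₖ]` for an equational context `C` with holes indexed by
`Fin k` and messages `M₁, …, Mₖ ∈ Γ`. -/
def Elem (T : Theory) (Γ : Set T.Message) (M : T.Message) : Prop :=
  ∃ (k : ℕ) (C : Pat T.sig (Fin k)) (A : Fin k → T.Message),
    (∀ i, A i ∈ Γ) ∧ EqE T M (C.inst A)

/-- The natural deduction system. -/
inductive NatDed (T : Theory) (Γ : Set T.Message) : T.Message → Prop
  | id {M} : M ∈ Γ → NatDed T Γ M
  | enc_elim {M K} : NatDed T Γ (.enc M K) → NatDed T Γ K → NatDed T Γ M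
  | enc_intro {M K} : NatDed T Γ M → NatDed T Γ K → NatDed T Γ (.enc M K)
  | pair_elim₁ {M N} : NatDed T Γ (.pair M N) → NatDed T Γ M
  | pair_elim₂ {M N} : NatDed T Γ (.pair M N) → NatDed T Γ N
  | pair_intro {M N} : NatDed T Γ M → NatDed T Γ N → NatDed T Γ (.pair M N)
  | sign_elim {M K} : NatDed T Γ (.sign M K) → NatDed T Γ (.pub K) → NatDed T Γ M
  | sign_intro {M K} : NatDed T Γ M → NatDed T Γ K → NatDed T Γ (.sign M K)
  | blind_elim₁ {M K} : NatDed T Γ (.blind M K) → NatDed T Γ K → NatDed T Γ M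
  | blind_intro {M K} : NatDed T Γ M → NatDed T Γ K → NatDed T Γ (.blind M K)
  | blind_elim₂ {M R K} : NatDed T Γ (.sign (.blind M R) K) → NatDed T Γ R →
      NatDed T Γ (.sign M K)
  | app_intro {f} {A : Fin (T.sig.arity f) → T.Message} :
      (∀ i, NatDed T Γ (A i)) → NatDed T Γ (.app f A)
  | conv {M N} : NatDed T Γ N → EqE T M N → NatDed T Γ M

/-- The sequent system. Its sequents are in normal form: as every rule but `cut` leads from a
normal conclusion to normal premises, only the cut message needs a proviso. -/
inductive SeqDed (T : Theory) : Set T.Message → T.Message → Prop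
  | id {Γ M} : Elem T Γ M → SeqDed T Γ M
  | cut {Γ M U} : IsNormal T M → SeqDed T Γ M → SeqDed T (insert M Γ) U → SeqDed T Γ U
  | pair_left {Γ M N U} : .pair M N ∈ Γ → SeqDed T (insert M (insert N Γ)) U → SeqDed T Γ U
  | pair_right {Γ M N} : SeqDed T Γ M → SeqDed T Γ N → SeqDed T Γ (.pair M N)
  | enc_left {Γ M K U} : .enc M K ∈ Γ → SeqDed T Γ K →
      SeqDed T (insert M (insert K Γ)) U → SeqDed T Γ U
  | enc_right {Γ M K} : SeqDed T Γ M → SeqDed T Γ K → SeqDed T Γ (.enc M K)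
  | sign_left {Γ M K L U} : .sign M K ∈ Γ → .pub L ∈ Γ → ACEq T K L →
      SeqDed T (insert M Γ) U → SeqDed T Γ U
  | sign_right {Γ M K} : SeqDed T Γ M → SeqDed T Γ K → SeqDed T Γ (.sign M K)
  | blind_left₁ {Γ M K U} : .blind M K ∈ Γ → SeqDed T Γ K →
      SeqDed T (insert M (insert K Γ)) U → SeqDed T Γ U
  | blind_right {Γ M K} : SeqDed T Γ M → SeqDed T Γ K → SeqDed T Γ (.blind M K)
  | blind_left₂ {Γ M R K U} : .sign (.blind M R) K ∈ Γ → SeqDed T Γ R →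
      SeqDed T (insert (.sign M K) (insert R Γ)) U → SeqDed T Γ U
  | gs {Γ A U} : A.IsGuarded → (∃ N ∈ insert U Γ, A.IsSubterm N) → SeqDed T Γ A →
      SeqDed T (insert A Γ) U → SeqDed T Γ U

/-- Derivability with `id` and the right rules only. -/
inductive RightDed (T : Theory) (Γ : Set T.Message) : T.Message → Prop
  | id {M} : Elem T Γ M → RightDed T Γ M
  | pair_right {M N} : RightDed T Γ M → RightDed T Γ N → RightDed T Γ (.pair M N)
  | enc_right {M K} : RightDed T Γ M → RightDed T Γ K → RightDed T Γ (.enc M K)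
  | sign_right {M K} : RightDed T Γ M → RightDed T Γ K → RightDed T Γ (.sign M K)
  | blind_right {M K} : RightDed T Γ M → RightDed T Γ K → RightDed T Γ (.blind M K)

/-- The linear system. -/
inductive LinDed (T : Theory) : Set T.Message → T.Message → Prop
  | r {Γ M} : RightDed T Γ M → LinDed T Γ M
  | le {Γ M K U} : .enc M K ∈ Γ → RightDed T Γ K →
      LinDed T (insert M (insert K Γ)) U → LinDed T Γ U
  | lp {Γ M N U} : .pair M N ∈ Γ → LinDed T (insert M (insert N Γ)) U → LinDed T Γ U
  | sign {Γ M K L U} : .sign M K ∈ Γ → .pub L ∈ Γ → ACEq T K L →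
      LinDed T (insert M Γ) U → LinDed T Γ U
  | blind₁ {Γ M K U} : .blind M K ∈ Γ → RightDed T Γ K →
      LinDed T (insert M (insert K Γ)) U → LinDed T Γ U
  | blind₂ {Γ M R K U} : .sign (.blind M R) K ∈ Γ → RightDed T Γ R →
      LinDed T (insert (.sign M K) (insert R Γ)) U → LinDed T Γ U
  | ls {Γ A U} : A.IsGuarded → (∃ N ∈ insert U Γ, A.IsSubterm N) → RightDed T Γ A →
      LinDed T (insert A Γ) U → LinDed T Γ U

/-- The sequent `Γ ⊢ M` is in normal form. -/
def NormalSequent (T : Theory) (Γ : Set T.Message) (M : T.Message) : Prop :=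
  ∀ N ∈ insert M Γ, IsNormal T N

/-! ### The machine model

The language of while programs over binary trees, with unit cost for each elementary operation on
trees (a pointer operation: there is no unit-cost comparison of trees other than the test
for `nil`). This is a standard model, polynomially equivalent to Turing machines. -/

/-- The data of while programs. -/
inductive Tree : Type
  | nil : Tree
  | cons (l r : Tree) : Tree

/-- The head of a tree; `nil` has head `nil`. -/
def Tree.hd : Tree → Tree
  | .nil => .nil
  | .cons l _ => l

/-- The tail of a tree; `nil` has tail `nil`. -/
def Tree.tl : Tree → Tree
  | .nil => .nil
  | .cons _ r => r

/-- Expressions over the registers `0, 1, 2, …`. -/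
inductive Expr : Type
  | reg (i : ℕ) : Expr
  | nil : Expr
  | cons (a b : Expr) : Expr
  | hd (a : Expr) : Expr
  | tl (a : Expr) : Expr

/-- The contents of the registers. -/
abbrev Store : Type := ℕ → Tree

/-- The value of an expression. -/
def Expr.eval (s : Store) : Expr → Tree
  | .reg i => s i
  | .nil => .nil
  | .cons a b => .cons (a.eval s) (b.eval s)
  | .hd a => (a.eval s).hd
  | .tl a => (a.eval s).tl

/-- The number of steps for evaluating an expression. -/
def Expr.cost : Expr → ℕ
  | .reg _ => 1
  | .nil => 1
  | .cons a b => a.cost + b.cost + 1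
  | .hd a => a.cost + 1
  | .tl a => a.cost + 1

/-- While programs. A tree counts as true if it is not `nil`. -/
inductive Prog : Type
  | assign (i : ℕ) (e : Expr) : Prog
  | seq (p q : Prog) : Prog
  | ite (e : Expr) (p q : Prog) : Prog
  | loop (e : Expr) (p : Prog) : Prog

/-- `Exec p s t s'`: started in store `s`, the program `p` halts after `t` steps in store `s'`. -/
inductive Exec : Prog → Store → ℕ → Store → Prop
  | assign (i e s) : Exec (.assign i e) s (e.cost + 1) (Function.update s i (e.eval s))
  | seq {p q s₁ s₂ s₃ t u} : Exec p s₁ t s₂ → Exec q s₂ u s₃ → Exec (.seq p q) s₁ (t + u) s₃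
  | ite_true {e p q s s' t} : e.eval s ≠ .nil → Exec p s t s' →
      Exec (.ite e p q) s (e.cost + 1 + t) s'
  | ite_false {e p q s s' t} : e.eval s = .nil → Exec q s t s' →
      Exec (.ite e p q) s (e.cost + 1 + t) s'
  | loop_true {e p s₁ s₂ s₃ t u} : e.eval s₁ ≠ .nil → Exec p s₁ t s₂ →
      Exec (.loop e p) s₂ u s₃ → Exec (.loop e p) s₁ (e.cost + 1 + t + u) s₃
  | loop_false {e p s} : e.eval s = .nil → Exec (.loop e p) s (e.cost + 1) s

/-- The initial store: the input is in register `0`. -/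
def initStore (x : Tree) : Store := Function.update (fun _ => Tree.nil) 0 x

/-! ### Encoding of problem instances as tagged DAGs -/

/-- Numbers in unary. -/
def Tree.ofNat : ℕ → Tree
  | 0 => .nil
  | n + 1 => .cons .nil (Tree.ofNat n)

/-- Lists of trees. -/
def Tree.ofList : List Tree → Tree
  | [] => .nil
  | x :: xs => .cons x (Tree.ofList xs)

open Classical in
/-- Truth values. -/
noncomputable def Tree.ofProp (p : Prop) : Tree :=
  if p then .cons .nil .nil else .nil

/-- The label of a node of the DAG: the name or the head symbol. -/
def Msg.label {S : Sig} : Msg S → Tree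
  | .name a => .cons (.ofNat 0) (.ofNat a)
  | .pub _ => .cons (.ofNat 1) .nil
  | .sign _ _ => .cons (.ofNat 2) .nil
  | .blind _ _ => .cons (.ofNat 3) .nil
  | .pair _ _ => .cons (.ofNat 4) .nil
  | .enc _ _ => .cons (.ofNat 5) .nil
  | .app f _ => .cons (.ofNat 6) (.ofNat f.val)

open Classical in
/-- A node of the DAG, for the message `u` in the enumeration `l` of the messages represented
by the DAG: two tags (is `u` in `Γ`? is `u` the goal `M`?), the label, and the list of pointers to
the immediate subterms of `u`, which are their positions in `l`. -/
noncomputable def encodeNode {S : Sig} (l : List (Msg S)) (Γ : Set (Msg S)) (M u : Msg S) : Tree :=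
  .cons (.ofProp (u ∈ Γ)) (.cons (.ofProp (u = M))
    (.cons u.label (.ofList (u.children.map (fun v => .ofNat (l.idxOf v))))))

/-- The DAG with node list `l`, tagged with the sequent `Γ ⊢ M`. -/
noncomputable def encodeDAG {S : Sig} (l : List (Msg S)) (Γ : Set (Msg S)) (M : Msg S) : Tree :=
  .ofList (l.map (encodeNode l Γ M))

/-- `l` lists the saturated set of `Γ ∪ {M}`, without repetition (maximal sharing) and in any
order. -/
def Enumerates {S : Sig} (l : List (Msg S)) (Γ : Set (Msg S)) (M : Msg S) : Prop :=
  l.Nodup ∧ ∀ u, u ∈ l ↔ u ∈ St (insert M Γ)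

/-! ### Complexity of deduction problems -/

/-- The deduction problem `D`, for sequents in normal form, has complexity `O(g(n))`:
some while program decides it, in at most `c * g n` steps, where the input is a tagged DAG
of the saturated set of `Γ ∪ {M}` and `n` is the cardinality of this set.
The answer is yes if register `0` is not `nil` in the end. -/
def HasComplexity (T : Theory) (D : Set T.Message → T.Message → Prop) (g : ℕ → ℕ) : Prop :=
  ∃ (p : Prog) (c : ℕ), ∀ (Γ : Set T.Message) (M : T.Message) (l : List T.Message),
    NormalSequent T Γ M → Enumerates l Γ M →
    ∃ (t : ℕ) (s : Store), Exec p (initStore (encodeDAG l Γ M)) t s ∧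
      t ≤ c * g (St (insert M Γ)).ncard ∧ (s 0 ≠ Tree.nil ↔ D Γ M)

/-- The deduction problem `D` is polynomially reducible to elementary deduction. -/
def PolyReducible (T : Theory) (D : Set T.Message → T.Message → Prop) : Prop :=
  ∃ k : ℕ, ∀ f : ℕ → ℕ, Monotone f →
    HasComplexity T (Elem T) f → HasComplexity T D (fun n => n ^ k * f n)

/-- The deduction problem `D` is decidable in polynomial time. -/
def InPTime (T : Theory) (D : Set T.Message → T.Message → Prop) : Prop :=
  ∃ k : ℕ, HasComplexity T D (fun n => n ^ k)

end Intruder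

namespace Intruder

/-! ### Equality modulo the theory -/

section Equality

variable {T : Theory}

/-! The theory cannot look inside a guarded message. Rules are pure and their left-hand sides are
not variables, so a substitution of maximal guarded subterms that respects `≈` below constructors
also respects `≈` (`GuardedCong.eqE`). Names are distinct normal forms, so well-chosen substitutions
yield everything needed: equal guarded messages have the same constructor and equal arguments
(`EqE.guarded_inv`), and a guarded message obtained by elementary deduction is equal to a guarded
message already present (`ElemI.exists_eqE_of_isGuarded`).

The central notion is a set `Δ` that is `Closed` inside a child-closed set `S`: every rule with
premises in `Δ` and conclusion in `S` stays in `Δ`. Two facts carry the proof. Whatever natural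
deduction derives from a subset of `Δ` can be synthesized from `Δ` by constructors and equational
symbols alone (`Closed.syn_of_natDed`; this is cut elimination in semantic form). A synthesized
message that lies in `S` already lies in `Δ` (`Closed.mem_of_syn`). Hence a closed set whose
elements are derivable decides derivability of the elements of `S`.

This is used twice. For the equivalence of the systems, `L` embeds in the sequent system and the
sequent system in natural deduction; for the way back, a maximal set of hypotheses reachable by left
rules of `L`, completed with the right-derivable subterms, is closed (`NatDed.linDed`). For
complexity, an operator applying all rules once to the nodes of the saturated DAG is iterated as
many times as there are nodes; the fixed point `sat` is closed and sound, so it contains the goal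
exactly when the goal is derivable (`goal_mem_sat_iff`). Each step asks polynomially many elementary
questions, all about sub-DAGs of the input. AC-equality of keys is such a question too: `K ≡ L`
holds exactly when `sign L L` is elementarily deducible from `sign K K`.

The running time is handled by a calculus of combinators for `PolyTime`. Its parameter `w` charges
calls to the elementary decision procedure, with one polynomial exponent for all procedures at once.
In the empty theory `≈` is identity and elementary deduction is itself such a fixed point. -/

theorem EqE.refl (M : T.Message) : EqE T M M := Relation.EqvGen.refl M

theorem EqE.symm {M N : T.Message} (h : EqE T M N) : EqE T N M := Relation.EqvGen.symm _ _ h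

theorem EqE.trans {M N P : T.Message} (h : EqE T M N) (h' : EqE T N P) : EqE T M P :=
  Relation.EqvGen.trans _ _ _ h h'

theorem ACEq.eqE {M N : T.Message} (h : ACEq T M N) : EqE T M N :=
  Relation.EqvGen.rel _ _ (.inl h)

theorem Rew.eqE {M N : T.Message} (h : Rew T M N) : EqE T M N :=
  Relation.EqvGen.rel _ _ (.inr h)

/-- A unary operation compatible with the generators of `≈` is compatible with `≈`. -/
theorem EqE.map (F : T.Message → T.Message) (hA : ∀ M N, ACEq T M N → EqE T (F M) (F N))
    (hR : ∀ M N, Rew T M N → EqE T (F M) (F N)) {M N : T.Message} (h : EqE T M N) :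
    EqE T (F M) (F N) := by
  induction h with
  | rel x y h => exact h.elim (hA x y) (hR x y)
  | refl x => exact EqE.refl _
  | symm x y _ ih => exact ih.symm
  | trans x y z _ _ ih₁ ih₂ => exact ih₁.trans ih₂

theorem EqE.pub {M M' : T.Message} (h : EqE T M M') : EqE T (.pub M) (.pub M') :=
  h.map _ (fun _ _ h => (ACEq.pub h).eqE) (fun _ _ h => (Rew.pub h).eqE)

theorem EqE.sign {M M' K K' : T.Message} (h : EqE T M M') (h' : EqE T K K') :
    EqE T (.sign M K) (.sign M' K') :=
  (h.map (fun x => .sign x K) (fun _ _ h => (ACEq.sign h (.refl _)).eqE)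
    (fun _ _ h => (Rew.sign_left _ h).eqE)).trans
  (h'.map (fun x => .sign M' x) (fun _ _ h => (ACEq.sign (.refl _) h).eqE)
    (fun _ _ h => (Rew.sign_right _ h).eqE))

theorem EqE.blind {M M' K K' : T.Message} (h : EqE T M M') (h' : EqE T K K') :
    EqE T (.blind M K) (.blind M' K') :=
  (h.map (fun x => .blind x K) (fun _ _ h => (ACEq.blind h (.refl _)).eqE)
    (fun _ _ h => (Rew.blind_left _ h).eqE)).trans
  (h'.map (fun x => .blind M' x) (fun _ _ h => (ACEq.blind (.refl _) h).eqE)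
    (fun _ _ h => (Rew.blind_right _ h).eqE))

theorem EqE.pair {M M' K K' : T.Message} (h : EqE T M M') (h' : EqE T K K') :
    EqE T (.pair M K) (.pair M' K') :=
  (h.map (fun x => .pair x K) (fun _ _ h => (ACEq.pair h (.refl _)).eqE)
    (fun _ _ h => (Rew.pair_left _ h).eqE)).trans
  (h'.map (fun x => .pair M' x) (fun _ _ h => (ACEq.pair (.refl _) h).eqE)
    (fun _ _ h => (Rew.pair_right _ h).eqE))

theorem EqE.enc {M M' K K' : T.Message} (h : EqE T M M') (h' : EqE T K K') :
    EqE T (.enc M K) (.enc M' K') :=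
  (h.map (fun x => .enc x K) (fun _ _ h => (ACEq.enc h (.refl _)).eqE)
    (fun _ _ h => (Rew.enc_left _ h).eqE)).trans
  (h'.map (fun x => .enc M' x) (fun _ _ h => (ACEq.enc (.refl _) h).eqE)
    (fun _ _ h => (Rew.enc_right _ h).eqE))

theorem ACEq.app_update {f : Fin T.sig.size} (a : Fin (T.sig.arity f) → T.Message)
    (i : Fin (T.sig.arity f)) {x y : T.Message} (h : ACEq T x y) :
    ACEq T (.app f (Function.update a i x)) (.app f (Function.update a i y)) := by
  refine ACEq.app fun j => ?_
  rcases eq_or_ne j i with rfl | hj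
  · simpa using h
  · simpa [hj] using ACEq.refl _

theorem Rew.app_update {f : Fin T.sig.size} (a : Fin (T.sig.arity f) → T.Message)
    (i : Fin (T.sig.arity f)) {x y : T.Message} (h : Rew T x y) :
    Rew T (.app f (Function.update a i x)) (.app f (Function.update a i y)) := by
  have := Rew.app (Function.update a i x) i (M' := y) (by simpa using h)
  simpa using this

theorem EqE.app {f : Fin T.sig.size} {a b : Fin (T.sig.arity f) → T.Message}
    (h : ∀ i, EqE T (a i) (b i)) : EqE T (.app f a) (.app f b) := by
  -- The arguments are exchanged one at a time, since a rewrite step acts at a single position.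
  have key : ∀ s : Finset (Fin (T.sig.arity f)), EqE T (.app f a) (.app f (s.piecewise b a)) := by
    intro s
    induction s using Finset.induction_on with
    | empty => simpa using EqE.refl _
    | insert j s hj ih =>
      rw [Finset.piecewise_insert]
      refine ih.trans ?_
      have := (h j).map (fun x => .app f (Function.update (s.piecewise b a) j x))
        (fun _ _ h => (ACEq.app_update _ j h).eqE) (fun _ _ h => (Rew.app_update _ j h).eqE)
      convert this using 2
      rw [eq_comm, Function.update_eq_self_iff]
      simp [hj]
  simpa using key Finset.univ

/-- Confluence: equal messages have a common reduct modulo AC. -/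
theorem EqE.join (hT : ACConvergent T) {M N : T.Message} (h : EqE T M N) :
    ∃ P Q, Relation.ReflTransGen (Step T) M P ∧ Relation.ReflTransGen (Step T) N Q ∧
      ACEq T P Q := by
  -- `Step` is a relation modulo AC, so an AC-equality in front of a nonempty reduction is absorbed
  -- by its first step.
  have absorb : ∀ {a b c : T.Message}, ACEq T a b → Relation.ReflTransGen (Step T) b c →
      ∃ d, Relation.ReflTransGen (Step T) a d ∧ ACEq T d c := by
    intro a b c hab hbc
    rcases Relation.ReflTransGen.cases_head hbc with rfl | ⟨b', ⟨x, y, h₁, h₂, h₃⟩, hb'⟩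
    · exact ⟨a, .refl, hab⟩
    · exact ⟨c, .head ⟨x, y, hab.trans h₁, h₂, h₃⟩ hb', .refl _⟩
  induction h with
  | rel x y h =>
    rcases h with h | h
    · exact ⟨x, y, .refl, .refl, h⟩
    · exact ⟨y, y, .single ⟨x, y, .refl _, h, .refl _⟩, .refl, .refl _⟩
  | refl x => exact ⟨x, x, .refl, .refl, .refl _⟩
  | symm x y _ ih =>
    obtain ⟨P, Q, h₁, h₂, h₃⟩ := ih
    exact ⟨Q, P, h₂, h₁, h₃.symm⟩
  | trans x y z _ _ ih₁ ih₂ =>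
    obtain ⟨P, Q, h₁, h₂, h₃⟩ := ih₁
    obtain ⟨P', Q', h₁', h₂', h₃'⟩ := ih₂
    obtain ⟨R, R', h₄, h₅, h₆⟩ := hT.confluent y Q P' h₂ h₁'
    obtain ⟨U, h₇, h₈⟩ := absorb h₃ h₄
    obtain ⟨U', h₉, h₁₀⟩ := absorb h₃'.symm h₅
    exact ⟨U, U', h₁.trans h₇, h₂'.trans h₉, h₈.trans (h₆.trans h₁₀.symm)⟩

theorem IsNormal.eq_of_steps {M N : T.Message} (hM : IsNormal T M)
    (h : Relation.ReflTransGen (Step T) M N) : M = N := by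
  rcases Relation.ReflTransGen.cases_head h with h | ⟨P, hP, _⟩
  · exact h
  · exact absurd hP (hM P)

theorem EqE.acEq (hT : ACConvergent T) {M N : T.Message} (hM : IsNormal T M) (hN : IsNormal T N)
    (h : EqE T M N) : ACEq T M N := by
  obtain ⟨P, Q, h₁, h₂, h₃⟩ := h.join hT
  rwa [← hM.eq_of_steps h₁, ← hN.eq_of_steps h₂] at h₃

theorem ACEq.name_iff {M N : T.Message} (h : ACEq T M N) (a : ℕ) : M = .name a ↔ N = .name a := by
  induction h with
  | refl => rfl
  | symm _ ih => exact ih.symm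
  | trans _ _ ih₁ ih₂ => exact ih₁.trans ih₂
  | _ => simp [Msg.bin]

/-- Both directions are proved together so that the symmetry case of the induction goes through. -/
theorem ACEq.sign_inv {M N : T.Message} (h : ACEq T M N) :
    (∀ A B, M = .sign A B → ∃ A' B', N = .sign A' B' ∧ ACEq T A A' ∧ ACEq T B B') ∧
    (∀ A B, N = .sign A B → ∃ A' B', M = .sign A' B' ∧ ACEq T A A' ∧ ACEq T B B') := by
  induction h with
  | refl => exact ⟨fun A B h => ⟨A, B, h, .refl _, .refl _⟩, fun A B h => ⟨A, B, h, .refl _, .refl _⟩⟩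
  | symm _ ih => exact ⟨ih.2, ih.1⟩
  | trans _ _ ih₁ ih₂ =>
    constructor
    · intro A B h
      obtain ⟨A', B', h, hA, hB⟩ := ih₁.1 A B h
      obtain ⟨A'', B'', h, hA', hB'⟩ := ih₂.1 A' B' h
      exact ⟨A'', B'', h, hA.trans hA', hB.trans hB'⟩
    · intro A B h
      obtain ⟨A', B', h, hA, hB⟩ := ih₂.2 A B h
      obtain ⟨A'', B'', h, hA', hB'⟩ := ih₁.2 A' B' h
      exact ⟨A'', B'', h, hA.trans hA', hB.trans hB'⟩
  | @sign M M' K K' h₁ h₂ _ _ =>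
    constructor
    · rintro A B h
      cases h
      exact ⟨_, _, rfl, h₁, h₂⟩
    · rintro A B h
      cases h
      exact ⟨_, _, rfl, h₁.symm, h₂.symm⟩
  | _ => simp [Msg.bin]

theorem Rule.lhs_inst_eq_app (r : Rule T.sig) (σ : ℕ → T.Message) :
    ∃ f a, r.lhs.inst σ = .app f a := by
  cases h : r.lhs with
  | var x => exact absurd h (r.lhs_not_var x)
  | app f a => exact ⟨f, _, rfl⟩

theorem isNormal_name (a : ℕ) : IsNormal T (.name a) := by
  rintro N ⟨M', N', h, hr, -⟩
  rw [(h.name_iff a).1 rfl] at hr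
  generalize hx : (Msg.name a : T.Message) = x at hr
  cases hr with
  | @root r _ σ =>
    obtain ⟨f, b, hb⟩ := Rule.lhs_inst_eq_app r σ
    rw [hb] at hx; cases hx
  | _ => cases hx

/-- A left-hand side is headed by an equational symbol, so `sign A B` is never a redex at the root.
This makes the added elements `sign M N` of the saturated set normal. -/
theorem IsNormal.sign {A B : T.Message} (hA : IsNormal T A) (hB : IsNormal T B) :
    IsNormal T (.sign A B) := by
  rintro N ⟨M', N', h, hr, -⟩
  obtain ⟨A', B', rfl, h₁, h₂⟩ := h.sign_inv.1 A B rfl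
  generalize hx : (Msg.sign A' B' : T.Message) = x at hr
  cases hr with
  | @root r _ σ =>
    obtain ⟨f, b, hb⟩ := Rule.lhs_inst_eq_app r σ
    rw [hb] at hx; cases hx
  | sign_left K h => cases hx; exact hA _ ⟨_, _, h₁, h, .refl _⟩
  | sign_right K h => cases hx; exact hB _ ⟨_, _, h₂, h, .refl _⟩
  | _ => cases hx

theorem IsNormal.child {M N : T.Message} (hN : IsNormal T N) (h : M ∈ N.children) :
    IsNormal T M := by
  rintro P ⟨M', N', h₁, h₂, -⟩
  cases N with
  | name a => simp [Msg.children] at h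
  | pub A =>
    simp only [Msg.children, List.mem_singleton] at h
    subst h
    exact hN _ ⟨_, _, .pub h₁, .pub h₂, .refl _⟩
  | sign A B =>
    simp only [Msg.children, List.mem_cons, List.not_mem_nil, or_false] at h
    rcases h with rfl | rfl
    · exact hN _ ⟨_, _, .sign h₁ (.refl _), .sign_left _ h₂, .refl _⟩
    · exact hN _ ⟨_, _, .sign (.refl _) h₁, .sign_right _ h₂, .refl _⟩
  | blind A B =>
    simp only [Msg.children, List.mem_cons, List.not_mem_nil, or_false] at h
    rcases h with rfl | rfl
    · exact hN _ ⟨_, _, .blind h₁ (.refl _), .blind_left _ h₂, .refl _⟩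
    · exact hN _ ⟨_, _, .blind (.refl _) h₁, .blind_right _ h₂, .refl _⟩
  | pair A B =>
    simp only [Msg.children, List.mem_cons, List.not_mem_nil, or_false] at h
    rcases h with rfl | rfl
    · exact hN _ ⟨_, _, .pair h₁ (.refl _), .pair_left _ h₂, .refl _⟩
    · exact hN _ ⟨_, _, .pair (.refl _) h₁, .pair_right _ h₂, .refl _⟩
  | enc A B =>
    simp only [Msg.children, List.mem_cons, List.not_mem_nil, or_false] at h
    rcases h with rfl | rfl
    · exact hN _ ⟨_, _, .enc h₁ (.refl _), .enc_left _ h₂, .refl _⟩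
    · exact hN _ ⟨_, _, .enc (.refl _) h₁, .enc_right _ h₂, .refl _⟩
  | app f a =>
    simp only [Msg.children, List.mem_ofFn] at h
    obtain ⟨i, rfl⟩ := h
    have := ACEq.app_update a i h₁
    rw [Function.update_eq_self] at this
    exact hN _ ⟨_, _, this, Rew.app_update a i h₂, .refl _⟩

/-- This is the consistency of the theory, and the target of the substitution arguments below: they
produce an equality of names. -/
theorem eq_of_name_eqE_name (hT : ACConvergent T) {a b : ℕ}
    (h : EqE T (.name a) (.name b)) : a = b := by
  have := (h.acEq hT (isNormal_name a) (isNormal_name b)).name_iff a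
  simpa [eq_comm] using this

end Equality

/-! ### Replacing maximal guarded subterms -/

/-- Replace every maximal guarded subterm `g` by `h g`. -/
def Msg.mapGuarded {S : Sig} (h : Msg S → Msg S) : Msg S → Msg S
  | .app f a => .app f (fun i => (a i).mapGuarded h)
  | .name a => h (.name a)
  | .pub M => h (.pub M)
  | .sign M K => h (.sign M K)
  | .blind M K => h (.blind M K)
  | .pair M K => h (.pair M K)
  | .enc M K => h (.enc M K)

theorem Msg.IsGuarded.mapGuarded {S : Sig} {M : Msg S} (hM : M.IsGuarded) (h : Msg S → Msg S) :
    M.mapGuarded h = h M := by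
  cases M <;> first | rfl | exact hM.elim

theorem Pat.mapGuarded_inst {S : Sig} {X : Type} (h : Msg S → Msg S) (σ : X → Msg S)
    (C : Pat S X) : (C.inst σ).mapGuarded h = C.inst (fun x => (σ x).mapGuarded h) := by
  induction C with
  | var x => rfl
  | app f a ih => simp only [Pat.inst, Msg.mapGuarded, ih]

/-- A set of messages that contains the immediate subterms of its elements. -/
def ChildClosed {S : Sig} (X : Set (Msg S)) : Prop := ∀ v ∈ X, ∀ u ∈ v.children, u ∈ X

theorem mapGuarded_eq_self {S : Sig} {h : Msg S → Msg S} {X : Set (Msg S)} (hX : ChildClosed X)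
    (hh : ∀ g ∈ X, g.IsGuarded → h g = g) : ∀ M ∈ X, M.mapGuarded h = M := by
  intro M
  induction M with
  | app f a ih =>
    intro hM
    simp only [Msg.mapGuarded, Msg.app.injEq, heq_eq_eq, true_and]
    funext i
    exact ih i (hX _ hM _ (by simp [Msg.children]))
  | _ => exact fun hM => hh _ hM trivial

section MapGuarded

variable {T : Theory}

/-- A map on guarded messages that respects `≈` of the arguments of constructors. -/
structure GuardedCong (T : Theory) (h : T.Message → T.Message) : Prop where
  pub : ∀ {M M'}, EqE T M M' → EqE T (h (.pub M)) (h (.pub M'))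
  sign : ∀ {M M' K K'}, EqE T M M' → EqE T K K' → EqE T (h (.sign M K)) (h (.sign M' K'))
  blind : ∀ {M M' K K'}, EqE T M M' → EqE T K K' → EqE T (h (.blind M K)) (h (.blind M' K'))
  pair : ∀ {M M' K K'}, EqE T M M' → EqE T K K' → EqE T (h (.pair M K)) (h (.pair M' K'))
  enc : ∀ {M M' K K'}, EqE T M M' → EqE T K K' → EqE T (h (.enc M K)) (h (.enc M' K'))

theorem mapGuarded_bin (h : T.Message → T.Message) (f : Fin T.sig.size) (x y : T.Message) :
    (Msg.bin f x y).mapGuarded h = .bin f (x.mapGuarded h) (y.mapGuarded h) := by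
  simp only [Msg.bin, Msg.mapGuarded, Msg.app.injEq, heq_eq_eq, true_and]
  funext i
  split_ifs <;> rfl

theorem GuardedCong.acEq {h : T.Message → T.Message} (hh : GuardedCong T h) {M N : T.Message}
    (H : ACEq T M N) : EqE T (M.mapGuarded h) (N.mapGuarded h) := by
  induction H with
  | comm hf x y => simp only [mapGuarded_bin]; exact (ACEq.comm hf _ _).eqE
  | assoc hf x y z => simp only [mapGuarded_bin]; exact (ACEq.assoc hf _ _ _).eqE
  | refl => exact EqE.refl _
  | symm _ ih => exact ih.symm
  | trans _ _ ih₁ ih₂ => exact ih₁.trans ih₂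
  | pub H => exact hh.pub H.eqE
  | sign H H' => exact hh.sign H.eqE H'.eqE
  | blind H H' => exact hh.blind H.eqE H'.eqE
  | pair H H' => exact hh.pair H.eqE H'.eqE
  | enc H H' => exact hh.enc H.eqE H'.eqE
  | app _ ih => exact EqE.app ih

/-- A rule applied outside all guarded subterms is pure, so the replacement only changes its
substitution. A step inside a guarded subterm takes place below its head constructor, where the
hypothesis on `h` applies. -/
theorem GuardedCong.rew {h : T.Message → T.Message} (hh : GuardedCong T h) {M N : T.Message}
    (H : Rew T M N) : EqE T (M.mapGuarded h) (N.mapGuarded h) := by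
  induction H with
  | root hr σ => simp only [Pat.mapGuarded_inst]; exact (Rew.root hr _).eqE
  | pub H => exact hh.pub H.eqE
  | sign_left _ H => exact hh.sign H.eqE (.refl _)
  | sign_right _ H => exact hh.sign (.refl _) H.eqE
  | blind_left _ H => exact hh.blind H.eqE (.refl _)
  | blind_right _ H => exact hh.blind (.refl _) H.eqE
  | pair_left _ H => exact hh.pair H.eqE (.refl _)
  | pair_right _ H => exact hh.pair (.refl _) H.eqE
  | enc_left _ H => exact hh.enc H.eqE (.refl _)
  | enc_right _ H => exact hh.enc (.refl _) H.eqE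
  | app a i _ ih =>
    refine EqE.app fun j => ?_
    rcases eq_or_ne j i with rfl | hj
    · simpa using ih
    · simpa [hj] using EqE.refl _

theorem GuardedCong.eqE {h : T.Message → T.Message} (hh : GuardedCong T h) {M N : T.Message}
    (H : EqE T M N) : EqE T (M.mapGuarded h) (N.mapGuarded h) :=
  H.map _ (fun _ _ => hh.acEq) (fun _ _ => hh.rew)

theorem GuardedCong.of_eqE {h : T.Message → T.Message}
    (hh : ∀ {M N}, EqE T M N → EqE T (h M) (h N)) : GuardedCong T h where
  pub H := hh H.pub
  sign H H' := hh (H.sign H')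
  blind H H' := hh (H.blind H')
  pair H H' := hh (H.pair H')
  enc H H' := hh (H.enc H')

end MapGuarded

/-! ### Constructors -/

section Constructors

variable {S : Sig}

/-- The number of the head constructor, as in `Msg.label`. -/
def Msg.kind : Msg S → ℕ
  | .name _ => 0
  | .pub _ => 1
  | .sign _ _ => 2
  | .blind _ _ => 3
  | .pair _ _ => 4
  | .enc _ _ => 5
  | .app _ _ => 6

/-- The first argument of a constructor. -/
def Msg.left : Msg S → Msg S
  | .name a => .name a
  | .pub M => M
  | .sign M _ => M
  | .blind M _ => M
  | .pair M _ => M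
  | .enc M _ => M
  | .app f a => .app f a

/-- The second argument of a binary constructor. -/
def Msg.right : Msg S → Msg S
  | .name a => .name a
  | .pub M => .pub M
  | .sign _ K => K
  | .blind _ K => K
  | .pair _ K => K
  | .enc _ K => K
  | .app f a => .app f a

/-- The message is headed by a binary constructor. -/
def Msg.IsBin (M : Msg S) : Prop := M.kind = 2 ∨ M.kind = 3 ∨ M.kind = 4 ∨ M.kind = 5

theorem Msg.IsBin.isGuarded {M : Msg S} (h : M.IsBin) : M.IsGuarded := by
  cases M <;> first | trivial | simp [Msg.IsBin, Msg.kind] at h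

theorem Msg.IsBin.children {M : Msg S} (h : M.IsBin) : M.children = [M.left, M.right] := by
  cases M <;> first | rfl | simp [Msg.IsBin, Msg.kind] at h

theorem Msg.IsBin.left_mem {M : Msg S} (h : M.IsBin) : M.left ∈ M.children := by
  simp [h.children]

theorem Msg.IsBin.right_mem {M : Msg S} (h : M.IsBin) : M.right ∈ M.children := by
  simp [h.children]

theorem Msg.children_of_kind_eq_one {M : Msg S} (h : M.kind = 1) : M.children = [M.left] := by
  cases M <;> first | rfl | simp [Msg.kind] at h

theorem Msg.kind_eq_one {M : Msg S} (h : M.kind = 1) : M = .pub M.left := by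
  cases M <;> first | rfl | simp [Msg.kind] at h

theorem Msg.kind_eq_two {M : Msg S} (h : M.kind = 2) : M = .sign M.left M.right := by
  cases M <;> first | rfl | simp [Msg.kind] at h

theorem Msg.kind_eq_three {M : Msg S} (h : M.kind = 3) : M = .blind M.left M.right := by
  cases M <;> first | rfl | simp [Msg.kind] at h

theorem Msg.kind_eq_four {M : Msg S} (h : M.kind = 4) : M = .pair M.left M.right := by
  cases M <;> first | rfl | simp [Msg.kind] at h

theorem Msg.kind_eq_five {M : Msg S} (h : M.kind = 5) : M = .enc M.left M.right := by
  cases M <;> first | rfl | simp [Msg.kind] at h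

variable {T : Theory}

theorem guardedCong_left : GuardedCong T Msg.left :=
  ⟨fun h => h, fun h _ => h, fun h _ => h, fun h _ => h, fun h _ => h⟩

theorem guardedCong_right : GuardedCong T Msg.right :=
  ⟨fun h => h.pub, fun _ h => h, fun _ h => h, fun _ h => h, fun _ h => h⟩

theorem guardedCong_kind : GuardedCong T (fun M => .name M.kind) :=
  ⟨fun _ => .refl _, fun _ _ => .refl _, fun _ _ => .refl _, fun _ _ => .refl _,
    fun _ _ => .refl _⟩

/-- Equal guarded messages have the same constructor and equal arguments. -/
theorem EqE.guarded_inv (hT : ACConvergent T) {M N : T.Message} (hM : M.IsGuarded)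
    (hN : N.IsGuarded) (h : EqE T M N) :
    M.kind = N.kind ∧ EqE T M.left N.left ∧ EqE T M.right N.right := by
  -- Head constructor and both arguments are read off by three replacements of guarded subterms; the
  -- constructor is coded as a name because distinct names are unequal.
  have h₁ := guardedCong_kind.eqE h
  have h₂ := guardedCong_left.eqE h
  have h₃ := guardedCong_right.eqE h
  rw [hM.mapGuarded, hN.mapGuarded] at h₁ h₂ h₃
  exact ⟨eq_of_name_eqE_name hT h₁, h₂, h₃⟩

end Constructors

/-! ### Elementary deduction -/

section Elementary

variable {T : Theory}

/-- Elementary deduction, step by step. -/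
inductive ElemI (T : Theory) (Γ : Set T.Message) : T.Message → Prop
  | id {M} : M ∈ Γ → ElemI T Γ M
  | app {f} {a : Fin (T.sig.arity f) → T.Message} : (∀ i, ElemI T Γ (a i)) → ElemI T Γ (.app f a)
  | conv {M N} : ElemI T Γ N → EqE T M N → ElemI T Γ M

/-- Rename the variables of a pure term. -/
def Pat.rename {S : Sig} {X Y : Type} (r : X → Y) : Pat S X → Pat S Y
  | .var x => .var (r x)
  | .app f a => .app f (fun i => (a i).rename r)

theorem Pat.inst_rename {S : Sig} {X Y : Type} (r : X → Y) (σ : Y → Msg S) (C : Pat S X) :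
    (C.rename r).inst σ = C.inst (σ ∘ r) := by
  induction C with
  | var x => rfl
  | app f a ih => simp only [Pat.rename, Pat.inst, ih]

theorem ElemI.inst {Γ : Set T.Message} {X : Type} {σ : X → T.Message} (hσ : ∀ x, ElemI T Γ (σ x))
    (C : Pat T.sig X) : ElemI T Γ (C.inst σ) := by
  induction C with
  | var x => exact hσ x
  | app f a ih => exact .app ih

theorem elem_iff_elemI {Γ : Set T.Message} {M : T.Message} : Elem T Γ M ↔ ElemI T Γ M := by
  constructor
  · rintro ⟨k, C, A, hA, h⟩
    exact .conv (ElemI.inst (fun i => .id (hA i)) C) h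
  · intro h
    induction h with
    | @id M hM => exact ⟨1, .var 0, fun _ => M, fun _ => hM, .refl _⟩
    | conv _ h ih =>
      obtain ⟨k, C, A, hA, h'⟩ := ih
      exact ⟨k, C, A, hA, h.trans h'⟩
    | @app f a _ ih =>
      choose k C A hA h using ih
      -- The contexts for the arguments have separate holes; `finSigmaFinEquiv` numbers them
      -- consecutively.
      let A' : Fin (∑ i, k i) → T.Message :=
        fun j => A (finSigmaFinEquiv.symm j).1 (finSigmaFinEquiv.symm j).2
      refine ⟨∑ i, k i, .app f fun i => (C i).rename fun j => finSigmaFinEquiv ⟨i, j⟩, A',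
        fun j => hA _ _, EqE.app fun i => ?_⟩
      rw [Pat.inst_rename]
      convert h i using 2
      funext j
      simp only [A', Function.comp_apply]
      rw [Equiv.symm_apply_apply]

theorem ElemI.bind {Γ Δ : Set T.Message} (h : ∀ M ∈ Γ, ElemI T Δ M) {M : T.Message}
    (hM : ElemI T Γ M) : ElemI T Δ M := by
  induction hM with
  | id hM => exact h _ hM
  | app _ ih => exact .app ih
  | conv _ h ih => exact .conv ih h

theorem ElemI.mono {Γ Δ : Set T.Message} (h : Γ ⊆ Δ) {M : T.Message} (hM : ElemI T Γ M) :
    ElemI T Δ M :=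
  hM.bind fun _ hM => .id (h hM)

theorem ACEq.isGuarded_iff {M N : T.Message} (h : ACEq T M N) : M.IsGuarded ↔ N.IsGuarded := by
  induction h with
  | refl => rfl
  | symm _ ih => exact ih.symm
  | trans _ _ ih₁ ih₂ => exact ih₁.trans ih₂
  | _ => simp [Msg.bin, Msg.IsGuarded]

theorem Rew.isGuarded {M N : T.Message} (h : Rew T M N) (hM : M.IsGuarded) : N.IsGuarded := by
  cases h with
  | @root r _ σ =>
    obtain ⟨f, b, hb⟩ := Rule.lhs_inst_eq_app r σ
    rw [hb] at hM; exact hM.elim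
  | app => exact hM.elim
  | _ => trivial

theorem Step.isGuarded {M N : T.Message} (h : Step T M N) (hM : M.IsGuarded) : N.IsGuarded :=
  let ⟨_, _, h₁, h₂, h₃⟩ := h
  h₃.isGuarded_iff.1 (h₂.isGuarded (h₁.isGuarded_iff.1 hM))

/-- Rewriting and AC-equality both preserve guardedness, and a normal `M` is AC-equal to a reduct of
`N`. -/
theorem EqE.isGuarded_of_isNormal (hT : ACConvergent T) {M N : T.Message} (hM : IsNormal T M)
    (h : EqE T M N) (hN : N.IsGuarded) : M.IsGuarded := by
  obtain ⟨P, Q, h₁, h₂, h₃⟩ := h.join hT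
  rw [← hM.eq_of_steps h₁] at h₃
  rw [h₃.isGuarded_iff]
  clear h₃
  induction h₂ with
  | refl => exact hN
  | tail _ h ih => exact h.isGuarded ih

open Classical in
/-- A guarded message that is deduced from `Γ` equals a guarded message that occurs in `Γ`. -/
theorem ElemI.exists_eqE_of_isGuarded (hT : ACConvergent T) {Γ X : Set T.Message} {G : T.Message}
    (hG : G.IsGuarded) (h : ElemI T Γ G)
    (hΓ : ∀ M ∈ Γ, M.IsGuarded ∨ M ∈ X) (hX : ChildClosed X) :
    ∃ A, A.IsGuarded ∧ (A ∈ Γ ∨ A ∈ X) ∧ EqE T A G := by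
  by_contra! hne
  -- If no guarded message of `Γ` or `X` equals `G`, replacing the class of `G` by any name fixes
  -- the hypotheses, hence up to `≈` everything deduced from them, including `G`. So `G` would equal
  -- every name.
  have key : ∀ a : ℕ, EqE T (.name a) G := by
    intro a
    let h' : T.Message → T.Message := fun g => if EqE T g G then .name a else g
    have hc : GuardedCong T h' := .of_eqE fun {M N} hMN => by
      by_cases hM : EqE T M G
      · have hN : EqE T N G := hMN.symm.trans hM
        simp only [h', hM, hN, if_true]; exact .refl _
      · have hN : ¬ EqE T N G := fun hN => hM (hMN.trans hN)
        simpa only [h', hM, hN, if_false] using hMN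
    have hfix : ∀ M, ElemI T Γ M → EqE T (M.mapGuarded h') M := by
      intro M hM
      induction hM with
      | @id M hM =>
        rcases hΓ M hM with hg | hMX
        · rw [hg.mapGuarded]
          simp only [h', hne M hg (.inl hM), if_false]; exact .refl _
        · rw [mapGuarded_eq_self hX _ M hMX]; · exact .refl _
          intro g hg hgg
          simp only [h', hne g hgg (.inr hg), if_false]
      | app _ ih => exact EqE.app ih
      | conv _ h ih => exact (hc.eqE h).trans (ih.trans h.symm)
    have := hfix G h
    rw [hG.mapGuarded] at this
    simpa only [h', EqE.refl, if_true] using this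
  exact absurd (eq_of_name_eqE_name hT ((key 0).trans (key 1).symm)) (by norm_num)

end Elementary

/-! ### Closed sets of messages -/

section Closed

variable {T : Theory}

/-- `Δ` is closed under all deductions within `S`. -/
structure Closed (T : Theory) (S Δ : Set T.Message) : Prop where
  sub : Δ ⊆ S
  elem : ∀ {M}, M ∈ S → Elem T Δ M → M ∈ Δ
  bin : ∀ {M}, M ∈ S → M.IsBin → M.left ∈ Δ → M.right ∈ Δ → M ∈ Δ
  pair : ∀ {M N}, Msg.pair M N ∈ Δ → M ∈ Δ ∧ N ∈ Δ
  enc : ∀ {M K}, Msg.enc M K ∈ Δ → K ∈ Δ → M ∈ Δ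
  sign : ∀ {M K L}, Msg.sign M K ∈ Δ → Msg.pub L ∈ Δ → ACEq T K L → M ∈ Δ
  blind₁ : ∀ {M K}, Msg.blind M K ∈ Δ → K ∈ Δ → M ∈ Δ
  blind₂ : ∀ {M R K}, Msg.sign (.blind M R) K ∈ Δ → R ∈ Δ → Msg.sign M K ∈ Δ

/-- `Δ` together with the messages obtained with at most `n` nested constructors. -/
def level (T : Theory) (Δ : Set T.Message) : ℕ → Set T.Message
  | 0 => Δ
  | n + 1 => Δ ∪ {M | M.IsBin ∧ ElemI T (level T Δ n) M.left ∧ ElemI T (level T Δ n) M.right}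

theorem level_mono (Δ : Set T.Message) {m n : ℕ} (h : m ≤ n) : level T Δ m ⊆ level T Δ n := by
  have step : ∀ n, level T Δ n ⊆ level T Δ (n + 1) := by
    intro n
    induction n with
    | zero => exact Set.subset_union_left
    | succ n ih =>
      exact Set.union_subset_union_right _ fun M hM => ⟨hM.1, hM.2.1.mono ih, hM.2.2.mono ih⟩
  exact monotone_nat_of_le_succ step h

/-- Deducible from `Δ` with the introduction rules only. -/
def Syn (T : Theory) (Δ : Set T.Message) (M : T.Message) : Prop := ∃ n, ElemI T (level T Δ n) M

theorem Syn.bin {Δ : Set T.Message} {M : T.Message} (hM : M.IsBin) (h₁ : Syn T Δ M.left)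
    (h₂ : Syn T Δ M.right) : Syn T Δ M := by
  obtain ⟨m, h₁⟩ := h₁
  obtain ⟨n, h₂⟩ := h₂
  exact ⟨max m n + 1, .id (.inr ⟨hM, h₁.mono (level_mono Δ (le_max_left _ _)),
    h₂.mono (level_mono Δ (le_max_right _ _))⟩)⟩

theorem Syn.conv {Δ : Set T.Message} {M N : T.Message} (h : Syn T Δ N) (h' : EqE T M N) :
    Syn T Δ M :=
  h.imp fun _ h => .conv h h'

theorem Syn.app {Δ : Set T.Message} {f : Fin T.sig.size} {a : Fin (T.sig.arity f) → T.Message}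
    (h : ∀ i, Syn T Δ (a i)) : Syn T Δ (.app f a) := by
  choose n hn using h
  exact ⟨Finset.univ.sup n, .app fun i =>
    (hn i).mono (level_mono Δ (Finset.le_sup (Finset.mem_univ i)))⟩

theorem Syn.of_mem {Δ : Set T.Message} {M : T.Message} (h : M ∈ Δ) : Syn T Δ M := ⟨0, .id h⟩

/-- Provides a dummy message for the replacement below. If `Δ` is empty, the derivation bottoms out
in a constant of the signature. -/
theorem ElemI.exists_elemI_of_level {Δ : Set T.Message} :
    ∀ {n} {M : T.Message}, ElemI T (level T Δ n) M → ∃ d, ElemI T Δ d := by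
  intro n
  induction n with
  | zero => exact fun h => ⟨_, h⟩
  | succ n ihn =>
    intro M h
    induction h with
    | id h => exact h.elim (fun h => ⟨_, .id h⟩) fun h => ihn h.2.1
    | @app f a _ ih =>
      by_cases hf : T.sig.arity f = 0
      · exact ⟨.app f a, .app fun i => (Fin.cast hf i).elim0⟩
      · exact ih ⟨0, Nat.pos_of_ne_zero hf⟩
    | conv _ _ ih => exact ih

variable {S Δ : Set T.Message}

-- Induction on the nesting of constructors. Guarded messages equal to nothing guarded in `S` are
-- irrelevant to a conclusion in `S` and are replaced by a deducible dummy `d`. The remaining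
-- composed messages equal some `A ∈ S`, whose arguments lie in `Δ` by the induction hypothesis, so
-- `A ∈ Δ`. The derivation thus becomes an elementary deduction from `Δ` itself.
open Classical in
theorem Closed.mem_of_elemI_level (hT : ACConvergent T) (hΔ : Closed T S Δ) (hS : ChildClosed S) :
    ∀ {n} {M : T.Message}, M ∈ S → ElemI T (level T Δ n) M → M ∈ Δ := by
  intro n
  induction n with
  | zero => exact fun hM h => hΔ.elem hM (elem_iff_elemI.2 h)
  | succ n ihn =>
    intro M hM h
    obtain ⟨d, hd⟩ := h.exists_elemI_of_level
    let h' : T.Message → T.Message :=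
      fun g => if ∃ A ∈ S, A.IsGuarded ∧ EqE T A g then g else d
    have hc : GuardedCong T h' := .of_eqE fun {M N} hMN => by
      have : (∃ A ∈ S, A.IsGuarded ∧ EqE T A M) ↔ ∃ A ∈ S, A.IsGuarded ∧ EqE T A N :=
        exists_congr fun A => and_congr_right fun _ => and_congr_right fun _ =>
          ⟨fun h => h.trans hMN, fun h => h.trans hMN.symm⟩
      by_cases hM : ∃ A ∈ S, A.IsGuarded ∧ EqE T A M
      · simpa only [h', if_pos hM, if_pos (this.1 hM)] using hMN
      · simpa only [h', if_neg hM, if_neg (mt this.2 hM)] using EqE.refl _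
    have hfix : ∀ M ∈ S, M.mapGuarded h' = M := mapGuarded_eq_self hS fun g hg hgg =>
      if_pos ⟨g, hg, hgg, .refl _⟩
    have key : ∀ M, ElemI T (level T Δ (n + 1)) M → ElemI T Δ (M.mapGuarded h') := by
      intro M hM
      induction hM with
      | @id M hM =>
        rcases hM with hM | ⟨hb, hl, hr⟩
        · rw [hfix M (hΔ.sub hM)]
          exact .id hM
        · rw [hb.isGuarded.mapGuarded]
          by_cases hA : ∃ A ∈ S, A.IsGuarded ∧ EqE T A M
          · simp only [h', if_pos hA]
            obtain ⟨A, hAS, hAg, hAM⟩ := hA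
            obtain ⟨hk, hl', hr'⟩ := hAM.guarded_inv hT hAg hb.isGuarded
            have hAb : A.IsBin := by simpa only [Msg.IsBin, hk] using hb
            exact .conv (.id (hΔ.bin hAS hAb (ihn (hS _ hAS _ hAb.left_mem) (.conv hl hl'))
              (ihn (hS _ hAS _ hAb.right_mem) (.conv hr hr')))) hAM.symm
          · simpa only [h', if_neg hA] using hd
      | app _ ih => exact .app ih
      | conv _ h ih => exact .conv ih (hc.eqE h)
    have := key M h
    rw [hfix M hM] at this
    exact hΔ.elem hM (elem_iff_elemI.2 this)

theorem Closed.mem_of_syn (hT : ACConvergent T) (hΔ : Closed T S Δ) (hS : ChildClosed S)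
    {M : T.Message} (hM : M ∈ S) (h : Syn T Δ M) : M ∈ Δ :=
  let ⟨_, h⟩ := h
  hΔ.mem_of_elemI_level hT hS hM h

/-- A guarded synthesizable message comes from an introduction rule or from an element
of `Δ`. -/
theorem Closed.syn_guarded_inv (hT : ACConvergent T) (hΔ : Closed T S Δ) (hS : ChildClosed S)
    {G : T.Message} (h : Syn T Δ G) (hG : G.IsGuarded) :
    (G.IsBin ∧ Syn T Δ G.left ∧ Syn T Δ G.right) ∨
    ∃ A ∈ Δ, A.IsGuarded ∧ A.kind = G.kind ∧ EqE T A.left G.left ∧ EqE T A.right G.right := by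
  obtain ⟨n, hn⟩ := h
  -- Level `n + 1` is by definition a union of `Δ` and composed messages, also when `n = 0`.
  have hn' := hn.mono (level_mono Δ (Nat.le_succ n))
  obtain ⟨A, hAg, hA, hAG⟩ := hn'.exists_eqE_of_isGuarded hT hG (X := S)
    (fun M hM => hM.elim (fun h => .inr (hΔ.sub h)) fun h => .inl h.1.isGuarded) hS
  obtain ⟨hk, hl, hr⟩ := hAG.guarded_inv hT hAg hG
  have inS : A ∈ S → A ∈ Δ := fun hAS => hΔ.mem_of_elemI_level hT hS hAS (.conv hn hAG)
  rcases hA with (hA | ⟨hb, hAl, hAr⟩) | hA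
  · exact .inr ⟨A, hA, hAg, hk, hl, hr⟩
  · refine .inl ⟨by simpa only [Msg.IsBin, hk] using hb, ?_, ?_⟩
    · exact Syn.conv ⟨n, hAl⟩ hl.symm
    · exact Syn.conv ⟨n, hAr⟩ hr.symm
  · exact .inr ⟨A, inS hA, hAg, hk, hl, hr⟩

/-- Introductions preserve synthesis trivially. The major premise of an elimination is guarded, so
it was either just composed, in which case its arguments are synthesized already, or it equals an
element of `Δ`. In the latter case the side premise equals a message of `S`, hence one of `Δ`, and
closure under the elimination applies. -/
theorem Closed.syn_of_natDed (hT : ACConvergent T) (hΔ : Closed T S Δ) (hS : ChildClosed S)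
    (hN : ∀ M ∈ S, IsNormal T M) {Γ : Set T.Message} (hΓ : Γ ⊆ Δ) {M : T.Message}
    (h : NatDed T Γ M) : Syn T Δ M := by
  have memS : ∀ {A u : T.Message}, A ∈ Δ → u ∈ A.children → u ∈ S :=
    fun hA hu => hS _ (hΔ.sub hA) _ hu
  induction h with
  | id h => exact .of_mem (hΓ h)
  | @enc_elim M K _ _ ih₁ ih₂ =>
    rcases hΔ.syn_guarded_inv hT hS ih₁ trivial with h | ⟨A, hA, -, hk, hl, hr⟩
    · exact h.2.1
    · rw [Msg.kind_eq_five hk] at hA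
      exact (Syn.of_mem (hΔ.enc hA (hΔ.mem_of_syn hT hS (memS hA (by simp [Msg.children]))
        (ih₂.conv hr)))).conv hl.symm
  | enc_intro _ _ ih₁ ih₂ => exact .bin (by simp [Msg.IsBin, Msg.kind]) ih₁ ih₂
  | pair_elim₁ _ ih =>
    rcases hΔ.syn_guarded_inv hT hS ih trivial with h | ⟨A, hA, -, hk, hl, hr⟩
    · exact h.2.1
    · rw [Msg.kind_eq_four hk] at hA
      exact (Syn.of_mem (hΔ.pair hA).1).conv hl.symm
  | pair_elim₂ _ ih =>
    rcases hΔ.syn_guarded_inv hT hS ih trivial with h | ⟨A, hA, -, hk, hl, hr⟩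
    · exact h.2.2
    · rw [Msg.kind_eq_four hk] at hA
      exact (Syn.of_mem (hΔ.pair hA).2).conv hr.symm
  | pair_intro _ _ ih₁ ih₂ => exact .bin (by simp [Msg.IsBin, Msg.kind]) ih₁ ih₂
  | @sign_elim M K _ _ ih₁ ih₂ =>
    rcases hΔ.syn_guarded_inv hT hS ih₁ trivial with h | ⟨A, hA, -, hk, hl, hr⟩
    · exact h.2.1
    -- No introduction rule yields a public key, so it must come from `Δ`. Normality then turns `≈`
    -- of the two keys into the AC-equality demanded by the rule.
    rcases hΔ.syn_guarded_inv hT hS ih₂ trivial with h | ⟨B, hB, -, hk', hl', -⟩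
    · simp [Msg.IsBin, Msg.kind] at h
    rw [Msg.kind_eq_two hk] at hA
    rw [Msg.kind_eq_one hk'] at hB
    refine (Syn.of_mem (hΔ.sign hA hB ?_)).conv hl.symm
    exact (hr.trans hl'.symm).acEq hT (hN _ (memS hA (by simp [Msg.children])))
      (hN _ (memS hB (by simp [Msg.children])))
  | sign_intro _ _ ih₁ ih₂ => exact .bin (by simp [Msg.IsBin, Msg.kind]) ih₁ ih₂
  | @blind_elim₁ M K _ _ ih₁ ih₂ =>
    rcases hΔ.syn_guarded_inv hT hS ih₁ trivial with h | ⟨A, hA, -, hk, hl, hr⟩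
    · exact h.2.1
    · rw [Msg.kind_eq_three hk] at hA
      exact (Syn.of_mem (hΔ.blind₁ hA (hΔ.mem_of_syn hT hS (memS hA (by simp [Msg.children]))
        (ih₂.conv hr)))).conv hl.symm
  | blind_intro _ _ ih₁ ih₂ => exact .bin (by simp [Msg.IsBin, Msg.kind]) ih₁ ih₂
  | @blind_elim₂ M R K _ _ ih₁ ih₂ =>
    rcases hΔ.syn_guarded_inv hT hS ih₁ trivial with ⟨-, h₁, h₂⟩ | ⟨A, hA, -, hk, hl, hr⟩
    · rcases hΔ.syn_guarded_inv hT hS (G := .blind M R) h₁ trivial with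
        h | ⟨A, hA, -, hk, hl, hr⟩
      · exact .bin (by simp [Msg.IsBin, Msg.kind]) h.2.1 h₂
      · rw [Msg.kind_eq_three hk] at hA
        refine .bin (by simp [Msg.IsBin, Msg.kind]) ?_ h₂
        exact (Syn.of_mem (hΔ.blind₁ hA (hΔ.mem_of_syn hT hS (memS hA (by simp [Msg.children]))
          (ih₂.conv hr)))).conv hl.symm
    · rw [Msg.kind_eq_two hk] at hA
      have hAl : A.left ∈ S := memS hA (by simp [Msg.children])
      -- The left argument of `A` is only known to be equal to a blinded message; being normal it is
      -- guarded, hence literally headed by `blind`.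
      have hg := hl.isGuarded_of_isNormal hT (hN _ hAl) trivial
      obtain ⟨hk', hl', hr'⟩ := hl.guarded_inv hT hg (N := .blind M R) trivial
      rw [Msg.kind_eq_three hk'] at hA hAl
      refine (Syn.of_mem (hΔ.blind₂ hA (hΔ.mem_of_syn hT hS (hS _ hAl _ (by simp [Msg.children]))
        (ih₂.conv hr')))).conv (EqE.sign hl'.symm hr.symm)
  | app_intro _ ih => exact Syn.app ih
  | conv _ h ih => exact ih.conv h

end Closed

/-! ### Subterms and saturated sets -/

section Subterms

variable {S : Sig}

/-- The relation between a message and its immediate subterms. -/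
abbrev Msg.IsChild (u v : Msg S) : Prop := u ∈ v.children

theorem Msg.wellFounded_isChild : WellFounded (Msg.IsChild (S := S)) := by
  refine ⟨fun v => ?_⟩
  induction v with
  | name a => exact ⟨_, fun u hu => by simp [IsChild, children] at hu⟩
  | pub M ih =>
    refine ⟨_, fun u hu => ?_⟩
    simp only [IsChild, children, List.mem_singleton] at hu
    exact hu ▸ ih
  | app f a ih =>
    refine ⟨_, fun u hu => ?_⟩
    simp only [IsChild, children, List.mem_ofFn] at hu
    obtain ⟨i, rfl⟩ := hu
    exact ih i
  | _ M K ih₁ ih₂ =>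
    refine ⟨_, fun u hu => ?_⟩
    simp only [IsChild, children, List.mem_cons, List.not_mem_nil, or_false] at hu
    rcases hu with rfl | rfl
    exacts [ih₁, ih₂]

/-- The child relation is well-founded, so a nonempty chain of children never returns to its start.
-/
theorem mem_pst_iff {X : Set (Msg S)} {u : Msg S} :
    u ∈ pst X ↔ ∃ v ∈ X, Relation.TransGen Msg.IsChild u v := by
  refine exists_congr fun v => and_congr_right fun _ => ⟨fun ⟨h, hne⟩ => ?_, fun h => ⟨h.to_reflTransGen, ?_⟩⟩
  · exact (Relation.reflTransGen_iff_eq_or_transGen.1 h).resolve_left fun h => hne h.symm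
  · rintro rfl
    exact Msg.wellFounded_isChild.transGen.irrefl.irrefl _ h

theorem mem_pst_of_child {X : Set (Msg S)} {u v : Msg S} (hv : v ∈ X) (h : u ∈ v.children) :
    u ∈ pst X :=
  mem_pst_iff.2 ⟨v, hv, .single h⟩

theorem mem_pst_of_child_pst {X : Set (Msg S)} {u v : Msg S} (hv : v ∈ pst X)
    (h : u ∈ v.children) : u ∈ pst X :=
  let ⟨w, hw, h'⟩ := mem_pst_iff.1 hv
  mem_pst_iff.2 ⟨w, hw, .head h h'⟩

theorem mem_pst_of_child_St {X : Set (Msg S)} {u v : Msg S} (hv : v ∈ St X)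
    (h : u ∈ v.children) : u ∈ pst X := by
  rcases hv with (hv | hv) | ⟨A, hA, B, hB, rfl⟩
  · exact mem_pst_of_child hv h
  · exact mem_pst_of_child_pst hv h
  · simp only [Msg.children, List.mem_cons, List.not_mem_nil, or_false] at h
    rcases h with rfl | rfl <;> assumption

theorem pst_subset_St (X : Set (Msg S)) : pst X ⊆ St X := fun _ h => .inl (.inr h)

theorem subset_St (X : Set (Msg S)) : X ⊆ St X := fun _ h => .inl (.inl h)

theorem childClosed_St (X : Set (Msg S)) : ChildClosed (St X) :=
  fun _ hv _ hu => pst_subset_St X (mem_pst_of_child_St hv hu)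

theorem sign_mem_St {X : Set (Msg S)} {A B : Msg S} (hA : A ∈ pst X) (hB : B ∈ pst X) :
    .sign A B ∈ St X := .inr ⟨A, hA, B, hB, rfl⟩

theorem unblind_mem_St {X : Set (Msg S)} {M R K : Msg S} (h : .sign (.blind M R) K ∈ St X) :
    .sign M K ∈ St X :=
  sign_mem_St (mem_pst_of_child_pst (mem_pst_of_child_St h (u := .blind M R)
    (by simp [Msg.children])) (by simp [Msg.children]))
    (mem_pst_of_child_St h (by simp [Msg.children]))

/-- Every child of an element of `St X` is a proper subterm of `X`, so saturation creates no new
proper subterms. Consequently questions about nodes of a saturated DAG have their own saturated DAG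
inside it. -/
theorem pst_subset_pst {X Y : Set (Msg S)} (h : Y ⊆ St X) : pst Y ⊆ pst X := by
  intro u hu
  obtain ⟨v, hv, huv⟩ := mem_pst_iff.1 hu
  replace hv := h hv
  clear hu
  induction huv using Relation.TransGen.head_induction_on with
  | single h => exact mem_pst_of_child_St hv h
  | @head a b h _ ih =>
    exact mem_pst_of_child_pst ih h

theorem St_subset_St {X Y : Set (Msg S)} (h : Y ⊆ St X) : St Y ⊆ St X := by
  have := pst_subset_pst h
  rintro u ((hu | hu) | ⟨A, hA, B, hB, rfl⟩)
  exacts [h hu, pst_subset_St X (this hu), sign_mem_St (this hA) (this hB)]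

theorem mem_of_isSubterm {X : Set (Msg S)} (hX : ChildClosed X) {u v : Msg S} (hv : v ∈ X)
    (h : u.IsSubterm v) : u ∈ X := by
  induction h using Relation.ReflTransGen.head_induction_on with
  | refl => exact hv
  | head h _ ih => exact hX _ ih _ h

theorem finite_subterms (v : Msg S) : {u : Msg S | u.IsSubterm v}.Finite := by
  induction v using Msg.wellFounded_isChild.induction with
  | _ v ih =>
    refine ((v.children.finite_toSet.biUnion ih).insert v).subset fun u hu => ?_
    rcases Relation.ReflTransGen.cases_tail hu with rfl | ⟨w, hw, hwv⟩
    · exact .inl rfl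
    · exact .inr (Set.mem_biUnion hwv hw)

theorem finite_St {X : Set (Msg S)} (hX : X.Finite) : (St X).Finite := by
  have h : (pst X).Finite := by
    refine (hX.biUnion fun v _ => finite_subterms v).subset ?_
    rintro u ⟨v, hv, huv, -⟩
    exact Set.mem_biUnion hv huv
  refine (hX.union h).union ((h.image2 Msg.sign h).subset ?_)
  rintro _ ⟨A, hA, B, hB, rfl⟩
  exact ⟨A, hA, B, hB, rfl⟩

theorem isNormal_of_mem_St {T : Theory} {X : Set T.Message} (h : ∀ M ∈ X, IsNormal T M) :
    ∀ M ∈ St X, IsNormal T M := by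
  have hp : ∀ M ∈ pst X, IsNormal T M := by
    rintro M ⟨N, hN, hMN, -⟩
    induction hMN using Relation.ReflTransGen.head_induction_on with
    | refl => exact h _ hN
    | head h _ ih => exact ih.child h
  rintro M ((hM | hM) | ⟨A, hA, B, hB, rfl⟩)
  exacts [h _ hM, hp _ hM, (hp _ hA).sign (hp _ hB)]

end Subterms

/-! ### Equivalence of the deduction systems -/

section Equivalence

variable {T : Theory} {Γ Δ : Set T.Message}

theorem NatDed.bind (h : ∀ M ∈ Γ, NatDed T Δ M) {M : T.Message} (hM : NatDed T Γ M) :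
    NatDed T Δ M := by
  induction hM with
  | id hM => exact h _ hM
  | enc_elim _ _ h₁ h₂ => exact .enc_elim h₁ h₂
  | enc_intro _ _ h₁ h₂ => exact .enc_intro h₁ h₂
  | pair_elim₁ _ h => exact .pair_elim₁ h
  | pair_elim₂ _ h => exact .pair_elim₂ h
  | pair_intro _ _ h₁ h₂ => exact .pair_intro h₁ h₂
  | sign_elim _ _ h₁ h₂ => exact .sign_elim h₁ h₂
  | sign_intro _ _ h₁ h₂ => exact .sign_intro h₁ h₂
  | blind_elim₁ _ _ h₁ h₂ => exact .blind_elim₁ h₁ h₂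
  | blind_intro _ _ h₁ h₂ => exact .blind_intro h₁ h₂
  | blind_elim₂ _ _ h₁ h₂ => exact .blind_elim₂ h₁ h₂
  | app_intro _ h => exact .app_intro h
  | conv _ h ih => exact .conv ih h

theorem NatDed.cut {A M : T.Message} (h : NatDed T (insert A Γ) M) (hA : NatDed T Γ A) :
    NatDed T Γ M :=
  h.bind fun _ hB => hB.elim (fun h => h ▸ hA) .id

theorem ElemI.natDed {M : T.Message} (h : ElemI T Γ M) : NatDed T Γ M := by
  induction h with
  | id h => exact .id h
  | app _ ih => exact .app_intro ih
  | conv _ h ih => exact .conv ih h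

theorem Elem.natDed {M : T.Message} (h : Elem T Γ M) : NatDed T Γ M :=
  (elem_iff_elemI.1 h).natDed

theorem SeqDed.natDed {M : T.Message} (h : SeqDed T Γ M) : NatDed T Γ M := by
  induction h with
  | id h => exact h.natDed
  | cut _ _ _ h₁ h₂ => exact h₂.cut h₁
  | pair_left h _ ih =>
    exact (ih.cut (.pair_elim₁ (.id (.inr h)))).cut (.pair_elim₂ (.id h))
  | pair_right _ _ h₁ h₂ => exact .pair_intro h₁ h₂
  | enc_left h _ _ h₁ h₂ =>
    exact (h₂.cut (.enc_elim (.id (.inr h)) (.id (.inl rfl)))).cut h₁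
  | enc_right _ _ h₁ h₂ => exact .enc_intro h₁ h₂
  | sign_left h h' hK _ ih =>
    exact ih.cut (.sign_elim (.id h) (.conv (.id h') (EqE.pub hK.eqE)))
  | sign_right _ _ h₁ h₂ => exact .sign_intro h₁ h₂
  | blind_left₁ h _ _ h₁ h₂ =>
    exact (h₂.cut (.blind_elim₁ (.id (.inr h)) (.id (.inl rfl)))).cut h₁
  | blind_right _ _ h₁ h₂ => exact .blind_intro h₁ h₂
  | blind_left₂ h _ _ h₁ h₂ =>
    exact (h₂.cut (.blind_elim₂ (.id (.inr h)) (.id (.inl rfl)))).cut h₁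
  | gs _ _ _ _ h₁ h₂ => exact h₂.cut h₁

theorem RightDed.seqDed {M : T.Message} (h : RightDed T Γ M) : SeqDed T Γ M := by
  induction h with
  | id h => exact .id h
  | pair_right _ _ h₁ h₂ => exact .pair_right h₁ h₂
  | enc_right _ _ h₁ h₂ => exact .enc_right h₁ h₂
  | sign_right _ _ h₁ h₂ => exact .sign_right h₁ h₂
  | blind_right _ _ h₁ h₂ => exact .blind_right h₁ h₂

theorem LinDed.seqDed {M : T.Message} (h : LinDed T Γ M) : SeqDed T Γ M := by
  induction h with
  | r h => exact h.seqDed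
  | le h h' _ ih => exact .enc_left h h'.seqDed ih
  | lp h _ ih => exact .pair_left h ih
  | sign h h' hK _ ih => exact .sign_left h h' hK ih
  | blind₁ h h' _ ih => exact .blind_left₁ h h'.seqDed ih
  | blind₂ h h' _ ih => exact .blind_left₂ h h'.seqDed ih
  | ls hA hN h _ ih => exact .gs hA hN h.seqDed ih

theorem RightDed.elem_or_isBin {M : T.Message} (h : RightDed T Γ M) : Elem T Γ M ∨ M.IsBin := by
  cases h <;> first | exact .inl ‹_› | simp [Msg.IsBin, Msg.kind]

theorem RightDed.bin {M : T.Message} (hM : M.IsBin) (h₁ : RightDed T Γ M.left)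
    (h₂ : RightDed T Γ M.right) : RightDed T Γ M := by
  cases M <;> first | simp [Msg.IsBin, Msg.kind] at hM; done | skip
  exacts [.sign_right h₁ h₂, .blind_right h₁ h₂, .pair_right h₁ h₂, .enc_right h₁ h₂]

/-- Among the subsets `Δ` of the finite saturated set from which a linear derivation of `M` would
give one from `Γ`, a maximal one above `Γ` is chosen. Every left rule applied backwards enlarges `Δ`
within this family, so its new hypotheses are already present. The subterms of `Δ ∪ {M}` with a
right derivation from `Δ` then form a closed set, which contains `M`. -/
theorem NatDed.linDed (hT : ACConvergent T) (hΓ : Γ.Finite) {M : T.Message}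
    (hN : NormalSequent T Γ M) (h : NatDed T Γ M) : LinDed T Γ M := by
  set S := St (insert M Γ) with hS
  have hSfin : S.Finite := finite_St (hΓ.insert M)
  have hSN : ∀ A ∈ S, IsNormal T A := isNormal_of_mem_St hN
  have hMS : M ∈ S := subset_St _ (.inl rfl)
  have hfin : {Δ | Δ ⊆ S ∧ (LinDed T Δ M → LinDed T Γ M)}.Finite :=
    hSfin.finite_subsets.subset fun Δ h => h.1
  obtain ⟨Δ, hΓΔ, hΔ⟩ := hfin.exists_le_maximal (a := Γ)
    ⟨fun A hA => subset_St _ (.inr hA), fun h => h⟩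
  obtain ⟨⟨hΔS, hlin⟩, hmax⟩ := hΔ
  have add : ∀ A ∈ S, (LinDed T (insert A Δ) M → LinDed T Δ M) → A ∈ Δ := fun A hA h =>
    hmax ⟨Set.insert_subset hA hΔS, fun h' => hlin (h h')⟩ (Set.subset_insert A Δ) (.inl rfl)
  have add₂ : ∀ A ∈ S, ∀ B ∈ S, (LinDed T (insert A (insert B Δ)) M → LinDed T Δ M) →
      A ∈ Δ ∧ B ∈ Δ := fun A hA B hB h => by
    have := hmax (y := insert A (insert B Δ))
      ⟨Set.insert_subset hA (Set.insert_subset hB hΔS), fun h' => hlin (h h')⟩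
      ((Set.subset_insert B Δ).trans (Set.subset_insert A _))
    exact ⟨this (.inl rfl), this (.inr (.inl rfl))⟩
  have child : ∀ {A u : T.Message}, A ∈ S → u ∈ A.children → u ∈ S :=
    fun hA hu => childClosed_St _ _ hA _ hu
  -- Closure is taken relative to subterms of the current sequent, not to all of `S`: rule `ls` is
  -- available only for these.
  let S' : Set T.Message := {A | ∃ N ∈ insert M Δ, A.IsSubterm N}
  let Δ' : Set T.Message := {A | A ∈ S' ∧ RightDed T Δ A}
  have hS'c : ChildClosed S' := fun v ⟨N, hN, hv⟩ u hu => ⟨N, hN, .head hu hv⟩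
  have hS'S : S' ⊆ S := by
    rintro A ⟨N, hN, hA⟩
    refine mem_of_isSubterm (childClosed_St _) ?_ hA
    rcases hN with rfl | h
    exacts [hMS, hΔS h]
  -- By `ls` and maximality, so the left rules, which need a principal message in `Δ`, apply to the
  -- guarded elements of `Δ'`.
  have hg : ∀ {A : T.Message}, A ∈ Δ' → A.IsGuarded → A ∈ Δ := fun {A} hA hg =>
    add A (hS'S hA.1) fun h => .ls hg hA.1 hA.2 h
  have hup : Δ ⊆ Δ' := fun A hA =>
    ⟨⟨A, .inr hA, .refl⟩, .id (elem_iff_elemI.2 (.id hA))⟩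
  have hcl : Closed T S' Δ' := by
    refine ⟨fun A hA => hA.1, ?_, fun hS hb hl hr => ⟨hS, .bin hb hl.2 hr.2⟩, ?_, ?_, ?_, ?_, ?_⟩
    · intro A hA h
      refine ⟨hA, .id (elem_iff_elemI.2 ((elem_iff_elemI.1 h).bind fun B hB => ?_))⟩
      -- A right derivation either is elementary or ends with a constructor, whose result is guarded
      -- and hence in `Δ`. Elementary deduction from `Δ'` thus reduces to `Δ`.
      rcases hB.2.elem_or_isBin with h | h
      · exact elem_iff_elemI.1 h
      · exact .id (hg hB h.isGuarded)
    · intro A B h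
      have h' := hg h trivial
      have := add₂ A (child (hΔS h') (by simp [Msg.children])) B
        (child (hΔS h') (by simp [Msg.children])) (.lp h')
      exact ⟨hup this.1, hup this.2⟩
    · intro A K h hK
      have h' := hg h trivial
      exact hup (add₂ A (child (hΔS h') (by simp [Msg.children])) K (hS'S hK.1)
        (.le h' hK.2)).1
    · intro A K L h hL hKL
      have h' := hg h trivial
      exact hup (add A (child (hΔS h') (by simp [Msg.children])) (.sign h' (hg hL trivial) hKL))
    · intro A K h hK
      have h' := hg h trivial
      exact hup (add₂ A (child (hΔS h') (by simp [Msg.children])) K (hS'S hK.1)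
        (.blind₁ h' hK.2)).1
    · intro A R K h hR
      have h' := hg h trivial
      -- The unblinded signature need not be a subterm; it is in the saturated set because that set
      -- contains all `sign` of proper subterms.
      exact hup (add₂ (.sign A K) (unblind_mem_St (hΔS h')) R (hS'S hR.1)
        (.blind₂ h' hR.2)).1
  have := hcl.syn_of_natDed hT hS'c (fun A hA => hSN A (hS'S hA))
    (hΓΔ.trans hup) h
  exact hlin (.r (hcl.mem_of_syn hT hS'c ⟨M, .inl rfl, .refl⟩ this).2)

theorem linDed_iff_natDed (hT : ACConvergent T) (hΓ : Γ.Finite) {M : T.Message}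
    (hN : NormalSequent T Γ M) : LinDed T Γ M ↔ NatDed T Γ M :=
  ⟨fun h => h.seqDed.natDed, fun h => h.linDed hT hΓ hN⟩

theorem seqDed_iff_natDed (hT : ACConvergent T) (hΓ : Γ.Finite) {M : T.Message}
    (hN : NormalSequent T Γ M) : SeqDed T Γ M ↔ NatDed T Γ M :=
  ⟨fun h => h.natDed, fun h => (h.linDed hT hΓ hN).seqDed⟩

/-- A closed set of messages derivable from `Γ` decides derivability. -/
theorem Closed.mem_iff_natDed (hT : ACConvergent T) {S : Set T.Message} (hΔ : Closed T S Δ)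
    (hS : ChildClosed S) (hN : ∀ M ∈ S, IsNormal T M) (hΓ : Γ ⊆ Δ)
    (hsound : ∀ M ∈ Δ, NatDed T Γ M) {M : T.Message} (hM : M ∈ S) : M ∈ Δ ↔ NatDed T Γ M :=
  ⟨hsound M, fun h => hΔ.mem_of_syn hT hS hM (hΔ.syn_of_natDed hT hS hN hΓ h)⟩

/-- Equality modulo AC of normal messages, as an elementary deduction problem. -/
theorem acEq_iff_elem_sign (hT : ACConvergent T) {K L : T.Message} (hK : IsNormal T K)
    (hL : IsNormal T L) : ACEq T K L ↔ Elem T {.sign K K} (.sign L L) := by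
  rw [elem_iff_elemI]
  constructor
  · exact fun h => .conv (.id rfl) (EqE.sign h.eqE h.eqE).symm
  · intro h
    -- Wrapping in `sign` makes hypothesis and goal guarded, which rules out any nontrivial
    -- equational context between them.
    obtain ⟨A, hA, hA' | hA', h⟩ := h.exists_eqE_of_isGuarded hT (G := .sign L L) (X := ∅) trivial
      (fun M hM => .inl (by rw [Set.mem_singleton_iff.1 hM]; trivial)) (fun v hv => hv.elim)
    · obtain rfl := Set.mem_singleton_iff.1 hA'
      exact (h.guarded_inv hT hA (N := .sign L L) trivial).2.1.acEq hT hK hL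
    · exact hA'.elim

end Equivalence

/-! ### Executions of while programs -/

section Machine

/-- A bound for the registers of an expression. -/
def Expr.bound : Expr → ℕ
  | .reg i => i + 1
  | .nil => 0
  | .cons a b => max a.bound b.bound
  | .hd a => a.bound
  | .tl a => a.bound

/-- A bound for the registers of a program. -/
def Prog.bound : Prog → ℕ
  | .assign i e => max (i + 1) e.bound
  | .seq p q => max p.bound q.bound
  | .ite e p q => max e.bound (max p.bound q.bound)
  | .loop e p => max e.bound p.bound

theorem Expr.eval_congr {e : Expr} {s s' : Store} (h : ∀ i < e.bound, s i = s' i) :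
    e.eval s = e.eval s' := by
  induction e with
  | reg i => exact h i (Nat.lt_succ_self i)
  | nil => rfl
  | cons a b ih₁ ih₂ =>
    simp only [eval, ih₁ fun i hi => h i (lt_max_of_lt_left hi),
      ih₂ fun i hi => h i (lt_max_of_lt_right hi)]
  | hd a ih => simp only [eval, ih h]
  | tl a ih => simp only [eval, ih h]

/-- A program neither reads nor changes the registers beyond its bound. -/
theorem Exec.frame {p : Prog} {s s' : Store} {t : ℕ} (h : Exec p s t s') :
    ∀ (N : ℕ), p.bound ≤ N → ∀ r : Store, (∀ i < N, r i = s i) →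
      ∃ r', Exec p r t r' ∧ (∀ i < N, r' i = s' i) ∧ ∀ i, N ≤ i → r' i = r i := by
  induction h with
  | assign i e s =>
    intro N hN r hr
    simp only [Prog.bound, max_le_iff] at hN
    refine ⟨_, .assign i e r, fun j hj => ?_, fun j hj => ?_⟩
    · rw [Expr.eval_congr fun k hk => hr k (hk.trans_le hN.2)]
      rcases eq_or_ne j i with rfl | hji
      · simp
      · simpa [hji] using hr j hj
    · rw [Function.update_of_ne (by omega)]
  | seq _ _ ih₁ ih₂ =>
    intro N hN r hr
    simp only [Prog.bound, max_le_iff] at hN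
    obtain ⟨r₁, h₁, h₂, h₃⟩ := ih₁ N hN.1 r hr
    obtain ⟨r₂, h₄, h₅, h₆⟩ := ih₂ N hN.2 r₁ h₂
    exact ⟨r₂, .seq h₁ h₄, h₅, fun i hi => (h₆ i hi).trans (h₃ i hi)⟩
  | ite_true he _ ih =>
    intro N hN r hr
    simp only [Prog.bound, max_le_iff] at hN
    obtain ⟨r₁, h₁, h₂, h₃⟩ := ih N hN.2.1 r hr
    refine ⟨r₁, .ite_true ?_ h₁, h₂, h₃⟩
    rwa [Expr.eval_congr fun k hk => hr k (hk.trans_le hN.1)]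
  | ite_false he _ ih =>
    intro N hN r hr
    simp only [Prog.bound, max_le_iff] at hN
    obtain ⟨r₁, h₁, h₂, h₃⟩ := ih N hN.2.2 r hr
    refine ⟨r₁, .ite_false ?_ h₁, h₂, h₃⟩
    rwa [Expr.eval_congr fun k hk => hr k (hk.trans_le hN.1)]
  | loop_true he _ _ ih₁ ih₂ =>
    intro N hN r hr
    have hN' := hN
    simp only [Prog.bound, max_le_iff] at hN
    obtain ⟨r₁, h₁, h₂, h₃⟩ := ih₁ N hN.2 r hr
    obtain ⟨r₂, h₄, h₅, h₆⟩ := ih₂ N hN' r₁ h₂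
    refine ⟨r₂, .loop_true ?_ h₁ h₄, h₅, fun i hi => (h₆ i hi).trans (h₃ i hi)⟩
    rwa [Expr.eval_congr fun k hk => hr k (hk.trans_le hN.1)]
  | loop_false he =>
    intro N hN r hr
    simp only [Prog.bound, max_le_iff] at hN
    refine ⟨r, .loop_false ?_, hr, fun _ _ => rfl⟩
    rwa [Expr.eval_congr fun k hk => hr k (hk.trans_le hN.1)]

/-- Set the registers `1, …, m` to `nil`. -/
def Prog.clear : ℕ → Prog
  | 0 => .assign 0 (.reg 0)
  | m + 1 => .seq (clear m) (.assign (m + 1) .nil)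

theorem Exec.clear (m : ℕ) (s : Store) : ∃ s', Exec (Prog.clear m) s (2 * (m + 1)) s' ∧ s' 0 = s 0 ∧
    (∀ i, 1 ≤ i → i ≤ m → s' i = .nil) ∧ ∀ i, m < i → s' i = s i := by
  induction m with
  | zero =>
    refine ⟨_, .assign 0 (.reg 0) s, by simp [Expr.eval], fun i h₁ h₂ => by omega, fun i hi => ?_⟩
    rw [Function.update_of_ne (by omega)]
  | succ m ih =>
    obtain ⟨s', h₁, h₂, h₃, h₄⟩ := ih
    refine ⟨_, .seq h₁ (.assign (m + 1) .nil s'), ?_, fun i h h' => ?_, fun i hi => ?_⟩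
    · rw [Function.update_of_ne (by omega), h₂]
    · rcases eq_or_ne i (m + 1) with rfl | hi
      · simp [Expr.eval]
      · rw [Function.update_of_ne hi, h₃ i h (by omega)]
    · rw [Function.update_of_ne (by omega), h₄ i (by omega)]

end Machine

/-! ### Functions computed in polynomial time -/

section PolyTime

variable {O : Type} {w : O → ℕ → ℕ} {ι : Type} {n : ι → ℕ}

/-- For each oracle `o`, some program computes `v i` from `e i`, in a time polynomial in `n i`
except for a factor `w o (n i)`. The exponent does not depend on `o`. The program leaves almost
all registers unchanged. -/
def PolyTime (w : O → ℕ → ℕ) (n : ι → ℕ) (e v : ι → Tree) : Prop :=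
  ∃ k : ℕ, ∀ o : O, ∃ (p : Prog) (N c : ℕ), ∀ (i : ι) (s : Store), s 0 = e i →
    ∃ (t : ℕ) (s' : Store), Exec p s t s' ∧ t ≤ c * (n i + 1) ^ k * (w o (n i) + 1) ∧
      s' 0 = v i ∧ ∀ j, N ≤ j → s' j = s j

theorem const_le_bound (c m k x : ℕ) : c ≤ c * (m + 1) ^ k * (x + 1) := by
  calc c = c * 1 * 1 := by simp
    _ ≤ c * (m + 1) ^ k * (x + 1) :=
      Nat.mul_le_mul (Nat.mul_le_mul le_rfl (Nat.one_le_pow _ _ (by omega))) (by omega)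

theorem bound_mono {c m k x c' k' m' x' : ℕ} (hc : c ≤ c') (hk : k ≤ k') (hm : m ≤ m')
    (hx : x ≤ x') : c * (m + 1) ^ k * (x + 1) ≤ c' * (m' + 1) ^ k' * (x' + 1) := by
  have : (m + 1) ^ k ≤ (m' + 1) ^ k' :=
    (Nat.pow_le_pow_right (by omega) hk).trans (Nat.pow_le_pow_left (by omega) _)
  gcongr

theorem bound_add (c c' m k k' x : ℕ) :
    c * (m + 1) ^ k * (x + 1) + c' * (m + 1) ^ k' * (x + 1) ≤
      (c + c') * (m + 1) ^ (max k k') * (x + 1) := by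
  rw [add_mul, add_mul]
  exact Nat.add_le_add (bound_mono le_rfl (le_max_left _ _) le_rfl le_rfl)
    (bound_mono le_rfl (le_max_right _ _) le_rfl le_rfl)

theorem PolyTime.comp_index {κ : Type} {e v : ι → Tree} (h : PolyTime w n e v) (π : κ → ι) :
    PolyTime w (fun k => n (π k)) (fun k => e (π k)) (fun k => v (π k)) := by
  obtain ⟨k, h⟩ := h
  refine ⟨k, fun o => ?_⟩
  obtain ⟨p, N, c, h⟩ := h o
  exact ⟨p, N, c, fun i => h (π i)⟩

theorem PolyTime.congr {e v e' v' : ι → Tree} (h : PolyTime w n e v) (he : ∀ i, e i = e' i)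
    (hv : ∀ i, v i = v' i) : PolyTime w n e' v' := by
  obtain rfl : e = e' := funext he
  obtain rfl : v = v' := funext hv
  exact h

theorem PolyTime.of_expr {e : ι → Tree} (a : Expr) {v : ι → Tree}
    (h : ∀ i s, s 0 = e i → a.eval s = v i) : PolyTime w n e v :=
  ⟨0, fun o => ⟨.assign 0 a, 1, a.cost + 1, fun i s hs => ⟨_, _, .assign 0 a s,
    const_le_bound _ _ _ _, by simpa using h i s hs,
    fun j hj => Function.update_of_ne (by omega) _ _⟩⟩⟩

theorem PolyTime.refl (e : ι → Tree) : PolyTime w n e e :=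
  .of_expr (.reg 0) fun _ _ hs => hs

theorem PolyTime.nil (e : ι → Tree) : PolyTime w n e (fun _ => .nil) :=
  .of_expr .nil fun _ _ _ => rfl

theorem PolyTime.trans {e v u : ι → Tree} (h : PolyTime w n e v) (h' : PolyTime w n v u) :
    PolyTime w n e u := by
  obtain ⟨k, h⟩ := h
  obtain ⟨k', h'⟩ := h'
  refine ⟨max k k', fun o => ?_⟩
  obtain ⟨p, N, c, h⟩ := h o
  obtain ⟨p', N', c', h'⟩ := h' o
  refine ⟨.seq p p', max N N', c + c', fun i s hs => ?_⟩
  obtain ⟨t, s₁, h₁, h₂, h₃, h₄⟩ := h i s hs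
  obtain ⟨t', s₂, h₁', h₂', h₃', h₄'⟩ := h' i s₁ h₃
  refine ⟨_, _, .seq h₁ h₁', (Nat.add_le_add h₂ h₂').trans (bound_add _ _ _ _ _ _), h₃',
    fun j hj => ?_⟩
  rw [h₄' j (le_trans (le_max_right _ _) hj), h₄ j (le_trans (le_max_left _ _) hj)]

theorem PolyTime.hd {e v : ι → Tree} (h : PolyTime w n e v) :
    PolyTime w n e (fun i => (v i).hd) :=
  h.trans (.of_expr (.hd (.reg 0)) fun i s hs => by simp [Expr.eval, hs])

theorem PolyTime.tl {e v : ι → Tree} (h : PolyTime w n e v) :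
    PolyTime w n e (fun i => (v i).tl) :=
  h.trans (.of_expr (.tl (.reg 0)) fun i s hs => by simp [Expr.eval, hs])

theorem PolyTime.cons {e v u : ι → Tree} (h : PolyTime w n e v) (h' : PolyTime w n e u) :
    PolyTime w n e (fun i => .cons (v i) (u i)) := by
  obtain ⟨k, h⟩ := h
  obtain ⟨k', h'⟩ := h'
  refine ⟨max k k', fun o => ?_⟩
  obtain ⟨p, N, c, h⟩ := h o
  obtain ⟨p', N', c', h'⟩ := h' o
  -- Neither program touches registers from `R` on: `R` saves the environment and `R + 1` the first
  -- result. The extra assignments cost exactly 10 steps.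
  let R := max N N' + 1
  refine ⟨.seq (.assign R (.reg 0)) (.seq p (.seq (.assign (R + 1) (.reg 0))
    (.seq (.assign 0 (.reg R)) (.seq p' (.assign 0 (.cons (.reg (R + 1)) (.reg 0))))))),
    R + 2, c + c' + 10, fun i s hs => ?_⟩
  have hN : N ≤ R := by omega
  have hN' : N' ≤ R := by omega
  obtain ⟨t, s₁, h₁, h₂, h₃, h₄⟩ := h i (Function.update s R (s 0)) (by
    rw [Function.update_of_ne (by omega), hs])
  have hR : s₁ R = e i := by rw [h₄ R hN]; simpa using hs
  let s₂ := Function.update s₁ (R + 1) (s₁ 0)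
  let s₃ := Function.update s₂ 0 (s₂ R)
  have hs₃ : s₃ 0 = e i := by
    simp only [s₃, Function.update_self, s₂]
    rw [Function.update_of_ne (by omega), hR]
  obtain ⟨t', s₄, h₁', h₂', h₃', h₄'⟩ := h' i s₃ hs₃
  refine ⟨_, _, .seq (.assign R (.reg 0) s) (.seq h₁ (.seq (.assign (R + 1) (.reg 0) s₁)
    (.seq (.assign 0 (.reg R) s₂) (.seq h₁' (.assign 0 _ s₄))))), ?_, ?_, fun j hj => ?_⟩
  · have := bound_add c c' (n i) k k' (w o (n i))
    have h10 := const_le_bound 10 (n i) (max k k') (w o (n i))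
    simp only [Expr.cost]
    rw [add_mul, add_mul]
    omega
  · simp only [Function.update_self, Expr.eval, h₃']
    rw [h₄' (R + 1) (by omega)]
    simp only [s₃, s₂]
    rw [Function.update_of_ne (by omega), Function.update_self, h₃]
  · rw [Function.update_of_ne (by omega), h₄' j (by omega)]
    simp only [s₃, s₂]
    rw [Function.update_of_ne (by omega), Function.update_of_ne (by omega), h₄ j (by omega),
      Function.update_of_ne (by omega)]

-- Each branch has to be computable only on the subfamily of indices where it is taken. Partial
-- operations, such as passing to an argument of a binary constructor, can therefore be guarded by a
-- test.
open Classical in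
theorem PolyTime.ite {P : ι → Prop} {e v u : ι → Tree}
    (hP : PolyTime w n e (fun i => .ofProp (P i)))
    (h : ∀ (κ : Type) (π : κ → ι), (∀ k, P (π k)) →
      PolyTime w (fun k => n (π k)) (fun k => e (π k)) (fun k => v (π k)))
    (h' : ∀ (κ : Type) (π : κ → ι), (∀ k, ¬ P (π k)) →
      PolyTime w (fun k => n (π k)) (fun k => e (π k)) (fun k => u (π k))) :
    PolyTime w n e (fun i => if P i then v i else u i) := by
  refine (hP.cons (.refl e)).trans ?_
  obtain ⟨k, h⟩ := h {i // P i} Subtype.val fun k => k.2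
  obtain ⟨k', h'⟩ := h' {i // ¬ P i} Subtype.val fun k => k.2
  refine ⟨max k k', fun o => ?_⟩
  obtain ⟨p, N, c, h⟩ := h o
  obtain ⟨p', N', c', h'⟩ := h' o
  let R := max N N' + 1
  refine ⟨.seq (.assign R (.hd (.reg 0))) (.seq (.assign 0 (.tl (.reg 0))) (.ite (.reg R) p p')),
    R + 1, c + c' + 10, fun i s hs => ?_⟩
  let s₁ := Function.update s R (s 0).hd
  let s₂ := Function.update s₁ 0 (s₁ 0).tl
  have h₂ : s₂ 0 = e i := by
    simp only [s₂, s₁, Function.update_self]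
    rw [Function.update_of_ne (by omega), hs]; rfl
  have hR : s₂ R = .ofProp (P i) := by
    simp only [s₂, s₁]
    rw [Function.update_of_ne (by omega), Function.update_self, hs]; rfl
  have hs₂ : ∀ j, R + 1 ≤ j → s₂ j = s j := fun j hj => by
    simp only [s₂, s₁]
    rw [Function.update_of_ne (by omega), Function.update_of_ne (by omega)]
  have hbd := bound_add c c' (n i) k k' (w o (n i))
  have h10 := const_le_bound 10 (n i) (max k k') (w o (n i))
  by_cases hi : P i
  · obtain ⟨t, s₃, e₁, e₂, e₃, e₄⟩ := h ⟨i, hi⟩ s₂ h₂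
    refine ⟨_, _, .seq (.assign R _ s) (.seq (.assign 0 _ s₁) (.ite_true (fun hh => ?_) e₁)),
      ?_, e₃.trans (if_pos hi).symm, fun j hj => by rw [e₄ j (by omega), hs₂ j hj]⟩
    · have := hR.symm.trans hh
      rw [Tree.ofProp, if_pos hi] at this
      cases this
    · simp only [Expr.cost]
      rw [add_mul, add_mul]
      simp only at e₂
      omega
  · obtain ⟨t, s₃, e₁, e₂, e₃, e₄⟩ := h' ⟨i, hi⟩ s₂ h₂
    refine ⟨_, _, .seq (.assign R _ s) (.seq (.assign 0 _ s₁) (.ite_false (hR.trans ?_) e₁)),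
      ?_, e₃.trans (if_neg hi).symm, fun j hj => by rw [e₄ j (by omega), hs₂ j hj]⟩
    · rw [Tree.ofProp, if_neg hi]
    · simp only [Expr.cost]
      rw [add_mul, add_mul]
      simp only at e₂
      omega

/-- A family of lists whose lengths are polynomially bounded. -/
def PolyLength {β : Type} (n : ι → ℕ) (L : ι → List β) : Prop :=
  ∃ a b, ∀ i, (L i).length ≤ a * (n i + 1) ^ b

/-- Loops over lists: `A i pre` is the value of the accumulator after the prefix `pre` of the
list. -/
theorem PolyTime.foldl {β : Type} {e : ι → Tree} {L : ι → List β} {enc : ι → β → Tree}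
    {A : ι → List β → Tree} (hlen : PolyLength n L)
    (hL : PolyTime w n e (fun i => .ofList ((L i).map (enc i))))
    (h₀ : PolyTime w n e (fun i => A i []))
    (hA : PolyTime (ι := {q : ι × List β × β // (q.2.1 ++ [q.2.2]) <+: L q.1}) w
      (fun q => n q.1.1)
      (fun q => .cons (enc q.1.1 q.1.2.2) (.cons (A q.1.1 q.1.2.1) (e q.1.1)))
      (fun q => A q.1.1 (q.1.2.1 ++ [q.1.2.2]))) :
    PolyTime w n e (fun i => A i (L i)) := by
  refine (hL.cons (h₀.cons (.refl e))).trans ?_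
  obtain ⟨a, b, hlen⟩ := hlen
  obtain ⟨k, hA⟩ := hA
  refine ⟨b + k, fun o => ?_⟩
  obtain ⟨p, N, c, h⟩ := hA o
  -- Beyond the registers of the body, `R` holds the rest of the list, `R + 1` the environment and
  -- `R + 2` the accumulator. The constants 20 cover the bookkeeping of one round and of the whole
  -- loop. The exponents of list length and body add up.
  let R := N + 1
  let body : Prog := .seq (.assign 0 (.cons (.hd (.reg R)) (.cons (.reg (R + 2)) (.reg (R + 1)))))
    (.seq p (.seq (.assign (R + 2) (.reg 0)) (.assign R (.tl (.reg R)))))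
  refine ⟨.seq (.assign R (.hd (.reg 0))) (.seq (.assign (R + 2) (.hd (.tl (.reg 0))))
    (.seq (.assign (R + 1) (.tl (.tl (.reg 0)))) (.seq (.loop (.reg R) body)
      (.assign 0 (.reg (R + 2)))))), R + 3, a * (c + 20) + 20, fun i s hs => ?_⟩
  have loop : ∀ (post pre : List β), L i = pre ++ post → ∀ s : Store,
      s R = .ofList (post.map (enc i)) → s (R + 1) = e i → s (R + 2) = A i pre →
      ∃ t s', Exec (.loop (.reg R) body) s t s' ∧
        t ≤ post.length * ((c + 20) * (n i + 1) ^ k * (w o (n i) + 1)) + 2 ∧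
        s' (R + 2) = A i (L i) ∧ ∀ j, R + 3 ≤ j → s' j = s j := by
    intro post
    induction post with
    | nil =>
      intro pre hpre s h₁ h₂ h₃
      refine ⟨_, s, .loop_false h₁, by simp [Expr.cost], ?_, fun _ _ => rfl⟩
      rw [h₃, hpre, List.append_nil]
    | cons x xs ih =>
      intro pre hpre s h₁ h₂ h₃
      have hp : (pre ++ [x]) <+: L i := ⟨xs, by rw [hpre]; simp⟩
      let s₁ := Function.update s 0
        (Expr.eval s (.cons (.hd (.reg R)) (.cons (.reg (R + 2)) (.reg (R + 1)))))
      obtain ⟨t, s₂, e₁, e₂, e₃, e₄⟩ := h ⟨(i, pre, x), hp⟩ s₁ (by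
        simp only [s₁, Function.update_self, Expr.eval, h₁, h₂, h₃]; rfl)
      simp only at e₂ e₃
      let s₃ := Function.update s₂ (R + 2) (s₂ 0)
      let s₄ := Function.update s₃ R (s₃ R).tl
      have hs : ∀ j, R ≤ j → s₂ j = s j := fun j hj => by
        rw [e₄ j (by omega)]
        simp only [s₁]
        rw [Function.update_of_ne (by omega)]
      obtain ⟨t', s₅, e₁', e₂', e₃', e₄'⟩ := ih (pre ++ [x]) (by rw [hpre]; simp) s₄
        (by
          simp only [s₄, s₃, Function.update_self]
          rw [Function.update_of_ne (by omega), hs R le_rfl, h₁]; rfl)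
        (by
          simp only [s₄, s₃]
          rw [Function.update_of_ne (by omega), Function.update_of_ne (by omega),
            hs _ (by omega), h₂])
        (by
          simp only [s₄, s₃]
          rw [Function.update_of_ne (by omega), Function.update_self, e₃])
      refine ⟨_, s₅, .loop_true (by simp only [Expr.eval, h₁]; exact Tree.noConfusion)
        (.seq (.assign 0 _ s) (.seq e₁ (.seq (.assign (R + 2) (.reg 0) s₂)
          (.assign R (.tl (.reg R)) s₃)))) e₁', ?_, e₃', fun j hj => ?_⟩
      · have h20 := const_le_bound 20 (n i) k (w o (n i))
        simp only [Expr.cost, List.length_cons]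
        rw [Nat.succ_mul]
        have : (c + 20) * (n i + 1) ^ k * (w o (n i) + 1) =
          c * (n i + 1) ^ k * (w o (n i) + 1) + 20 * (n i + 1) ^ k * (w o (n i) + 1) := by ring
        omega
      · rw [e₄' j hj]
        simp only [s₄, s₃]
        rw [Function.update_of_ne (by omega), Function.update_of_ne (by omega), hs j (by omega)]
  let s₁ := Function.update s R (s 0).hd
  let s₂ := Function.update s₁ (R + 2) (s₁ 0).tl.hd
  let s₃ := Function.update s₂ (R + 1) (s₂ 0).tl.tl
  have hs₁ : s₁ 0 = s 0 := by
    simp only [s₁]; rw [Function.update_of_ne (by omega)]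
  have hs₂ : s₂ 0 = s 0 := by
    simp only [s₂]; rw [Function.update_of_ne (by omega), hs₁]
  obtain ⟨t, s₄, e₁, e₂, e₃, e₄⟩ := loop (L i) [] rfl s₃
    (by
      simp only [s₃]; rw [Function.update_of_ne (by omega)]
      simp only [s₂]; rw [Function.update_of_ne (by omega)]
      simp only [s₁, Function.update_self, hs]; rfl)
    (by simp only [s₃, Function.update_self, hs₂, hs]; rfl)
    (by
      simp only [s₃]; rw [Function.update_of_ne (by omega)]
      simp only [s₂, Function.update_self, hs₁, hs]; rfl)
  refine ⟨_, _, .seq (.assign R _ s) (.seq (.assign (R + 2) _ s₁) (.seq (.assign (R + 1) _ s₂)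
    (.seq e₁ (.assign 0 (.reg (R + 2)) s₄)))), ?_, ?_, fun j hj => ?_⟩
  · have h20 := const_le_bound 20 (n i) (b + k) (w o (n i))
    have hmul := Nat.mul_le_mul_right ((c + 20) * (n i + 1) ^ k * (w o (n i) + 1)) (hlen i)
    simp only [Expr.cost]
    have : (a * (c + 20) + 20) * (n i + 1) ^ (b + k) * (w o (n i) + 1) =
      a * (n i + 1) ^ b * ((c + 20) * (n i + 1) ^ k * (w o (n i) + 1)) +
        20 * (n i + 1) ^ (b + k) * (w o (n i) + 1) := by ring
    omega
  · simp only [Function.update_self, Expr.eval, e₃]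
  · rw [Function.update_of_ne (by omega), e₄ j (by omega)]
    simp only [s₃, s₂, s₁]
    rw [Function.update_of_ne (by omega), Function.update_of_ne (by omega),
      Function.update_of_ne (by omega)]

end PolyTime

/-! ### Combinators: Boolean connectives, unary numbers, loops over lists. -/

section Combinators

variable {O : Type} {w : O → ℕ → ℕ} {ι : Type} {n : ι → ℕ} {e : ι → Tree}

/-- Polynomial-time decidability. -/
abbrev PolyDec (w : O → ℕ → ℕ) (n : ι → ℕ) (e : ι → Tree) (P : ι → Prop) : Prop :=
  PolyTime w n e (fun i => .ofProp (P i))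

/-- From the environment `e'` over `κ`, the environment `e` over `ι` is computable. -/
abbrev Extends (w : O → ℕ → ℕ) (n : ι → ℕ) (e : ι → Tree) {κ : Type} (π : κ → ι)
    (e' : κ → Tree) : Prop :=
  PolyTime w (fun k => n (π k)) e' (fun k => e (π k))

theorem PolyTime.lift {v : ι → Tree} (h : PolyTime w n e v) {κ : Type} {π : κ → ι}
    {e' : κ → Tree} (he : Extends w n e π e') :
    PolyTime w (fun k => n (π k)) e' (fun k => v (π k)) :=
  PolyTime.trans he (h.comp_index π)

theorem PolyTime.reverse {β : Type} {L : ι → List β} {enc : ι → β → Tree} (hlen : PolyLength n L)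
    (hL : PolyTime w n e (fun i => .ofList ((L i).map (enc i)))) :
    PolyTime w n e (fun i => .ofList ((L i).reverse.map (enc i))) := by
  refine PolyTime.foldl (A := fun i pre => .ofList (pre.reverse.map (enc i))) hlen hL (.nil e) ?_
  refine ((PolyTime.refl _).hd.cons (PolyTime.refl _).tl.hd).congr (fun _ => rfl) fun q => ?_
  simp [Tree.ofList, Tree.hd, Tree.tl]

/-- Loops from the end of a list to its beginning: `A i xs` is the value of the accumulator after
the suffix `xs` of the list. -/
theorem PolyTime.foldr {β : Type} {L : ι → List β} {enc : ι → β → Tree}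
    {A : ι → List β → Tree} (hlen : PolyLength n L)
    (hL : PolyTime w n e (fun i => .ofList ((L i).map (enc i))))
    (h₀ : PolyTime w n e (fun i => A i []))
    (hA : ∀ (κ : Type) (π : κ → ι) (x : κ → β) (xs : κ → List β) (e' : κ → Tree),
      (∀ k, x k :: xs k <:+ L (π k)) → Extends w n e π e' →
      PolyTime w (fun k => n (π k)) e' (fun k => enc (π k) (x k)) →
      PolyTime w (fun k => n (π k)) e' (fun k => A (π k) (xs k)) →
      PolyTime w (fun k => n (π k)) e' (fun k => A (π k) (x k :: xs k))) :
    PolyTime w n e (fun i => A i (L i)) := by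
  -- The prefixes of the reversed list, reversed, are the suffixes of the list.
  have := PolyTime.foldl (L := fun i => (L i).reverse) (enc := enc)
    (A := fun i pre => A i pre.reverse) (e := e) (n := n) (w := w)
    (by obtain ⟨a, b, h⟩ := hlen; exact ⟨a, b, fun i => by simpa using h i⟩)
    (hL.reverse hlen) h₀ ?_
  · simpa using this
  · refine (hA {q : ι × List β × β // (q.2.1 ++ [q.2.2]) <+: (L q.1).reverse} (fun q => q.1.1)
      (fun q => q.1.2.2) (fun q => q.1.2.1.reverse) _ (fun q => ?_) (PolyTime.refl _).tl.tl (PolyTime.refl _).hd (PolyTime.refl _).tl.hd).congr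
      (fun _ => rfl) fun q => by simp
    have := List.reverse_suffix.2 q.2
    simpa using this

/-- The body is required for every family of list elements and every environment from which the
outer one can be recomputed. This form lets loops be nested: outer data are carried inward with
`lift`. -/
theorem PolyTime.map {β : Type} {L : ι → List β} {enc g : ι → β → Tree} (hlen : PolyLength n L)
    (hL : PolyTime w n e (fun i => .ofList ((L i).map (enc i))))
    (hg : ∀ (κ : Type) (π : κ → ι) (x : κ → β) (e' : κ → Tree),
      (∀ k, x k ∈ L (π k)) → Extends w n e π e' →
      PolyTime w (fun k => n (π k)) e' (fun k => enc (π k) (x k)) →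
      PolyTime w (fun k => n (π k)) e' (fun k => g (π k) (x k))) :
    PolyTime w n e (fun i => .ofList ((L i).map (g i))) :=
  PolyTime.foldr (A := fun i xs => .ofList (xs.map (g i))) hlen hL (.nil e)
    fun κ π x _ e' hx he h₁ h₂ =>
      (hg κ π x e' (fun k => (hx k).subset List.mem_cons_self) he h₁).cons h₂

theorem PolyTime.ofNat_const (c : ℕ) : PolyTime w n e (fun _ => .ofNat c) := by
  induction c with
  | zero => exact .nil e
  | succ c ih => exact (PolyTime.nil e).cons ih

theorem PolyDec.const (p : Prop) : PolyDec w n e (fun _ => p) := by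
  by_cases hp : p
  · exact ((PolyTime.nil e).cons (.nil e)).congr (fun _ => rfl) fun _ => by simp [Tree.ofProp, hp]
  · exact (PolyTime.nil e).congr (fun _ => rfl) fun _ => by simp [Tree.ofProp, hp]

theorem PolyDec.congr {P Q : ι → Prop} (h : PolyDec w n e P) (hPQ : ∀ i, P i ↔ Q i) :
    PolyDec w n e Q :=
  PolyTime.congr h (fun _ => rfl) fun i => by rw [propext (hPQ i)]

/-- Conjunction; the second conjunct need only be decided where the first one holds. -/
theorem PolyDec.and {P Q : ι → Prop} (h : PolyDec w n e P)
    (h' : ∀ (κ : Type) (π : κ → ι), (∀ k, P (π k)) →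
      PolyDec w (fun k => n (π k)) (fun k => e (π k)) (fun k => Q (π k))) :
    PolyDec w n e (fun i => P i ∧ Q i) := by
  refine (PolyTime.ite (v := fun i => .ofProp (Q i)) (u := fun _ => .nil) h h'
    fun κ π _ => .nil _).congr (fun _ => rfl) fun i => ?_
  by_cases hP : P i
  · simp only [hP, if_true, true_and]
  · simp [hP, Tree.ofProp]

theorem PolyDec.and' {P Q : ι → Prop} (h : PolyDec w n e P) (h' : PolyDec w n e Q) :
    PolyDec w n e (fun i => P i ∧ Q i) :=
  h.and fun _ π _ => PolyTime.comp_index h' π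

theorem PolyDec.or {P Q : ι → Prop} (h : PolyDec w n e P) (h' : PolyDec w n e Q) :
    PolyDec w n e (fun i => P i ∨ Q i) := by
  refine (PolyTime.ite (v := fun _ => .ofProp True) (u := fun i => .ofProp (Q i)) h (fun κ π _ => PolyDec.const True)
    fun κ π _ => PolyTime.comp_index h' π).congr (fun _ => rfl) fun i => ?_
  by_cases hP : P i <;> simp [hP]

theorem PolyDec.not {P : ι → Prop} (h : PolyDec w n e P) : PolyDec w n e (fun i => ¬ P i) := by
  refine (PolyTime.ite (v := fun _ => .ofProp False) (u := fun _ => .ofProp True) h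
    (fun κ π _ => PolyDec.const False) fun κ π _ => PolyDec.const True).congr
    (fun _ => rfl) fun i => ?_
  by_cases hP : P i <;> simp [hP]

theorem PolyDec.exists_mem {β : Type} {L : ι → List β} {enc : ι → β → Tree} {P : ι → β → Prop}
    (hlen : PolyLength n L)
    (hL : PolyTime w n e (fun i => .ofList ((L i).map (enc i))))
    (hP : ∀ (κ : Type) (π : κ → ι) (x : κ → β) (e' : κ → Tree),
      (∀ k, x k ∈ L (π k)) → Extends w n e π e' →
      PolyTime w (fun k => n (π k)) e' (fun k => enc (π k) (x k)) →
      PolyDec w (fun k => n (π k)) e' (fun k => P (π k) (x k))) :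
    PolyDec w n e (fun i => ∃ x ∈ L i, P i x) := by
  refine PolyTime.foldr (A := fun i xs => .ofProp (∃ x ∈ xs, P i x)) hlen hL ?_ ?_
  · exact (PolyDec.const False).congr fun i => by simp
  · intro κ π x xs e' hx he h₁ h₂
    exact ((hP κ π x e' (fun k => (hx k).subset List.mem_cons_self) he h₁).or h₂).congr
      fun k => by simp

theorem PolyDec.forall_mem {β : Type} {L : ι → List β} {enc : ι → β → Tree} {P : ι → β → Prop}
    (hlen : PolyLength n L)
    (hL : PolyTime w n e (fun i => .ofList ((L i).map (enc i))))
    (hP : ∀ (κ : Type) (π : κ → ι) (x : κ → β) (e' : κ → Tree),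
      (∀ k, x k ∈ L (π k)) → Extends w n e π e' →
      PolyTime w (fun k => n (π k)) e' (fun k => enc (π k) (x k)) →
      PolyDec w (fun k => n (π k)) e' (fun k => P (π k) (x k))) :
    PolyDec w n e (fun i => ∀ x ∈ L i, P i x) :=
  (PolyDec.exists_mem (P := fun i x => ¬ P i x) hlen hL
    fun κ π x e' hx he h => (hP κ π x e' hx he h).not).not.congr fun i => by simp

theorem Tree.ofNat_eq (a : ℕ) : Tree.ofNat a = .ofList ((List.replicate a ()).map fun _ => .nil) := by
  induction a with
  | zero => rfl
  | succ a ih => simp only [ofNat, ih, List.replicate_succ, List.map_cons, ofList]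

theorem Tree.tl_iterate_nil (a : ℕ) : Tree.tl^[a] .nil = .nil := by
  induction a with
  | zero => rfl
  | succ a ih => exact ih

theorem Tree.tl_iterate_ofNat (a b : ℕ) : Tree.tl^[a] (.ofNat b) = .ofNat (b - a) := by
  induction a generalizing b with
  | zero => rfl
  | succ a ih =>
    cases b with
    | zero => rw [Nat.zero_sub]; exact tl_iterate_nil (a + 1)
    | succ b => simpa [Function.iterate_succ_apply, ofNat, tl] using ih b

theorem Tree.tl_iterate_ofList (a : ℕ) (L : List Tree) :
    Tree.tl^[a] (.ofList L) = .ofList (L.drop a) := by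
  induction a generalizing L with
  | zero => rfl
  | succ a ih =>
    cases L with
    | nil => rw [List.drop_nil]; exact tl_iterate_nil (a + 1)
    | cons x L => simpa [Function.iterate_succ_apply, ofList, tl] using ih L

/-- A polynomially bounded family of numbers. -/
def PolyBounded (n a : ι → ℕ) : Prop := ∃ c k, ∀ i, a i ≤ c * (n i + 1) ^ k

theorem PolyBounded.const (c : ℕ) : PolyBounded n (fun _ => c) := ⟨c, 0, fun _ => by simp⟩

theorem PolyBounded.of_le {a : ι → ℕ} (h : ∀ i, a i ≤ n i) : PolyBounded n a :=
  ⟨1, 1, fun i => by have := h i; simp; omega⟩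

theorem PolyTime.tl_iterate {a : ι → ℕ} {v : ι → Tree} (hb : PolyBounded n a)
    (ha : PolyTime w n e (fun i => .ofNat (a i))) (hv : PolyTime w n e v) :
    PolyTime w n e (fun i => Tree.tl^[a i] (v i)) := by
  have := PolyTime.foldr (L := fun i => List.replicate (a i) ()) (enc := fun _ _ => .nil)
    (A := fun i xs => Tree.tl^[xs.length] (v i)) (e := e) (n := n) (w := w)
    (by obtain ⟨c, k, hb⟩ := hb; exact ⟨c, k, fun i => by simpa using hb i⟩)
    (ha.congr (fun _ => rfl) fun i => Tree.ofNat_eq _) hv ?_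
  · simpa using this
  · intro κ π x xs e' _ _ _ h
    refine h.tl.congr (fun _ => rfl) fun k => ?_
    rw [List.length_cons, Function.iterate_succ_apply']

-- Dropping `a` cells from the unary number `b` leaves the truncated difference, which is not `nil`
-- exactly when `a < b`. Only `a` controls a loop, so only `a` needs a bound.
open Classical in
theorem PolyDec.lt {a b : ι → ℕ} (hab : PolyBounded n a)
    (ha : PolyTime w n e (fun i => .ofNat (a i))) (hb : PolyTime w n e (fun i => .ofNat (b i))) :
    PolyDec w n e (fun i => a i < b i) := by
  have h := PolyTime.tl_iterate hab ha hb
  have : PolyDec w n (fun i => Tree.ofNat (b i - a i)) (fun i => a i < b i) := by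
    refine ⟨0, fun o => ⟨.ite (.reg 0) (.assign 0 (.cons .nil .nil)) (.assign 0 .nil), 1, 10,
      fun i s hs => ?_⟩⟩
    have h10 := const_le_bound 10 (n i) 0 (w o (n i))
    by_cases hi : a i < b i
    · refine ⟨_, _, .ite_true ?_ (.assign 0 _ s), ?_, ?_, fun j hj => Function.update_of_ne (by omega) _ _⟩
      · obtain ⟨c, hc⟩ := Nat.exists_eq_add_of_lt hi
        simp only [Expr.eval, hs, show b i - a i = c + 1 by omega, Tree.ofNat]
        exact Tree.noConfusion
      · simp only [Expr.cost]; omega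
      · simp [Tree.ofProp, hi, Expr.eval]
    · refine ⟨_, _, .ite_false ?_ (.assign 0 _ s), ?_, ?_, fun j hj => Function.update_of_ne (by omega) _ _⟩
      · simp only [Expr.eval, hs, show b i - a i = 0 by omega, Tree.ofNat]
      · simp only [Expr.cost]; omega
      · simp [Tree.ofProp, hi, Expr.eval]
  exact (h.congr (fun _ => rfl) fun i => Tree.tl_iterate_ofNat _ _).trans this

theorem PolyDec.nat_eq {a b : ι → ℕ} (hab : PolyBounded n a) (hbb : PolyBounded n b)
    (ha : PolyTime w n e (fun i => .ofNat (a i))) (hb : PolyTime w n e (fun i => .ofNat (b i))) :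
    PolyDec w n e (fun i => a i = b i) :=
  ((PolyDec.lt hab ha hb).not.and' (PolyDec.lt hbb hb ha).not).congr fun i => by omega

theorem PolyTime.ofNat_length {β : Type} {L : ι → List β} {enc : ι → β → Tree}
    (hlen : PolyLength n L)
    (hL : PolyTime w n e (fun i => .ofList ((L i).map (enc i)))) :
    PolyTime w n e (fun i => .ofNat (L i).length) :=
  PolyTime.foldr (A := fun _ xs => .ofNat xs.length) hlen hL (.nil e)
    fun _ _ _ _ _ _ _ _ h => (PolyTime.nil _).cons h

theorem PolyTime.range_length {β : Type} {L : ι → List β} {enc : ι → β → Tree}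
    (hlen : PolyLength n L)
    (hL : PolyTime w n e (fun i => .ofList ((L i).map (enc i)))) :
    PolyTime w n e (fun i => .ofList ((List.range (L i).length).map .ofNat)) := by
  -- The accumulator pairs the current position with the list of positions from there on. The loop
  -- runs backwards, so the position starts at the length and drops by one each round.
  have := PolyTime.foldr (A := fun i xs => .cons (.ofNat ((L i).length - xs.length))
    (.ofList ((List.range' ((L i).length - xs.length) xs.length).map .ofNat))) hlen hL
    (e := e) (n := n) (w := w) ((PolyTime.ofNat_length hlen hL).cons (.nil e)) ?_
  · refine this.tl.congr (fun _ => rfl) fun i => ?_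
    simp [Tree.tl, List.range_eq_range']
  · intro κ π x xs e' hx _ _ h
    refine (h.hd.tl.cons (h.hd.tl.cons h.tl)).congr (fun _ => rfl) fun k => ?_
    have := (hx k).length_le
    rw [List.length_cons] at this
    obtain ⟨m, hm⟩ := Nat.exists_eq_add_of_le this
    have h₁ : (L (π k)).length - (xs k).length = m + 1 := by omega
    have h₂ : (L (π k)).length - (x k :: xs k).length = m := by rw [List.length_cons]; omega
    rw [h₁, h₂]
    simp only [Tree.hd, Tree.tl, Tree.ofNat, List.length_cons, List.range'_succ, List.map_cons,
      Tree.ofList]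

open Classical in
theorem PolyTime.filter_map {β : Type} {L : ι → List β} {enc g : ι → β → Tree}
    {P : ι → β → Prop} (hlen : PolyLength n L)
    (hL : PolyTime w n e (fun i => .ofList ((L i).map (enc i))))
    (hP : ∀ (κ : Type) (π : κ → ι) (x : κ → β) (e' : κ → Tree),
      (∀ k, x k ∈ L (π k)) → Extends w n e π e' →
      PolyTime w (fun k => n (π k)) e' (fun k => enc (π k) (x k)) →
      PolyDec w (fun k => n (π k)) e' (fun k => P (π k) (x k)))
    (hg : ∀ (κ : Type) (π : κ → ι) (x : κ → β) (e' : κ → Tree),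
      (∀ k, x k ∈ L (π k)) → (∀ k, P (π k) (x k)) → Extends w n e π e' →
      PolyTime w (fun k => n (π k)) e' (fun k => enc (π k) (x k)) →
      PolyTime w (fun k => n (π k)) e' (fun k => g (π k) (x k))) :
    PolyTime w n e (fun i => .ofList (((L i).filter fun x => P i x).map (g i))) := by
  refine PolyTime.foldr (A := fun i xs => .ofList ((xs.filter fun x => P i x).map (g i))) hlen hL
    (.nil e) fun κ π x xs e' hx he h₁ h₂ => ?_
  have hmem : ∀ k, x k ∈ L (π k) := fun k => (hx k).subset List.mem_cons_self
  refine (PolyTime.ite (hP κ π x e' hmem he h₁) (fun κ' ρ hρ => ?_)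
    (u := fun k => .ofList (((xs k).filter fun x => P (π k) x).map (g (π k))))
    (v := fun k => .cons (g (π k) (x k))
      (.ofList (((xs k).filter fun x => P (π k) x).map (g (π k)))))
    fun κ' ρ _ => h₂.comp_index ρ).congr (fun _ => rfl) fun k => ?_
  · exact (hg κ' (fun k => π (ρ k)) (fun k => x (ρ k)) (fun k => e' (ρ k)) (fun k => hmem _) hρ
      (PolyTime.comp_index he ρ) (h₁.comp_index ρ)).cons (h₂.comp_index ρ)
  · by_cases hk : P (π k) (x k) <;> simp [hk, Tree.ofList]

end Combinators

/-! ### Computing with instances of deduction problems -/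

/-- An instance of a deduction problem, with a node list of its DAG. -/
structure Inst (T : Theory) where
  Γ : Set T.Message
  M : T.Message
  l : List T.Message
  normal : NormalSequent T Γ M
  enum : Enumerates l Γ M

section Instances

variable {T : Theory}

/-- The tagged DAG of an instance. -/
noncomputable def Inst.dag (I : Inst T) : Tree := encodeDAG I.l I.Γ I.M

open Classical in
/-- A pointer to a node. -/
noncomputable def Inst.ptr (I : Inst T) (v : T.Message) : Tree := .ofNat (I.l.idxOf v)

/-- A set of nodes, as a list of bits. -/
noncomputable def Inst.bits (I : Inst T) (χ : Set T.Message) : Tree :=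
  .ofList (I.l.map fun v => .ofProp (v ∈ χ))

theorem Inst.bits_congr (I : Inst T) {χ χ' : Set T.Message}
    (h : ∀ v ∈ I.l, v ∈ χ ↔ v ∈ χ') : I.bits χ = I.bits χ' :=
  congrArg Tree.ofList (List.map_congr_left fun v hv => congrArg Tree.ofProp (propext (h v hv)))

theorem Inst.mem_iff (I : Inst T) {v : T.Message} : v ∈ I.l ↔ v ∈ St (insert I.M I.Γ) := I.enum.2 v

theorem Inst.goal_mem (I : Inst T) : I.M ∈ I.l := I.mem_iff.2 (subset_St _ (.inl rfl))

theorem Inst.hyp_mem (I : Inst T) {v : T.Message} (h : v ∈ I.Γ) : v ∈ I.l :=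
  I.mem_iff.2 (subset_St _ (.inr h))

theorem Inst.child_mem (I : Inst T) {u v : T.Message} (hv : v ∈ I.l) (h : u ∈ v.children) :
    u ∈ I.l :=
  I.mem_iff.2 (childClosed_St _ _ (I.mem_iff.1 hv) _ h)

theorem Inst.isNormal (I : Inst T) {v : T.Message} (hv : v ∈ I.l) : IsNormal T v :=
  isNormal_of_mem_St I.normal v (I.mem_iff.1 hv)

theorem Inst.ncard (I : Inst T) : (St (insert I.M I.Γ)).ncard = I.l.length := by
  classical
  have : St (insert I.M I.Γ) = (I.l.toFinset : Set T.Message) := by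
    ext v; simp [← I.mem_iff]
  rw [this, Set.ncard_coe_finset, List.toFinset_card_of_nodup I.enum.1]

theorem length_children_le (v : T.Message) :
    v.children.length ≤ 2 + ∑ f, T.sig.arity f := by
  cases v with
  | app f a =>
    simp only [Msg.children, List.length_ofFn]
    have := Finset.single_le_sum (f := T.sig.arity) (fun _ _ => Nat.zero_le _) (Finset.mem_univ f)
    omega
  | _ => simp [Msg.children]; try omega

theorem Tree.hd_tl_iterate_idxOf [DecidableEq T.Message] {l : List T.Message} {v : T.Message}
    (hv : v ∈ l) (f : T.Message → Tree) : (Tree.tl^[l.idxOf v] (.ofList (l.map f))).hd = f v := by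
  have h := List.idxOf_lt_length_of_mem hv
  rw [Tree.tl_iterate_ofList, ← List.map_drop, List.drop_eq_getElem_cons h]
  simp [Tree.ofList, Tree.hd]

theorem map_idxOf_eq_range [DecidableEq T.Message] {l : List T.Message} (h : l.Nodup) :
    l.map l.idxOf = List.range l.length := by
  refine List.ext_getElem (by simp) fun i h₁ h₂ => ?_
  simp [h.idxOf_getElem]

theorem Msg.label_hd {S : Sig} (v : Msg S) : v.label.hd = .ofNat v.kind := by
  cases v <;> rfl

theorem Msg.kind_le {S : Sig} (v : Msg S) : v.kind ≤ 6 := by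
  cases v <;> simp [Msg.kind]

end Instances

/-! ### Navigation in the DAG: pointers, lookup, tests on nodes, sets of nodes as bit lists. -/

section Context

variable {T : Theory} {O : Type} {w : O → ℕ → ℕ} {ι : Type} {n : ι → ℕ} {e : ι → Tree}
  {I : ι → Inst T}

/-- The instances `I i` have size at most `n i`, and their DAGs are computable from `e`. -/
structure Ctx (w : O → ℕ → ℕ) (n : ι → ℕ) (e : ι → Tree) (I : ι → Inst T) : Prop where
  size : ∀ i, (I i).l.length ≤ n i
  dag : PolyTime w n e (fun i => (I i).dag)

/-- A node of `I i`, given by a pointer that is computable from `e`. -/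
structure Ref (w : O → ℕ → ℕ) (n : ι → ℕ) (e : ι → Tree) (I : ι → Inst T)
    (v : ι → T.Message) : Prop where
  mem : ∀ i, v i ∈ (I i).l
  ptr : PolyTime w n e (fun i => (I i).ptr (v i))

theorem Ctx.lift (h : Ctx w n e I) {κ : Type} {π : κ → ι} {e' : κ → Tree}
    (he : Extends w n e π e') : Ctx w (fun k => n (π k)) e' (fun k => I (π k)) :=
  ⟨fun k => h.size (π k), PolyTime.lift h.dag he⟩

theorem Ref.lift {v : ι → T.Message} (h : Ref w n e I v) {κ : Type} {π : κ → ι} {e' : κ → Tree}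
    (he : Extends w n e π e') : Ref w (fun k => n (π k)) e' (fun k => I (π k)) (fun k => v (π k)) :=
  ⟨fun k => h.mem (π k), PolyTime.lift h.ptr he⟩

theorem Extends.of_comp {κ : Type} (π : κ → ι) : Extends w n e π (fun k => e (π k)) :=
  PolyTime.refl _

theorem Ctx.polyLength (h : Ctx w n e I) : PolyLength n (fun i => (I i).l) :=
  ⟨1, 1, fun i => by have := h.size i; simp; omega⟩

theorem Ctx.polyBounded_idxOf [DecidableEq T.Message] (h : Ctx w n e I) {v : ι → T.Message}
    (hv : ∀ i, v i ∈ (I i).l) : PolyBounded n (fun i => (I i).l.idxOf (v i)) :=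
  .of_le fun i => (List.idxOf_lt_length_of_mem (hv i)).le.trans (h.size i)

/-- Since the enumeration has no repetitions, the list of all pointers is just `0, 1, 2, …`. -/
theorem Ctx.ptrs (h : Ctx w n e I) :
    PolyTime w n e (fun i => .ofList ((I i).l.map (I i).ptr)) := by
  classical
  refine (PolyTime.range_length h.polyLength
    (enc := fun i => encodeNode (I i).l (I i).Γ (I i).M) h.dag).congr (fun _ => rfl) fun i => ?_
  rw [← map_idxOf_eq_range (I i).enum.1, List.map_map]
  refine congrArg _ (List.map_congr_left fun v _ => ?_)
  simp only [Inst.ptr, Function.comp_apply]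

theorem Ctx.exists_mem (h : Ctx w n e I) {P : ι → T.Message → Prop}
    (hP : ∀ (κ : Type) (π : κ → ι) (v : κ → T.Message) (e' : κ → Tree), Extends w n e π e' →
      Ref w (fun k => n (π k)) e' (fun k => I (π k)) v →
      PolyDec w (fun k => n (π k)) e' (fun k => P (π k) (v k))) :
    PolyDec w n e (fun i => ∃ v ∈ (I i).l, P i v) :=
  PolyDec.exists_mem h.polyLength h.ptrs fun κ π v e' hv he hp => hP κ π v e' he ⟨hv, hp⟩

theorem Ctx.bits (h : Ctx w n e I) {P : ι → T.Message → Prop}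
    (hP : ∀ (κ : Type) (π : κ → ι) (v : κ → T.Message) (e' : κ → Tree), Extends w n e π e' →
      Ref w (fun k => n (π k)) e' (fun k => I (π k)) v →
      PolyDec w (fun k => n (π k)) e' (fun k => P (π k) (v k))) :
    PolyTime w n e (fun i => (I i).bits {v | v ∈ (I i).l ∧ P i v}) := by
  refine (PolyTime.map (g := fun i v => .ofProp (P i v)) h.polyLength h.ptrs
    fun κ π v e' hv he hp => hP κ π v e' he ⟨hv, hp⟩).congr (fun _ => rfl) fun i => ?_
  refine congrArg _ (List.map_congr_left fun v hv => ?_)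
  simp [hv]

theorem Ref.lookup {v : ι → T.Message} (hv : Ref w n e I v) (h : Ctx w n e I)
    {f : ι → T.Message → Tree} (hf : PolyTime w n e (fun i => .ofList ((I i).l.map (f i)))) :
    PolyTime w n e (fun i => f i (v i)) := by
  classical
  refine (PolyTime.tl_iterate (h.polyBounded_idxOf hv.mem)
    (hv.ptr.congr (fun _ => rfl) fun i => ?_) hf).hd.congr (fun _ => rfl)
    fun i => Tree.hd_tl_iterate_idxOf (hv.mem i) _
  simp only [Inst.ptr]

theorem Ref.mem_bits {v : ι → T.Message} (hv : Ref w n e I v) (h : Ctx w n e I)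
    {χ : ι → Set T.Message} (hχ : PolyTime w n e (fun i => (I i).bits (χ i))) :
    PolyDec w n e (fun i => v i ∈ χ i) :=
  hv.lookup h (f := fun i v => .ofProp (v ∈ χ i)) hχ

theorem Ref.node {v : ι → T.Message} (hv : Ref w n e I v) (h : Ctx w n e I) :
    PolyTime w n e (fun i => encodeNode (I i).l (I i).Γ (I i).M (v i)) :=
  hv.lookup h (f := fun i => encodeNode (I i).l (I i).Γ (I i).M) h.dag

theorem Ref.mem_hyp {v : ι → T.Message} (hv : Ref w n e I v) (h : Ctx w n e I) :
    PolyDec w n e (fun i => v i ∈ (I i).Γ) :=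
  (hv.node h).hd

theorem Ref.eq_goal {v : ι → T.Message} (hv : Ref w n e I v) (h : Ctx w n e I) :
    PolyDec w n e (fun i => v i = (I i).M) :=
  (hv.node h).tl.hd

theorem Ref.label {v : ι → T.Message} (hv : Ref w n e I v) (h : Ctx w n e I) :
    PolyTime w n e (fun i => (v i).label) :=
  (hv.node h).tl.tl.hd

theorem Ref.children {v : ι → T.Message} (hv : Ref w n e I v) (h : Ctx w n e I) :
    PolyTime w n e (fun i => .ofList ((v i).children.map (I i).ptr)) :=
  (hv.node h).tl.tl.tl

theorem polyLength_children (v : ι → T.Message) : PolyLength n (fun i => (v i).children) :=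
  ⟨2 + ∑ f, T.sig.arity f, 0, fun i => by simpa using length_children_le (v i)⟩

theorem Ref.kind {v : ι → T.Message} (hv : Ref w n e I v) (h : Ctx w n e I) (c : ℕ) :
    PolyDec w n e (fun i => (v i).kind = c) := by
  refine PolyDec.nat_eq ⟨6, 0, fun i => by simpa using (v i).kind_le⟩ (.const c) ?_
    (.ofNat_const c)
  exact (hv.label h).hd.congr (fun _ => rfl) fun i => (v i).label_hd

theorem Ref.eq {u v : ι → T.Message} (hu : Ref w n e I u) (hv : Ref w n e I v)
    (h : Ctx w n e I) : PolyDec w n e (fun i => u i = v i) := by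
  classical
  refine (PolyDec.nat_eq (a := fun i => (I i).l.idxOf (u i)) (b := fun i => (I i).l.idxOf (v i))
    (h.polyBounded_idxOf hu.mem) (h.polyBounded_idxOf hv.mem)
    (hu.ptr.congr (fun _ => rfl) fun i => ?_)
    (hv.ptr.congr (fun _ => rfl) fun i => ?_)).congr fun i => List.idxOf_inj (hu.mem i)
  · simp only [Inst.ptr]
  · simp only [Inst.ptr]

theorem Ref.mem_children {u v : ι → T.Message} (hu : Ref w n e I u) (hv : Ref w n e I v)
    (h : Ctx w n e I) : PolyDec w n e (fun i => u i ∈ (v i).children) := by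
  refine PolyDec.congr (PolyDec.exists_mem (L := fun i => (v i).children)
    (enc := fun i => (I i).ptr) (P := fun i x => x = u i) (polyLength_children v) (hv.children h)
    fun κ π x e' hx he hp => ?_) fun i => by simp
  exact Ref.eq ⟨fun k => (I (π k)).child_mem (hv.mem _) (hx k), hp⟩ (hu.lift he) (h.lift he)

theorem Ref.isBin {v : ι → T.Message} (hv : Ref w n e I v) (h : Ctx w n e I) :
    PolyDec w n e (fun i => (v i).IsBin) :=
  (hv.kind h 2).or ((hv.kind h 3).or ((hv.kind h 4).or (hv.kind h 5)))

theorem Ref.left {v : ι → T.Message} (hv : Ref w n e I v) (h : Ctx w n e I)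
    (hb : ∀ i, (v i).IsBin) : Ref w n e I (fun i => (v i).left) :=
  ⟨fun i => (I i).child_mem (hv.mem i) (hb i).left_mem,
    (hv.children h).hd.congr (fun _ => rfl) fun i => by rw [(hb i).children]; rfl⟩

theorem Ref.right {v : ι → T.Message} (hv : Ref w n e I v) (h : Ctx w n e I)
    (hb : ∀ i, (v i).IsBin) : Ref w n e I (fun i => (v i).right) :=
  ⟨fun i => (I i).child_mem (hv.mem i) (hb i).right_mem,
    (hv.children h).tl.hd.congr (fun _ => rfl) fun i => by rw [(hb i).children]; rfl⟩

theorem Ref.left_of_pub {v : ι → T.Message} (hv : Ref w n e I v) (h : Ctx w n e I)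
    (hb : ∀ i, (v i).kind = 1) : Ref w n e I (fun i => (v i).left) := by
  have hc : ∀ i, (v i).children = [(v i).left] := fun i =>
    Msg.children_of_kind_eq_one (hb i)
  exact ⟨fun i => (I i).child_mem (hv.mem i) (by simp [hc i]),
    (hv.children h).hd.congr (fun _ => rfl) fun i => by rw [hc i]; rfl⟩

/-- Iterating an operator on sets of nodes. -/
theorem Ctx.iterate (h : Ctx w n e I) {Op : ι → Set T.Message → Set T.Message}
    {χ₀ : ι → Set T.Message} (h₀ : PolyTime w n e (fun i => (I i).bits (χ₀ i)))
    (hsub₀ : ∀ i, ∀ v ∈ χ₀ i, v ∈ (I i).l) (hsub : ∀ i χ, ∀ v ∈ Op i χ, v ∈ (I i).l)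
    (hOp : ∀ (κ : Type) (π : κ → ι) (χ : κ → Set T.Message) (e' : κ → Tree),
      Extends w n e π e' → (∀ k, ∀ v ∈ χ k, v ∈ (I (π k)).l) →
      PolyTime w (fun k => n (π k)) e' (fun k => (I (π k)).bits (χ k)) →
      PolyTime w (fun k => n (π k)) e' (fun k => (I (π k)).bits (Op (π k) (χ k)))) :
    PolyTime w n e (fun i => (I i).bits ((Op i)^[(I i).l.length] (χ₀ i))) := by
  refine PolyTime.foldr (A := fun i xs => (I i).bits ((Op i)^[xs.length] (χ₀ i)))
    h.polyLength h.ptrs h₀ fun κ π x xs e' _ he _ hχ => ?_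
  refine (hOp κ π (fun k => (Op (π k))^[(xs k).length] (χ₀ (π k))) e' he (fun k v hv => ?_)
    hχ).congr (fun _ => rfl) fun k => ?_
  · cases hx : (xs k).length with
    | zero => rw [hx] at hv; exact hsub₀ _ v hv
    | succ m =>
      rw [hx, Function.iterate_succ_apply'] at hv
      exact hsub _ _ v hv
  · rw [List.length_cons, Function.iterate_succ_apply']

end Context

/-! ### Fixed points of inflationary operators on finite sets -/

/-- Until the iteration becomes stationary each step adds an element: the iterate is stationary at
`m`, or the next one has more than `m` elements. The latter is impossible when `m` is the length of
`l`. -/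
theorem iterate_eq_fixedPoint {α : Type} {l : List α} {Op : Set α → Set α} {χ : Set α}
    (hsub : ∀ χ, ∀ v ∈ Op χ, v ∈ l) (hχ : ∀ v ∈ χ, v ∈ l)
    (hinf : ∀ χ, (∀ v ∈ χ, v ∈ l) → χ ⊆ Op χ) :
    Op (Op^[l.length] χ) = Op^[l.length] χ := by
  classical
  have hl : ∀ m, ∀ v ∈ Op^[m] χ, v ∈ l := by
    intro m
    cases m with
    | zero => exact hχ
    | succ m => rw [Function.iterate_succ_apply']; exact hsub _
  have hfin : ∀ m, (Op^[m] χ).Finite := fun m => l.finite_toSet.subset (hl m)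
  have key : ∀ m, Op (Op^[m] χ) = Op^[m] χ ∨ m < (Op^[m + 1] χ).ncard := by
    intro m
    induction m with
    | zero =>
      by_contra! hne
      have : χ ⊂ Op χ := (hinf χ hχ).ssubset_of_ne fun h => hne.1 h.symm
      have := Set.ncard_lt_ncard this (hfin 1)
      exact absurd hne.2 (by simp only [zero_add, Function.iterate_one]; omega)
    | succ m ih =>
      by_contra! hne
      rcases ih with ih | ih
      · apply hne.1
        rw [Function.iterate_succ_apply', ih, ih]
      · have : Op^[m + 1] χ ⊂ Op (Op^[m + 1] χ) :=
          (hinf _ (hl _)).ssubset_of_ne fun h => hne.1 h.symm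
        rw [show Op (Op^[m + 1] χ) = Op^[m + 1 + 1] χ from
          (Function.iterate_succ_apply' Op _ _).symm] at this
        have := Set.ncard_lt_ncard this (hfin _)
        omega
  refine (key l.length).resolve_right fun h => ?_
  have h₁ := Set.ncard_le_ncard (hl (l.length + 1)) l.finite_toSet
  have h₂ : {v | v ∈ l}.ncard ≤ l.length := by
    have : {v | v ∈ l} = (l.toFinset : Set α) := by ext; simp
    rw [this, Set.ncard_coe_finset]
    exact l.toFinset_card_le
  exact absurd (h.trans_le (h₁.trans h₂)) (lt_irrefl _)

theorem iterate_induction {α : Type} {Op : Set α → Set α} {χ : Set α} {P : α → Prop}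
    (h₀ : ∀ v ∈ χ, P v) (hs : ∀ χ, (∀ v ∈ χ, P v) → ∀ v ∈ Op χ, P v) (m : ℕ) :
    ∀ v ∈ Op^[m] χ, P v := by
  induction m with
  | zero => exact h₀
  | succ m ih => rw [Function.iterate_succ_apply']; exact hs _ ih

/-! ### Elementary deduction queries -/

section Query

variable {T : Theory} {O : Type} {w : O → ℕ → ℕ} {ι : Type} {n : ι → ℕ} {e : ι → Tree}
  {I : ι → Inst T}

/-- One step in the computation of the proper subterms of `X`. -/
def pstStep (I : Inst T) (X χ : Set T.Message) : Set T.Message :=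
  {v | v ∈ I.l ∧ (v ∈ χ ∨ ∃ u ∈ I.l, (u ∈ X ∨ u ∈ χ) ∧ v ∈ u.children)}

theorem pstStep_iterate (I : Inst T) {X : Set T.Message} (hX : ∀ v ∈ X, v ∈ I.l) :
    (pstStep I X)^[I.l.length] ∅ = pst X := by
  have hfix := iterate_eq_fixedPoint (l := I.l) (Op := pstStep I X) (χ := ∅)
    (fun _ _ h => h.1) (fun _ h => h.elim) (fun χ hχ v hv => ⟨hχ v hv, .inl hv⟩)
  have hl : ∀ v ∈ (pstStep I X)^[I.l.length] ∅, v ∈ I.l := by rw [← hfix]; exact fun _ h => h.1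
  apply Set.Subset.antisymm
  · refine iterate_induction (fun _ h => h.elim) (fun χ hχ v hv => ?_) _
    rcases hv.2 with h | ⟨u, -, h | h, hvu⟩
    exacts [hχ v h, mem_pst_of_child h hvu, mem_pst_of_child_pst (hχ u h) hvu]
  · intro v hv
    obtain ⟨x, hx, hvx⟩ := mem_pst_iff.1 hv
    clear hv
    induction hvx using Relation.TransGen.head_induction_on with
    | single h =>
      rw [← hfix]
      exact ⟨I.child_mem (hX x hx) h, .inr ⟨x, hX x hx, .inl hx, h⟩⟩
    | head h _ ih =>
      rw [← hfix]
      exact ⟨I.child_mem (hl _ ih) h, .inr ⟨_, hl _ ih, .inr ih, h⟩⟩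

theorem Ctx.bits_pst (h : Ctx w n e I) {X : ι → Set T.Message}
    (hX : ∀ i, ∀ v ∈ X i, v ∈ (I i).l) (hbX : PolyTime w n e (fun i => (I i).bits (X i))) :
    PolyTime w n e (fun i => (I i).bits (pst (X i))) := by
  refine (h.iterate (Op := fun i => pstStep (I i) (X i)) (χ₀ := fun _ => ∅) ?_
    (fun _ _ h => h.elim) (fun _ _ _ h => h.1) fun κ π χ e' he _ hbχ => ?_).congr (fun _ => rfl)
    fun i => by rw [pstStep_iterate (I i) (hX i)]
  · refine (h.bits (P := fun _ _ => False) fun _ _ _ _ _ _ => PolyDec.const False).congr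
      (fun _ => rfl) fun i => ?_
    simp
  · refine (h.lift he).bits (P := fun k v => v ∈ χ k ∨
      ∃ u ∈ (I (π k)).l, (u ∈ X (π k) ∨ u ∈ χ k) ∧ v ∈ u.children)
      fun κ' π' v e'' he' hv => ?_
    have h' := (h.lift he).lift he'
    refine (hv.mem_bits h' (hbχ.lift he')).or (h'.exists_mem fun κ₃ π₃ u e₃ he₃ hu => ?_)
    have h₃ := h'.lift he₃
    exact ((hu.mem_bits h₃ (((hbX.lift he).lift he').lift he₃)).or
      (hu.mem_bits h₃ ((hbχ.lift he').lift he₃))).and' ((hv.lift he₃).mem_children hu h₃)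

theorem Ctx.bits_St (h : Ctx w n e I) {X : ι → Set T.Message}
    (hX : ∀ i, ∀ v ∈ X i, v ∈ (I i).l) (hbX : PolyTime w n e (fun i => (I i).bits (X i))) :
    PolyTime w n e (fun i => (I i).bits (St (X i))) := by
  have hpst := h.bits_pst hX hbX
  refine (h.bits (P := fun i v => v ∈ X i ∨ v ∈ pst (X i) ∨
    (v.kind = 2 ∧ v.left ∈ pst (X i) ∧ v.right ∈ pst (X i))) fun κ π v e' he hv => ?_).congr
    (fun _ => rfl) fun i => ?_
  · have h' := h.lift he
    refine (hv.mem_bits h' (hbX.lift he)).or ((hv.mem_bits h' (hpst.lift he)).or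
      ((hv.kind h' 2).and fun κ' ρ hρ => ?_))
    have he' := Extends.of_comp (w := w) (n := fun k => n (π k)) (e := e') ρ
    have h'' := h'.lift he'
    have hb : ∀ k, (v (ρ k)).IsBin := fun k => .inl (hρ k)
    exact (((hv.lift he').left h'' hb).mem_bits h'' ((hpst.lift he).lift he')).and'
      (((hv.lift he').right h'' hb).mem_bits h'' ((hpst.lift he).lift he'))
  · refine (I i).bits_congr fun v hv => ?_
    simp only [Set.mem_ofPred_eq, hv, true_and, St, sst, Set.mem_union, or_assoc]
    refine or_congr_right (or_congr_right ⟨fun h => ⟨_, h.2.1, _, h.2.2, Msg.kind_eq_two h.1⟩, ?_⟩)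
    rintro ⟨A, hA, B, hB, rfl⟩
    exact ⟨rfl, hA, hB⟩

/-- Pointers must be renumbered when passing to a sub-DAG: the new position is the number of
retained nodes that come earlier. -/
theorem idxOf_filter {α : Type} [DecidableEq α] {l : List α} (hl : l.Nodup) {p : α → Bool} {a : α}
    (ha : a ∈ l) (hp : p a) :
    (l.filter p).idxOf a = (l.filter fun v => p v && decide (l.idxOf v < l.idxOf a)).length := by
  induction l with
  | nil => simp at ha
  | cons x l ih =>
    obtain ⟨hx, hl⟩ := List.nodup_cons.1 hl
    by_cases hxa : x = a
    · subst hxa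
      simp [hp, List.idxOf_cons_self]
    · have ha' : a ∈ l := (List.mem_cons.1 ha).resolve_left fun h => hxa h.symm
      have hcongr : l.filter (fun v => p v && decide ((x :: l).idxOf v < (x :: l).idxOf a)) =
          l.filter (fun v => p v && decide (l.idxOf v < l.idxOf a)) := by
        refine List.filter_congr fun v hv => ?_
        have hxv : x ≠ v := fun h => hx (h ▸ hv)
        rw [List.idxOf_cons_ne _ hxv, List.idxOf_cons_ne _ hxa]
        simp
      have h0 : (x :: l).idxOf x < (x :: l).idxOf a := by
        rw [List.idxOf_cons_self, List.idxOf_cons_ne _ hxa]; exact Nat.succ_pos _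
      by_cases hpx : p x
      · rw [List.filter_cons_of_pos hpx, List.idxOf_cons_ne _ hxa, ih hl ha',
          List.filter_cons_of_pos (by simp only [hpx, h0]; rfl), hcongr, List.length_cons]
      · rw [List.filter_cons_of_neg hpx, ih hl ha',
          List.filter_cons_of_neg (by simp [hpx]), hcongr]

open Classical in
/-- The instance `χ ⊢ u`, for nodes of `I`. -/
noncomputable def Inst.query (I : Inst T) (χ : Set T.Message) (u : T.Message)
    (hχ : ∀ v ∈ χ, v ∈ I.l) (hu : u ∈ I.l) : Inst T where
  Γ := χ
  M := u
  l := I.l.filter fun v => v ∈ St (insert u χ)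
  normal := fun N hN => hN.elim (fun h => h ▸ I.isNormal hu) fun h => I.isNormal (hχ N h)
  enum := by
    refine ⟨I.enum.1.filter _, fun v => ?_⟩
    simp only [List.mem_filter, decide_eq_true_eq, and_iff_right_iff_imp]
    intro hv
    refine I.mem_iff.2 (St_subset_St ?_ hv)
    exact fun N hN => I.mem_iff.1 (hN.elim (fun h => h ▸ hu) fun h => hχ N h)

open Classical in
/-- The DAG of a query is computable. -/
theorem Ctx.dag_query (h : Ctx w n e I) {χ : ι → Set T.Message} {u : ι → T.Message}
    (hχ : ∀ i, ∀ v ∈ χ i, v ∈ (I i).l) (hu : Ref w n e I u)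
    (hbχ : PolyTime w n e (fun i => (I i).bits (χ i))) :
    PolyTime w n e (fun i => ((I i).query (χ i) (u i) (hχ i) (hu.mem i)).dag) := by
  have hX : ∀ i, ∀ v ∈ insert (u i) (χ i), v ∈ (I i).l := fun i v hv =>
    hv.elim (fun h => h ▸ hu.mem i) fun h => hχ i v h
  have hbX : PolyTime w n e (fun i => (I i).bits (insert (u i) (χ i))) := by
    refine (h.bits (P := fun i v => v = u i ∨ v ∈ χ i) fun κ π v e' he hv => ?_).congr
      (fun _ => rfl) fun i => congrArg _ (Set.ext fun v => and_iff_right_of_imp (hX i v))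
    exact (hv.eq (hu.lift he) (h.lift he)).or (hv.mem_bits (h.lift he) (hbχ.lift he))
  have hSt := h.bits_St hX hbX
  refine PolyTime.filter_map (L := fun i => (I i).l) (enc := fun i => (I i).ptr)
    (P := fun i v => v ∈ St (insert (u i) (χ i)))
    (g := fun i v => encodeNode ((I i).query (χ i) (u i) (hχ i) (hu.mem i)).l (χ i) (u i) v)
    h.polyLength h.ptrs (fun κ π v e' hv he hp => ?_) fun κ π v e' hv hvS he hp => ?_
  · exact Ref.mem_bits ⟨hv, hp⟩ (h.lift he) (hSt.lift he)
  have h' := h.lift he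
  have hr : Ref w (fun k => n (π k)) e' (fun k => I (π k)) v := ⟨hv, hp⟩
  refine (hr.mem_bits h' (hbχ.lift he)).cons ((hr.eq (hu.lift he) h').cons
    ((hr.label h').cons ?_))
  refine PolyTime.map (polyLength_children v) (hr.children h') fun κ' π' x e'' hx he' hpx => ?_
  have h'' := h'.lift he'
  have hrx : Ref w (fun k => n (π (π' k))) e'' (fun k => I (π (π' k))) x :=
    ⟨fun k => (I _).child_mem (hv _) (hx k), hpx⟩
  -- The new pointer to a child is computed as the length of the list of retained nodes in front of
  -- it. The child itself is retained because saturated sets are child-closed.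
  refine (PolyTime.ofNat_length (L := fun k => (I (π (π' k))).l.filter fun v =>
      v ∈ St (insert (u (π (π' k))) (χ (π (π' k)))) ∧
      (I (π (π' k))).l.idxOf v < (I (π (π' k))).l.idxOf (x k))
    (enc := fun _ _ => .nil) ⟨1, 1, fun k => ?_⟩ ?_).congr (fun _ => rfl) fun k => ?_
  · have := h''.size k
    refine (List.length_filter_le _ _).trans ?_
    simp only [one_mul, pow_one]
    omega
  · refine (PolyTime.filter_map (enc := fun k => (I (π (π' k))).ptr) (g := fun _ _ => .nil)
      (P := fun k v => v ∈ St (insert (u (π (π' k))) (χ (π (π' k)))) ∧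
      (I (π (π' k))).l.idxOf v < (I (π (π' k))).l.idxOf (x k)) h''.polyLength h''.ptrs
      (fun κ₃ π₃ y e₃ hy he₃ hpy => ?_) fun κ₃ π₃ y e₃ hy _ he₃ hpy => .nil _).congr
      (fun _ => rfl) fun k => by congr!
    have h₃ := h''.lift he₃
    have hry : Ref w (fun k => n (π (π' (π₃ k)))) e₃ (fun k => I (π (π' (π₃ k)))) y := ⟨hy, hpy⟩
    exact (hry.mem_bits h₃ (((hSt.lift he).lift he').lift he₃)).and'
      (PolyDec.lt (h₃.polyBounded_idxOf hy) hpy (hrx.lift he₃).ptr)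
  · have hxS : x k ∈ St (insert (u (π (π' k))) (χ (π (π' k)))) :=
      childClosed_St _ _ (hvS _) _ (hx k)
    simp only [Inst.query]
    rw [idxOf_filter (I _).enum.1 (hrx.mem k) (by simpa using hxS)]
    simp only [Bool.decide_and]

/-- The elementary deduction problem is decided within the time bounds. -/
def ElemOracle (T : Theory) {O : Type} (w : O → ℕ → ℕ) : Prop :=
  ∀ (κ : Type) (n : κ → ℕ) (J : κ → Inst T), (∀ k, (J k).l.length ≤ n k) →
    PolyDec w n (fun k => (J k).dag) (fun k => Elem T (J k).Γ (J k).M)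

/-- The DAG of the query is a sub-DAG of the input, so the same size bound `n i`, and the same
factor `w`, apply to the call. -/
theorem ElemOracle.polyDec (hO : ElemOracle T w) (h : Ctx w n e I) {χ : ι → Set T.Message}
    {u : ι → T.Message} (hχ : ∀ i, ∀ v ∈ χ i, v ∈ (I i).l) (hu : Ref w n e I u)
    (hbχ : PolyTime w n e (fun i => (I i).bits (χ i))) :
    PolyDec w n e (fun i => Elem T (χ i) (u i)) :=
  (h.dag_query hχ hu hbχ).trans (hO ι n
    (fun i => (I i).query (χ i) (u i) (hχ i) (hu.mem i)) fun i =>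
      (List.length_filter_le _ _).trans (h.size i))

end Query

/-! ### Saturation -/

section Saturation

variable {T : Theory} {O : Type} {w : O → ℕ → ℕ} {ι : Type} {n : ι → ℕ} {e : ι → Tree}
  {I : ι → Inst T}

/-- The message `v` is obtained by eliminating the head constructor of `u`, or by unblinding `u`,
with side premises in `χ`. -/
def Elim (I : Inst T) (χ : Set T.Message) (u v : T.Message) : Prop :=
  (u.kind = 4 ∧ (u.left = v ∨ u.right = v)) ∨
  ((u.kind = 5 ∨ u.kind = 3) ∧ u.left = v ∧ u.right ∈ χ) ∨
  (u.kind = 2 ∧ u.left = v ∧ ∃ x ∈ I.l, x.kind = 1 ∧ x ∈ χ ∧ ACEq T u.right x.left) ∨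
  ((v.kind = 2 ∧ u.kind = 2) ∧ u.left.kind = 3 ∧ v.left = u.left.left ∧ v.right = u.right ∧
    u.left.right ∈ χ)

/-- One step of the saturation. -/
def satStep (I : Inst T) (χ : Set T.Message) : Set T.Message :=
  {v | v ∈ I.l ∧ (v ∈ χ ∨ Elem T χ v ∨ (v.IsBin ∧ v.left ∈ χ ∧ v.right ∈ χ) ∨
    ∃ u ∈ I.l, u ∈ χ ∧ Elim I χ u v)}

/-- The nodes of the DAG that are derivable from the hypotheses. -/
def sat (I : Inst T) : Set T.Message := (satStep I)^[I.l.length] I.Γ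

theorem satStep_sat (I : Inst T) : satStep I (sat I) = sat I :=
  iterate_eq_fixedPoint (fun _ _ h => h.1) (fun _ => I.hyp_mem)
    (fun _ hχ v hv => ⟨hχ v hv, .inl hv⟩)

theorem hyp_subset_sat (I : Inst T) : I.Γ ⊆ sat I := by
  have : ∀ m, I.Γ ⊆ (satStep I)^[m] I.Γ := by
    intro m
    induction m with
    | zero => exact subset_rfl
    | succ m ih =>
      rw [Function.iterate_succ_apply']
      exact fun v hv => ⟨I.hyp_mem hv, .inl (ih hv)⟩
  exact this _

theorem Elim.natDed {I : Inst T} {Γ χ : Set T.Message} (hχ : ∀ v ∈ χ, NatDed T Γ v)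
    {u v : T.Message} (hu : NatDed T Γ u) (h : Elim I χ u v) : NatDed T Γ v := by
  rcases h with ⟨hk, h⟩ | ⟨hk | hk, rfl, hr⟩ | ⟨hk, rfl, x, -, hx, hxχ, hK⟩ |
    ⟨⟨hv, hk⟩, hk', h₁, h₂, hR⟩
  · rw [Msg.kind_eq_four hk] at hu
    rcases h with rfl | rfl
    exacts [.pair_elim₁ hu, .pair_elim₂ hu]
  · rw [Msg.kind_eq_five hk] at hu
    exact .enc_elim hu (hχ _ hr)
  · rw [Msg.kind_eq_three hk] at hu
    exact .blind_elim₁ hu (hχ _ hr)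
  · rw [Msg.kind_eq_two hk] at hu
    have hx' := hχ _ hxχ
    rw [Msg.kind_eq_one hx] at hx'
    exact .sign_elim hu (.conv hx' hK.eqE.pub)
  · rw [Msg.kind_eq_two hk, Msg.kind_eq_three hk'] at hu
    rw [Msg.kind_eq_two hv, h₁, h₂]
    exact .blind_elim₂ hu (hχ _ hR)

theorem natDed_of_mem_sat (I : Inst T) : ∀ v ∈ sat I, NatDed T I.Γ v := by
  refine iterate_induction (fun v hv => .id hv) (fun χ hχ v hv => ?_) _
  rcases hv.2 with h | h | ⟨hb, hl, hr⟩ | ⟨u, -, hu, h⟩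
  · exact hχ v h
  · exact h.natDed.bind hχ
  · have h₁ := hχ _ hl
    have h₂ := hχ _ hr
    rcases hb with hk | hk | hk | hk
    · rw [Msg.kind_eq_two hk]; exact .sign_intro h₁ h₂
    · rw [Msg.kind_eq_three hk]; exact .blind_intro h₁ h₂
    · rw [Msg.kind_eq_four hk]; exact .pair_intro h₁ h₂
    · rw [Msg.kind_eq_five hk]; exact .enc_intro h₁ h₂
  · exact h.natDed hχ (hχ u hu)

/-- A fixed point of `satStep` absorbs every rule whose conclusion is a node. Conclusions of
destructor rules are children of nodes, except for unblinding, whose conclusion is a node by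
saturation of the DAG. -/
theorem closed_sat (I : Inst T) : Closed T {v | v ∈ I.l} (sat I) := by
  have hfix := satStep_sat I
  have hl : ∀ {v}, v ∈ sat I → v ∈ I.l := by rw [← hfix]; exact fun h => h.1
  have elim : ∀ {u v}, u ∈ sat I → v ∈ I.l → Elim I (sat I) u v → v ∈ sat I := by
    intro u v hu hv h
    rw [← hfix]
    exact ⟨hv, .inr (.inr (.inr ⟨u, hl hu, hu, h⟩))⟩
  have child : ∀ {u v : T.Message}, u ∈ sat I → v ∈ u.children → v ∈ I.l :=
    fun hu hv => I.child_mem (hl hu) hv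
  refine ⟨fun v => hl, fun hv h => ?_, fun hv hb h₁ h₂ => ?_, fun h => ⟨?_, ?_⟩, fun h hK => ?_,
    fun h hL hKL => ?_, fun h hK => ?_, fun h hR => ?_⟩
  · rw [← hfix]; exact ⟨hv, .inr (.inl h)⟩
  · rw [← hfix]; exact ⟨hv, .inr (.inr (.inl ⟨hb, h₁, h₂⟩))⟩
  · exact elim h (child h (by simp [Msg.children])) (.inl ⟨rfl, .inl rfl⟩)
  · exact elim h (child h (by simp [Msg.children])) (.inl ⟨rfl, .inr rfl⟩)
  · exact elim h (child h (by simp [Msg.children])) (.inr (.inl ⟨.inl rfl, rfl, hK⟩))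
  · exact elim h (child h (by simp [Msg.children]))
      (.inr (.inr (.inl ⟨rfl, rfl, _, hl hL, rfl, hL, hKL⟩)))
  · exact elim h (child h (by simp [Msg.children])) (.inr (.inl ⟨.inr rfl, rfl, hK⟩))
  · exact elim h (I.mem_iff.2 (unblind_mem_St (I.mem_iff.1 (hl h))))
      (.inr (.inr (.inr ⟨⟨rfl, rfl⟩, rfl, rfl, rfl, hR⟩)))

theorem goal_mem_sat_iff (hT : ACConvergent T) (I : Inst T) : I.M ∈ sat I ↔ NatDed T I.Γ I.M :=
  (closed_sat I).mem_iff_natDed hT (fun _ hv _ hu => I.child_mem hv hu) (fun _ hv => I.isNormal hv)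
    (hyp_subset_sat I) (natDed_of_mem_sat I) I.goal_mem

/-- AC-equality is not computed by comparing terms but delegated to the oracle, as the question
whether `sign L L` follows from `sign K K`. These two nodes are found by searching the DAG, hence
the hypotheses that they occur in it. -/
theorem ElemOracle.acEq (hT : ACConvergent T) (hO : ElemOracle T w) (h : Ctx w n e I)
    {K L : ι → T.Message} (hK : Ref w n e I K) (hL : Ref w n e I L)
    (hK' : ∀ i, .sign (K i) (K i) ∈ (I i).l) (hL' : ∀ i, .sign (L i) (L i) ∈ (I i).l) :
    PolyDec w n e (fun i => ACEq T (K i) (L i)) := by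
  refine PolyDec.congr (h.exists_mem (P := fun i y => y.kind = 2 ∧ (y.left = K i ∧ y.right = K i) ∧
    ∃ z ∈ (I i).l, z.kind = 2 ∧ (z.left = L i ∧ z.right = L i) ∧ Elem T {y} z)
    fun κ π y e' he hy => ?_) fun i => ?_
  · have h₁ := h.lift he
    have hK₁ := hK.lift he
    have hL₁ := hL.lift he
    refine (hy.kind h₁ 2).and fun κ' ρ hρ => ?_
    have he' := Extends.of_comp (w := w) (n := fun k => n (π k)) (e := e') ρ
    have h₂ := h₁.lift he'
    have hy₂ := hy.lift he'
    have hyb : ∀ k, (y (ρ k)).IsBin := fun k => .inl (hρ k)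
    refine (((hy₂.left h₂ hyb).eq (hK₁.lift he') h₂).and'
      ((hy₂.right h₂ hyb).eq (hK₁.lift he') h₂)).and' ?_
    refine h₂.exists_mem fun κ₃ π₃ z e₃ he₃ hz => ?_
    have h₃ := h₂.lift he₃
    refine (hz.kind h₃ 2).and fun κ₄ ρ₄ hρ₄ => ?_
    have he₄ := Extends.of_comp (w := w) (n := fun k => n (π (ρ (π₃ k)))) (e := e₃) ρ₄
    have h₄ := h₃.lift he₄
    have hz₄ := hz.lift he₄
    have hzb : ∀ k, (z (ρ₄ k)).IsBin := fun k => .inl (hρ₄ k)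
    refine (((hz₄.left h₄ hzb).eq (((hL₁.lift he').lift he₃).lift he₄) h₄).and'
      ((hz₄.right h₄ hzb).eq (((hL₁.lift he').lift he₃).lift he₄) h₄)).and' ?_
    have hy₄ := (hy₂.lift he₃).lift he₄
    refine hO.polyDec h₄ (fun k v hv => Set.mem_singleton_iff.1 hv ▸ hy₄.mem k) hz₄ ?_
    refine (h₄.bits (P := fun k v => v = y (ρ (π₃ (ρ₄ k))))
      fun κ₅ π₅ v e₅ he₅ hv => hv.eq (hy₄.lift he₅) (h₄.lift he₅)).congr (fun _ => rfl) fun k =>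
      Inst.bits_congr _ fun v hv => ?_
    exact ⟨fun h => h.2, fun h => ⟨hv, h⟩⟩
  · have hc : ∀ {A : T.Message}, .sign A A ∈ (I i).l → IsNormal T A := fun {A} hA =>
      (I i).isNormal ((I i).child_mem hA (by simp [Msg.children]))
    rw [acEq_iff_elem_sign hT (hc (hK' i)) (hc (hL' i))]
    constructor
    · rintro ⟨y, -, hy, ⟨hy₁, hy₂⟩, z, -, hz, ⟨hz₁, hz₂⟩, h⟩
      rwa [Msg.kind_eq_two hy, Msg.kind_eq_two hz, hy₁, hy₂, hz₁, hz₂] at h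
    · exact fun h => ⟨_, hK' i, rfl, ⟨rfl, rfl⟩, _, hL' i, rfl, ⟨rfl, rfl⟩, h⟩

/-- A child of a node is a proper subterm of the sequent, and the saturated set contains every
`sign` of two proper subterms, in particular the diagonal ones needed for AC tests. -/
theorem Inst.sign_self_mem (I : Inst T) {u v : T.Message} (hu : u ∈ I.l) (hv : v ∈ u.children) :
    .sign v v ∈ I.l :=
  have := mem_pst_of_child_St (I.mem_iff.1 hu) hv
  I.mem_iff.2 (sign_mem_St this this)

theorem ElemOracle.elim (hT : ACConvergent T) (hO : ElemOracle T w) (h : Ctx w n e I)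
    {χ : ι → Set T.Message} {u v : ι → T.Message}
    (hbχ : PolyTime w n e (fun i => (I i).bits (χ i))) (hu : Ref w n e I u)
    (hv : Ref w n e I v) : PolyDec w n e (fun i => Elim (I i) (χ i) (u i) (v i)) := by
  refine PolyDec.or ?_ (PolyDec.or ?_ (PolyDec.or ?_ ?_))
  · refine (hu.kind h 4).and fun κ ρ hρ => ?_
    have he := Extends.of_comp (w := w) (n := n) (e := e) ρ
    have h' := h.lift he
    have hb : ∀ k, (u (ρ k)).IsBin := fun k => .inr (.inr (.inl (hρ k)))
    exact (((hu.lift he).left h' hb).eq (hv.lift he) h').or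
      (((hu.lift he).right h' hb).eq (hv.lift he) h')
  · refine ((hu.kind h 5).or (hu.kind h 3)).and fun κ ρ hρ => ?_
    have he := Extends.of_comp (w := w) (n := n) (e := e) ρ
    have h' := h.lift he
    have hb : ∀ k, (u (ρ k)).IsBin := fun k =>
      (hρ k).elim (fun h => .inr (.inr (.inr h))) fun h => .inr (.inl h)
    exact (((hu.lift he).left h' hb).eq (hv.lift he) h').and'
      (((hu.lift he).right h' hb).mem_bits h' (hbχ.lift he))
  · refine (hu.kind h 2).and fun κ ρ hρ => ?_
    have he := Extends.of_comp (w := w) (n := n) (e := e) ρ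
    have h' := h.lift he
    have hb : ∀ k, (u (ρ k)).IsBin := fun k => .inl (hρ k)
    refine (((hu.lift he).left h' hb).eq (hv.lift he) h').and' ?_
    refine h'.exists_mem fun κ₂ π₂ x e₂ he₂ hx => ?_
    have h₂ := h'.lift he₂
    refine (hx.kind h₂ 1).and fun κ₃ ρ₃ hρ₃ => ?_
    have he₃ := Extends.of_comp (w := w) (n := fun k => n (ρ (π₂ k))) (e := e₂) ρ₃
    have h₃ := h₂.lift he₃
    have hx₃ := hx.lift he₃
    refine (hx₃.mem_bits h₃ (((hbχ.lift he).lift he₂).lift he₃)).and' ?_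
    refine hO.acEq hT h₃ ((((hu.lift he).right h' hb).lift he₂).lift he₃)
      (hx₃.left_of_pub h₃ hρ₃) (fun k => ?_) fun k => ?_
    · exact Inst.sign_self_mem _ (hu.mem _) (hb _).right_mem
    · exact Inst.sign_self_mem _ (hx₃.mem _)
        (by rw [Msg.children_of_kind_eq_one (hρ₃ k)]; exact List.mem_cons_self)
  · refine ((hv.kind h 2).and' (hu.kind h 2)).and fun κ ρ hρ => ?_
    have he := Extends.of_comp (w := w) (n := n) (e := e) ρ
    have h' := h.lift he
    have hub : ∀ k, (u (ρ k)).IsBin := fun k => .inl (hρ k).2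
    have hvb : ∀ k, (v (ρ k)).IsBin := fun k => .inl (hρ k).1
    have hul := (hu.lift he).left h' hub
    refine (hul.kind h' 3).and fun κ₂ ρ₂ hρ₂ => ?_
    have he₂ := Extends.of_comp (w := w) (n := fun k => n (ρ k)) (e := fun k => e (ρ k)) ρ₂
    have h₂ := h'.lift he₂
    have hub₂ : ∀ k, (u (ρ (ρ₂ k))).left.IsBin := fun k => .inr (.inl (hρ₂ k))
    have hul₂ := hul.lift he₂
    exact ((((hv.lift he).left h' hvb).lift he₂).eq (hul₂.left h₂ hub₂) h₂).and'
      (((((hv.lift he).right h' hvb).lift he₂).eq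
        (((hu.lift he).right h' hub).lift he₂) h₂).and'
        ((hul₂.right h₂ hub₂).mem_bits h₂ ((hbχ.lift he).lift he₂)))

theorem ElemOracle.bits_sat (hT : ACConvergent T) (hO : ElemOracle T w) (h : Ctx w n e I) :
    PolyTime w n e (fun i => (I i).bits (sat (I i))) := by
  refine h.iterate (Op := fun i => satStep (I i)) (χ₀ := fun i => (I i).Γ) ?_
    (fun i v => (I i).hyp_mem) (fun _ _ _ h => h.1) fun κ π χ e' he hχ hbχ => ?_
  · refine (h.bits (P := fun i v => v ∈ (I i).Γ) fun κ π v e' he hv => hv.mem_hyp (h.lift he)).congr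
      (fun _ => rfl) fun i => Inst.bits_congr _ fun v hv => ?_
    exact ⟨fun h => h.2, fun h => ⟨hv, h⟩⟩
  · have h₁ := h.lift he
    refine h₁.bits (P := fun k v => v ∈ χ k ∨ Elem T (χ k) v ∨
      (v.IsBin ∧ v.left ∈ χ k ∧ v.right ∈ χ k) ∨
      ∃ u ∈ (I (π k)).l, u ∈ χ k ∧ Elim (I (π k)) (χ k) u v) fun κ₂ π₂ v e₂ he₂ hv => ?_
    have h₂ := h₁.lift he₂
    have hbχ₂ := hbχ.lift he₂
    refine (hv.mem_bits h₂ hbχ₂).or ((hO.polyDec h₂ (fun k => hχ _) hv hbχ₂).or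
      (PolyDec.or ?_ ?_))
    · refine (hv.isBin h₂).and fun κ₃ ρ hρ => ?_
      have he₃ := Extends.of_comp (w := w) (n := fun k => n (π (π₂ k))) (e := e₂) ρ
      have h₃ := h₂.lift he₃
      exact (((hv.lift he₃).left h₃ hρ).mem_bits h₃ (hbχ₂.lift he₃)).and'
        (((hv.lift he₃).right h₃ hρ).mem_bits h₃ (hbχ₂.lift he₃))
    · refine h₂.exists_mem fun κ₃ π₃ u e₃ he₃ hu => ?_
      have h₃ := h₂.lift he₃
      exact (hu.mem_bits h₃ (hbχ₂.lift he₃)).and'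
        (hO.elim hT h₃ (hbχ₂.lift he₃) hu (hv.lift he₃))

/-- Membership of the goal in a computable set of nodes. -/
theorem Ctx.goal_mem_bits (h : Ctx w n e I) {χ : ι → Set T.Message}
    (hbχ : PolyTime w n e (fun i => (I i).bits (χ i))) :
    PolyDec w n e (fun i => (I i).M ∈ χ i) := by
  refine PolyDec.congr (h.exists_mem (P := fun i v => v = (I i).M ∧ v ∈ χ i)
    fun κ π v e' he hv => (hv.eq_goal (h.lift he)).and' (hv.mem_bits (h.lift he) (hbχ.lift he)))
    fun i => ⟨?_, fun hM => ⟨_, (I i).goal_mem, rfl, hM⟩⟩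
  rintro ⟨v, -, rfl, hv⟩
  exact hv

theorem ElemOracle.natDed (hT : ACConvergent T) (hO : ElemOracle T w) (h : Ctx w n e I) :
    PolyDec w n e (fun i => NatDed T (I i).Γ (I i).M) :=
  (h.goal_mem_bits (hO.bits_sat hT h)).congr fun i => goal_mem_sat_iff hT (I i)

end Saturation

/-! ### Elementary deduction in the empty theory -/

section EmptyTheory

variable {T : Theory} {O : Type} {w : O → ℕ → ℕ} {ι : Type} {n : ι → ℕ} {e : ι → Tree}
  {I : ι → Inst T}

theorem EqE.eq_of_empty (hR : T.rules = ∅) (hac : T.ac = none) {M N : T.Message}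
    (h : EqE T M N) : M = N := by
  have hA : ∀ {M N : T.Message}, ACEq T M N → M = N := by
    intro M N h
    induction h with
    | comm hf => simp [hac] at hf
    | assoc hf => simp [hac] at hf
    | refl => rfl
    | symm _ ih => exact ih.symm
    | trans _ _ ih₁ ih₂ => exact ih₁.trans ih₂
    | app _ ih => exact congrArg _ (funext ih)
    | pub _ ih => rw [ih]
    | _ _ _ ih₁ ih₂ => rw [ih₁, ih₂]
  have hW : ∀ {M N : T.Message}, ¬ Rew T M N := by
    intro M N h
    induction h with
    | root hr => simp [hR] at hr
    | _ => assumption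
  induction h with
  | rel _ _ h => exact h.elim hA fun h => (hW h).elim
  | refl => rfl
  | symm _ _ _ ih => exact ih.symm
  | trans _ _ _ _ _ ih₁ ih₂ => exact ih₁.trans ih₂

/-- One step in the computation of the nodes deducible in the empty theory. -/
def elemStep (I : Inst T) (χ : Set T.Message) : Set T.Message :=
  {v | v ∈ I.l ∧ (v ∈ χ ∨ (v.kind = 6 ∧ ∀ u ∈ v.children, u ∈ χ))}

theorem goal_mem_elemStep_iff (hR : T.rules = ∅) (hac : T.ac = none) (I : Inst T) :
    I.M ∈ (elemStep I)^[I.l.length] I.Γ ↔ Elem T I.Γ I.M := by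
  rw [elem_iff_elemI]
  have hfix := iterate_eq_fixedPoint (l := I.l) (Op := elemStep I) (χ := I.Γ)
    (fun _ _ h => h.1) (fun _ => I.hyp_mem) (fun χ hχ v hv => ⟨hχ v hv, .inl hv⟩)
  have hΓ : ∀ m, I.Γ ⊆ (elemStep I)^[m] I.Γ := by
    intro m
    induction m with
    | zero => exact subset_rfl
    | succ m ih =>
      rw [Function.iterate_succ_apply']
      exact fun v hv => ⟨I.hyp_mem hv, .inl (ih hv)⟩
  constructor
  · refine iterate_induction (fun v hv => .id hv) (fun χ hχ v hv => ?_) _ I.M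
    rcases hv.2 with h | ⟨hk, h⟩
    · exact hχ v h
    · cases v with
      | app f a => exact .app fun i => hχ _ (h _ (by simp [Msg.children]))
      | _ => simp [Msg.kind] at hk
  -- No intermediate message leaves the DAG: with `≈` being identity, a deduction of a node proceeds
  -- through its children.
  · have : ∀ M, ElemI T I.Γ M → M ∈ I.l → M ∈ (elemStep I)^[I.l.length] I.Γ := by
      intro M h
      induction h with
      | id h => exact fun _ => hΓ _ h
      | @app f a _ ih =>
        intro hl
        rw [← hfix]
        refine ⟨hl, .inr ⟨rfl, fun u hu => ?_⟩⟩
        have hu' := hu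
        simp only [Msg.children, List.mem_ofFn] at hu'
        obtain ⟨i, rfl⟩ := hu'
        exact ih i (I.child_mem hl hu)
      | conv _ h ih => rw [h.eq_of_empty hR hac]; exact ih
    exact fun h => this _ h I.goal_mem

theorem Ctx.elem_of_empty (hR : T.rules = ∅) (hac : T.ac = none) (h : Ctx w n e I) :
    PolyDec w n e (fun i => Elem T (I i).Γ (I i).M) := by
  refine (h.goal_mem_bits ?_).congr fun i => goal_mem_elemStep_iff hR hac (I i)
  refine h.iterate (Op := fun i => elemStep (I i)) (χ₀ := fun i => (I i).Γ) ?_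
    (fun i v => (I i).hyp_mem) (fun _ _ _ h => h.1) fun κ π χ e' he hχ hbχ => ?_
  · refine (h.bits (P := fun i v => v ∈ (I i).Γ) fun κ π v e' he hv => hv.mem_hyp (h.lift he)).congr
      (fun _ => rfl) fun i => Inst.bits_congr _ fun v hv => ?_
    exact ⟨fun h => h.2, fun h => ⟨hv, h⟩⟩
  · have h₁ := h.lift he
    refine h₁.bits (P := fun k v => v ∈ χ k ∨ (v.kind = 6 ∧ ∀ u ∈ v.children, u ∈ χ k))
      fun κ₂ π₂ v e₂ he₂ hv => ?_
    have h₂ := h₁.lift he₂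
    have hbχ₂ := hbχ.lift he₂
    refine (hv.mem_bits h₂ hbχ₂).or ((hv.kind h₂ 6).and' ?_)
    refine PolyDec.forall_mem (polyLength_children v) (hv.children h₂)
      fun κ₃ π₃ x e₃ hx he₃ hp => ?_
    exact Ref.mem_bits ⟨fun k => (I _).child_mem (hv.mem _) (hx k), hp⟩ (h₂.lift he₃)
      (hbχ₂.lift he₃)

end EmptyTheory

/-! ### Complexity of deduction problems -/

section Complexity

variable {T : Theory}

theorem Exec.pos {p : Prog} {s s' : Store} {t : ℕ} (h : Exec p s t s') : 0 < t := by
  induction h <;> omega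

/-- Every execution takes at least one step, so a time bound cannot vanish at the size of an actual
instance. This permits replacing `f + 1` by `2 * f`. -/
theorem HasComplexity.pos {D : Set T.Message → T.Message → Prop} {g : ℕ → ℕ}
    (h : HasComplexity T D g) (I : Inst T) : 0 < g I.l.length := by
  obtain ⟨p, c, h⟩ := h
  obtain ⟨t, s, h₁, h₂, -⟩ := h I.Γ I.M I.l I.normal I.enum
  rw [I.ncard] at h₂
  exact Nat.pos_of_mul_pos_left (h₁.pos.trans_le h₂)

theorem PolyDec.exists_hasComplexity {O : Type} {w : O → ℕ → ℕ}
    {D : Set T.Message → T.Message → Prop}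
    (h : PolyDec w (fun I : Inst T => I.l.length) (fun I => I.dag) (fun I => D I.Γ I.M)) :
    ∃ k, ∀ o, HasComplexity T D (fun n => n ^ k * (w o n + 1)) := by
  obtain ⟨k, h⟩ := h
  refine ⟨k, fun o => ?_⟩
  obtain ⟨p, N, c, h⟩ := h o
  -- The node list contains the goal, so its length `n` is positive and `n + 1 ≤ 2 * n`; this costs
  -- the factor `2 ^ k`.
  refine ⟨p, c * 2 ^ k, fun Γ M l hN hl => ?_⟩
  let I : Inst T := ⟨Γ, M, l, hN, hl⟩
  obtain ⟨t, s, h₁, h₂, h₃, -⟩ := h I (initStore I.dag) (by simp [initStore])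
  refine ⟨t, s, h₁, h₂.trans ?_, ?_⟩
  · rw [I.ncard, mul_assoc, mul_assoc, ← mul_assoc (2 ^ k), ← mul_pow]
    have : 0 < I.l.length := List.length_pos_of_mem I.goal_mem
    gcongr
    show I.l.length + 1 ≤ 2 * I.l.length
    omega
  · rw [h₃]
    by_cases hD : D Γ M <;> simp [Tree.ofProp, I, hD]

theorem HasComplexity.congr {D D' : Set T.Message → T.Message → Prop} {g g' : ℕ → ℕ} (a : ℕ)
    (h : HasComplexity T D g) (hg : ∀ I : Inst T, g I.l.length ≤ a * g' I.l.length)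
    (hD : ∀ I : Inst T, D I.Γ I.M ↔ D' I.Γ I.M) : HasComplexity T D' g' := by
  obtain ⟨p, c, h⟩ := h
  refine ⟨p, c * a, fun Γ M l hN hl => ?_⟩
  obtain ⟨t, s, h₁, h₂, h₃⟩ := h Γ M l hN hl
  let I : Inst T := ⟨Γ, M, l, hN, hl⟩
  refine ⟨t, s, h₁, h₂.trans ?_, h₃.trans (hD I)⟩
  rw [I.ncard, mul_assoc]
  exact Nat.mul_le_mul_left _ (hg I)

/-- A decision program for elementary deduction can be called as a subroutine. -/
theorem elemOracle (T : Theory) :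
    ElemOracle T (fun o : {f : ℕ → ℕ // Monotone f ∧ HasComplexity T (Elem T) f} => o.1) := by
  intro κ n J hJ
  -- The exponent is 0: apart from a constant overhead, the whole time is charged to the factor `f`.
  refine ⟨0, fun ⟨f, hf, p, c, h⟩ => ?_⟩
  let m := p.bound
  refine ⟨.seq (.clear m) (.seq p (.ite (.reg 0) (.assign 0 (.cons .nil .nil)) (.assign 0 .nil))),
    m + 1, c + 2 * (m + 1) + 10, fun k s hs => ?_⟩
  -- The subroutine expects an initial store. Clearing all registers it can see, except the input
  -- register, is enough by `Exec.frame`; the rest of the caller's store survives.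
  obtain ⟨s₁, e₁, h₀, h₁, h₂⟩ := Exec.clear m s
  obtain ⟨t, s₂, e₂, ht, hD⟩ := h (J k).Γ (J k).M (J k).l (J k).normal (J k).enum
  obtain ⟨r, e₃, h₃, h₄⟩ := e₂.frame (m + 1) (Nat.le_succ _) s₁ (by
    intro i hi
    rcases Nat.eq_zero_or_pos i with rfl | hpos
    · rw [h₀, hs]; simp [initStore, Inst.dag]
    · rw [h₁ i hpos (by omega)]
      simp only [initStore]
      rw [Function.update_of_ne (by omega)])
  rw [(J k).ncard] at ht
  have ht' : t ≤ c * f (n k) := ht.trans (Nat.mul_le_mul_left _ (hf (hJ k)))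
  have hbd : 2 * (m + 1) + t + 10 ≤ (c + 2 * (m + 1) + 10) * (n k + 1) ^ 0 * (f (n k) + 1) := by
    have : (c + 2 * (m + 1) + 10) * (n k + 1) ^ 0 * (f (n k) + 1) =
      c * f (n k) + c + (2 * (m + 1) + 10) * f (n k) + (2 * (m + 1) + 10) := by ring
    omega
  rw [← h₃ 0 (Nat.succ_pos _)] at hD
  by_cases hE : Elem T (J k).Γ (J k).M
  · refine ⟨_, _, .seq e₁ (.seq e₃ (.ite_true (hD.2 hE) (.assign 0 _ r))), ?_, ?_, fun j hj => ?_⟩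
    · simp only [Expr.cost]; omega
    · simp [Tree.ofProp, hE, Expr.eval]
    · rw [Function.update_of_ne (by omega), h₄ j hj, h₂ j (by omega)]
  · refine ⟨_, _, .seq e₁ (.seq e₃ (.ite_false (not_not.1 fun h => hE (hD.1 h)) (.assign 0 _ r))),
      ?_, ?_, fun j hj => ?_⟩
    · simp only [Expr.cost]; omega
    · simp [Tree.ofProp, hE, Expr.eval]
    · rw [Function.update_of_ne (by omega), h₄ j hj, h₂ j (by omega)]

/-- The exponent must be chosen before the bound `f`. This is why the oracle index ranges over all
admissible `f` simultaneously and `PolyTime` fixes its exponent first. -/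
theorem polyReducible_of_iff_natDed (hT : ACConvergent T)
    {D : Set T.Message → T.Message → Prop}
    (hD : ∀ I : Inst T, NatDed T I.Γ I.M ↔ D I.Γ I.M) : PolyReducible T D := by
  obtain ⟨k, h⟩ := ((elemOracle T).natDed hT (I := fun I : Inst T => I)
    ⟨fun _ => le_rfl, .refl _⟩).exists_hasComplexity (D := NatDed T)
  refine ⟨k, fun f hf hE => (h ⟨f, hf, hE⟩).congr 2 (fun I => ?_) hD⟩
  have := hE.pos I
  calc I.l.length ^ k * (f I.l.length + 1) ≤ I.l.length ^ k * (2 * f I.l.length) := by gcongr; omega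
    _ = _ := by ring

theorem PolyReducible.inPTime (hR : T.rules = ∅) (hac : T.ac = none)
    {D : Set T.Message → T.Message → Prop} (h : PolyReducible T D) : InPTime T D := by
  obtain ⟨k, h⟩ := h
  -- No oracle is called here, so a single trivial one of cost 0 serves.
  obtain ⟨k', h'⟩ := ((Ctx.elem_of_empty (w := fun (_ : Unit) _ => 0) hR hac
    (I := fun I : Inst T => I) ⟨fun _ => le_rfl, .refl _⟩).exists_hasComplexity (D := Elem T))
  refine ⟨k + k', (h (fun n => n ^ k') (fun a b hab => Nat.pow_le_pow_left hab k')
    ((h' ()).congr 1 (fun I => by simp) fun _ => Iff.rfl)).congr 1 (fun I => ?_) fun _ => Iff.rfl⟩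
  simp [pow_add]

theorem Inst.finite_hyp (I : Inst T) : I.Γ.Finite :=
  I.l.finite_toSet.subset fun _ => I.hyp_mem

end Complexity

end Intruder

/-! ### The main theorem. -/

theorem mainTheorem3 (T : Intruder.Theory) (hT : Intruder.ACConvergent T) :
    Intruder.PolyReducible T (Intruder.LinDed T) ∧
    Intruder.PolyReducible T (Intruder.SeqDed T) ∧
    Intruder.PolyReducible T (Intruder.NatDed T) ∧
    (∀ (Γ : Set T.Message) (M : T.Message), Γ.Finite → Intruder.NormalSequent T Γ M →
      ((Intruder.LinDed T Γ M ↔ Intruder.SeqDed T Γ M) ∧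
        (Intruder.SeqDed T Γ M ↔ Intruder.NatDed T Γ M))) ∧
    (T.rules = ∅ → T.ac = none →
      Intruder.InPTime T (Intruder.LinDed T) ∧
      Intruder.InPTime T (Intruder.SeqDed T) ∧
      Intruder.InPTime T (Intruder.NatDed T)) := by
  have hL : Intruder.PolyReducible T (Intruder.LinDed T) :=
    Intruder.polyReducible_of_iff_natDed hT fun I =>
      (Intruder.linDed_iff_natDed hT I.finite_hyp I.normal).symm
  have hS : Intruder.PolyReducible T (Intruder.SeqDed T) :=
    Intruder.polyReducible_of_iff_natDed hT fun I =>
      (Intruder.seqDed_iff_natDed hT I.finite_hyp I.normal).symm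
  have hN : Intruder.PolyReducible T (Intruder.NatDed T) :=
    Intruder.polyReducible_of_iff_natDed hT fun I => Iff.rfl
  refine ⟨hL, hS, hN, fun Γ M hΓ hM => ?_, fun hR hac => ⟨hL.inPTime hR hac, hS.inPTime hR hac,
    hN.inPTime hR hac⟩⟩
  have h₁ := Intruder.linDed_iff_natDed hT hΓ hM
  have h₂ := Intruder.seqDed_iff_natDed hT hΓ hM
  exact ⟨h₁.trans h₂.symm, h₂⟩
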